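/- **Problem.** An instance of FLaMECaST (Flow-weighted Layered Minimal Euclidean Capacitated Steiner Tree) with $\lambda$ intermediate layers consists of finitely many sources and sinks with fixed positions in the plane (positions may coincide), capacities $c_0 \ge c_1 \ge \dots \ge c_{\lambda+1} \ge 1$ (possibly $\infty$) and $\alpha \in [0,1]$. A layout is a rooted forest of height at most $\lambda+1$ whose leaves are exactly the sources and whose roots are sinks, together with positions in the plane for the remaining (Steiner) vertices. The load $\ell(u)$ of a vertex $u$ is the number of sources in its subtree; the layer of a vertex is its distance from its root. The layout is valid if $\ell(u) \le c_i$ for every vertex $u$ in layer $i$; its cost is the sum of $\|u-v\|\cdot \ell(u)^\alpha$ over all edges $uv$ from a vertex $u$ to its parent $v$. The instance is convex if all sources lie on the boundary of the convex hull of all sources and sinks. **Weber solver.** A Weber solver with running time $T_{\mathrm{Weber}}$ is a deterministic black box that, given $\varepsilon>0$, a point $t$ and a list $A$ of $k\ge 1$ points, returns in at most $T_{\mathrm{Weber}}(k,\varepsilon)$ steps a point $v$ and a number $c$ with $$\sum_{a\in A}\|a-v\| + \|v-t\| \;\le\; c \;\le\; (1+\varepsilon)\,\min_{q\in\mathbb{R}^2}\Bigl(\sum_{a\in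 A}\|a-q\|+\|q-t\|\Bigr).$$ Here $T_{\mathrm{Weber}}(k,\varepsilon)\ge 1$ for $k \ge 1$ and $T_{\mathrm{Weber}}$ is nondecreasing in $k$. **Theorem.** There are an absolute constant $C$ and a single algorithm (a program for the real RAM with unit-cost arithmetic and comparisons on reals, square roots, index arithmetic and arrays, and with a Weber solver as a subroutine) such that the following holds for every Weber solver with running time $T_{\mathrm{Weber}}$, every $\varepsilon>0$ and every convex instance with $n\ge 1$ sources in arbitrary order, one intermediate layer ($\lambda=1$), one sink, unlimited capacities ($c_0=c_1=c_2=\infty$) and $\alpha=0$. Given the positions of the sources and the sink and $\varepsilon$, the algorithm with this solver as its subroutine halts after at most $C\cdot n^6\cdot T_{\mathrm{Weber}}(n,\varepsilon)$ steps and outputs a valid layout whose cost is at most $(1+\varepsilon)$ times the cost of every valid layout of the instance. A call of the subroutine is charged the running time of the solver on that call, plus one step. -/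

import Mathlib

namespace Flamecast

/-- The Euclidean plane. -/
abbrev Plane : Type := EuclideanSpace ℝ (Fin 2)

/-! ### The layered Steiner forest problem -/

/-- An instance: sources and sinks with fixed positions (given as finite families, so that several
of them may share a position), the number `lam` of intermediate layers, the capacities
`c₀ ≥ c₁ ≥ ⋯ ≥ c_{lam+1} ≥ 1` of the layers (`⊤` means unlimited) and the exponent `α`. -/
structure Instance where
  n : ℕ
  τ : ℕ
  lam : ℕ
  source : Fin n → Plane
  sink : Fin τ → Plane
  cap : Fin (lam + 2) → ℕ∞
  cap_antitone : Antitone cap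
  one_le_cap : ∀ i, 1 ≤ cap i
  α : ℝ
  α_nonneg : 0 ≤ α
  α_le_one : α ≤ 1

/-- All sources lie on the boundary of the convex hull of sources and sinks. -/
def Instance.IsConvex (I : Instance) : Prop :=
  ∀ i, I.source i ∈ frontier (convexHull ℝ (Set.range I.source ∪ Set.range I.sink))

/-- The vertices of a forest with `n` sources, `m` Steiner vertices and `τ` possible roots. -/
inductive Node (n m τ : ℕ) : Type
  | source (i : Fin n)
  | steiner (j : Fin m)
  | sink (k : Fin τ)

/-- The edges of a forest: the parent of every source and of every Steiner vertex.
A parent is a Steiner vertex or a sink, hence sources have no children and sinks no parent. -/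
structure ParentMap (n m τ : ℕ) where
  ofSource : Fin n → Fin m ⊕ Fin τ
  ofSteiner : Fin m → Fin m ⊕ Fin τ

namespace ParentMap

variable {n m τ : ℕ}

/-- A possible parent as a vertex. -/
def toNode : Fin m ⊕ Fin τ → Node n m τ
  | Sum.inl j => Node.steiner j
  | Sum.inr k => Node.sink k

/-- The parent of a vertex; sinks are sent to themselves. -/
def next (p : ParentMap n m τ) : Node n m τ → Node n m τ
  | Node.source i => toNode (p.ofSource i)
  | Node.steiner j => toNode (p.ofSteiner j)
  | Node.sink k => Node.sink k

/-- The directed path from `u` has reached a sink after `k` steps. -/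
def ReachesSink (p : ParentMap n m τ) (u : Node n m τ) (k : ℕ) : Prop :=
  ∃ t : Fin τ, p.next^[k] u = Node.sink t

/-- The layer of a vertex: the length of its path to the root. -/
noncomputable def layer (p : ParentMap n m τ) (u : Node n m τ) : ℕ :=
  sInf {k | p.ReachesSink u k}

/-- The load of a vertex: the number of sources in its subtree.  The load of the edge from `u` to
its parent is the load of `u`. -/
noncomputable def load (p : ParentMap n m τ) (u : Node n m τ) : ℕ :=
  {i : Fin n | ∃ k, p.next^[k] (Node.source i) = u}.ncard

end ParentMap

/-- A layout: a rooted forest of height at most `lam + 1` whose leaves are exactly the sources and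
whose roots are sinks, with positions for its Steiner vertices.  (Sinks without children are not
part of the forest.) -/
structure Layout (I : Instance) where
  m : ℕ
  parents : ParentMap I.n m I.τ
  height_le : ∀ u, ∃ k ≤ I.lam + 1, parents.ReachesSink u k
  not_leaf : ∀ j, ∃ u, parents.next u = Node.steiner j
  steinerPos : Fin m → Plane

namespace Layout

variable {I : Instance}

/-- The position of a vertex. -/
def pos (L : Layout I) : Node I.n L.m I.τ → Plane
  | Node.source i => I.source i
  | Node.steiner j => L.steinerPos j
  | Node.sink k => I.sink k

/-- The layout respects the capacities. -/
def Valid (L : Layout I) : Prop :=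
  ∀ (u : Node I.n L.m I.τ) (i : Fin (I.lam + 2)),
    L.parents.layer u = i → (L.parents.load u : ℕ∞) ≤ I.cap i

/-- The cost of the edge from `u` to its parent: length times `load ^ α`. -/
noncomputable def edgeCost (L : Layout I) (u : Node I.n L.m I.τ) : ℝ :=
  dist (L.pos u) (L.pos (L.parents.next u)) * (L.parents.load u : ℝ) ^ I.α

/-- The total cost of all edges. -/
noncomputable def cost (L : Layout I) : ℝ :=
  ∑ i, L.edgeCost (Node.source i) + ∑ j, L.edgeCost (Node.steiner j)

end Layout

/-! ### Solvers for the Weber problem -/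

/-- The cost of connecting the sources in the list `A` to the sink `t` by a single Steiner vertex
at the point `q`, without load weights. -/
noncomputable def starCost (t : Plane) (A : List Plane) (q : Plane) : ℝ :=
  (A.map fun a => dist a q).sum + dist q t

/-- A deterministic black box for the Weber problem: on accuracy `ε`, sink `t` and sources `A` it
returns the point `point ε t A` and the number `value ε t A` after `steps ε t A` steps. -/
structure WeberSolver where
  point : ℝ → Plane → List Plane → Plane
  value : ℝ → Plane → List Plane → ℝ
  steps : ℝ → Plane → List Plane → ℕ

/-- The solver is a `(1 + ε)`-approximation for every `ε > 0`, with time bound `T |A| ε`. The number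
it returns is guaranteed only to lie between the cost of the returned point and `1 + ε` times the
optimal cost. -/
def WeberSolver.Correct (W : WeberSolver) (T : ℕ → ℝ → ℕ) : Prop :=
  ∀ (ε : ℝ), 0 < ε → ∀ (t : Plane) (A : List Plane), A ≠ [] →
    starCost t A (W.point ε t A) ≤ W.value ε t A ∧
    (∀ q, W.value ε t A ≤ (1 + ε) * starCost t A q) ∧
    W.steps ε t A ≤ T A.length ε

/-! ### The machine model

A real RAM with a Weber subroutine, programmed in a structured language.  The memory consists of
named arrays with two indices; one family of arrays holds natural numbers, the other real numbers.
Array names are fixed in the program, indices are computed at run time. -/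

/-- A memory: the entry of array `a` at position `(i, j)` is `nat a i j` or `real a i j`. -/
structure Memory where
  nat : ℕ → ℕ → ℕ → ℕ
  real : ℕ → ℕ → ℕ → ℝ

namespace Memory

def setNat (s : Memory) (a i j v : ℕ) : Memory where
  nat := fun a' i' j' => if a' = a ∧ i' = i ∧ j' = j then v else s.nat a' i' j'
  real := s.real

noncomputable def setReal (s : Memory) (a i j : ℕ) (v : ℝ) : Memory where
  nat := s.nat
  real := fun a' i' j' => if a' = a ∧ i' = i ∧ j' = j then v else s.real a' i' j'

end Memory

/-- Expressions for natural numbers; subtraction is truncated. -/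
inductive NatExp : Type
  | const (k : ℕ)
  | get (a : ℕ) (i j : NatExp)
  | add (e f : NatExp)
  | sub (e f : NatExp)

def NatExp.eval (s : Memory) : NatExp → ℕ
  | .const k => k
  | .get a i j => s.nat a (i.eval s) (j.eval s)
  | .add e f => e.eval s + f.eval s
  | .sub e f => e.eval s - f.eval s

/-- Expressions for real numbers, with rational constants. Division by zero and the square root of a
negative number give zero. -/
inductive RealExp : Type
  | const (q : ℚ)
  | get (a : ℕ) (i j : NatExp)
  | add (e f : RealExp)
  | sub (e f : RealExp)
  | mul (e f : RealExp)
  | div (e f : RealExp)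
  | sqrt (e : RealExp)

noncomputable def RealExp.eval (s : Memory) : RealExp → ℝ
  | .const q => (q : ℝ)
  | .get a i j => s.real a (i.eval s) (j.eval s)
  | .add e f => e.eval s + f.eval s
  | .sub e f => e.eval s - f.eval s
  | .mul e f => e.eval s * f.eval s
  | .div e f => e.eval s / f.eval s
  | .sqrt e => Real.sqrt (e.eval s)

/-- Tests: comparisons and their Boolean combinations. -/
inductive Test : Type
  | natLe (e f : NatExp)
  | realLe (e f : RealExp)
  | neg (b : Test)
  | conj (b c : Test)

def Test.Holds (s : Memory) : Test → Prop
  | .natLe e f => e.eval s ≤ f.eval s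
  | .realLe e f => e.eval s ≤ f.eval s
  | .neg b => ¬ b.Holds s
  | .conj b c => b.Holds s ∧ c.Holds s

/-- Programs.  `weber px py row len ε tx ty ox oy oc` passes to the Weber subroutine the accuracy
`ε`, the sink `(tx, ty)` and the first `len` points whose coordinates are stored in row `row` of the
real arrays `px` and `py`; the returned point and number are stored at position `(0, 0)` of the real
arrays `ox`, `oy` and `oc`. -/
inductive Program : Type
  | skip
  | setNat (a : ℕ) (i j : NatExp) (e : NatExp)
  | setReal (a : ℕ) (i j : NatExp) (e : RealExp)
  | seq (P Q : Program)
  | ite (b : Test) (P Q : Program)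
  | while (b : Test) (P : Program)
  | weber (px py : ℕ) (row len : NatExp) (ε tx ty : RealExp) (ox oy oc : ℕ)

/-- The list of the points stored at positions `(row, 0), …, (row, len - 1)` of `px`, `py`. -/
def Memory.points (s : Memory) (px py row len : ℕ) : List Plane :=
  (List.range len).map fun i => !₂[s.real px row i, s.real py row i]

/-- The memory after a call of the Weber subroutine. -/
noncomputable def Memory.storeAnswer (s : Memory) (ox oy oc : ℕ) (v : Plane) (c : ℝ) : Memory :=
  ((s.setReal ox 0 0 (v 0)).setReal oy 0 0 (v 1)).setReal oc 0 0 c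

/-- `Exec W P s s' k`: started in memory `s`, the program `P` with the solver `W` as its Weber
subroutine halts in memory `s'` after `k` steps.  Assignments and tests take one step each; since
the expressions are part of the fixed program, counting their single operations instead would change
the number of steps only by a factor that depends on the program alone. A call of the subroutine
takes the time of the solver plus one step. -/
inductive Exec (W : WeberSolver) : Program → Memory → Memory → ℕ → Prop
  | skip (s : Memory) : Exec W .skip s s 1
  | setNat (s : Memory) (a : ℕ) (i j e : NatExp) :
      Exec W (.setNat a i j e) s (s.setNat a (i.eval s) (j.eval s) (e.eval s)) 1
  | setReal (s : Memory) (a : ℕ) (i j : NatExp) (e : RealExp) :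
      Exec W (.setReal a i j e) s (s.setReal a (i.eval s) (j.eval s) (e.eval s)) 1
  | seq {P Q : Program} {s s' s'' : Memory} {k l : ℕ} :
      Exec W P s s' k → Exec W Q s' s'' l → Exec W (.seq P Q) s s'' (k + l)
  | ite_true {b : Test} {P Q : Program} {s s' : Memory} {k : ℕ} :
      b.Holds s → Exec W P s s' k → Exec W (.ite b P Q) s s' (k + 1)
  | ite_false {b : Test} {P Q : Program} {s s' : Memory} {k : ℕ} :
      ¬ b.Holds s → Exec W Q s s' k → Exec W (.ite b P Q) s s' (k + 1)
  | while_true {b : Test} {P : Program} {s s' s'' : Memory} {k l : ℕ} :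
      b.Holds s → Exec W P s s' k → Exec W (.while b P) s' s'' l →
      Exec W (.while b P) s s'' (k + l + 1)
  | while_false {b : Test} {P : Program} {s : Memory} :
      ¬ b.Holds s → Exec W (.while b P) s s 1
  | weber (s : Memory) (px py : ℕ) (row len : NatExp) (ε tx ty : RealExp) (ox oy oc : ℕ) :
      Exec W (.weber px py row len ε tx ty ox oy oc) s
        (s.storeAnswer ox oy oc
          (W.point (ε.eval s) !₂[tx.eval s, ty.eval s]
            (s.points px py (row.eval s) (len.eval s)))
          (W.value (ε.eval s) !₂[tx.eval s, ty.eval s]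
            (s.points px py (row.eval s) (len.eval s))))
        (W.steps (ε.eval s) !₂[tx.eval s, ty.eval s]
          (s.points px py (row.eval s) (len.eval s)) + 1)

/-! ### Input and output -/

/-- The initial memory: the numbers of sources and sinks, the coordinates of the sources in the
given (arbitrary) order, the coordinates of the sinks, and `ε`; all else is zero.  The number of
layers, the capacities and `α` are not passed on, as the programs considered here are for fixed
values of them. -/
noncomputable def Instance.input (I : Instance) (ε : ℝ) : Memory where
  nat := fun a i j =>
    if a = 0 ∧ i = 0 ∧ j = 0 then I.n
    else if a = 1 ∧ i = 0 ∧ j = 0 then I.τ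
    else 0
  real := fun a i j =>
    if i = 0 then
      if a = 0 then (if h : j < I.n then I.source ⟨j, h⟩ 0 else 0)
      else if a = 1 then (if h : j < I.n then I.source ⟨j, h⟩ 1 else 0)
      else if a = 2 then (if h : j < I.τ then I.sink ⟨j, h⟩ 0 else 0)
      else if a = 3 then (if h : j < I.τ then I.sink ⟨j, h⟩ 1 else 0)
      else if a = 4 ∧ j = 0 then ε
      else 0
    else 0

/-- A parent is encoded by a number: sinks come first, then the Steiner vertices. -/
def parentCode {m τ : ℕ} : Fin m ⊕ Fin τ → ℕ
  | Sum.inl j => τ + j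
  | Sum.inr k => k

/-- The memory `s` contains the layout `L` as output: the number of Steiner vertices, the parents of
the sources and of the Steiner vertices, and the coordinates of the Steiner vertices. -/
def Layout.IsOutput {I : Instance} (L : Layout I) (s : Memory) : Prop :=
  s.nat 0 0 0 = L.m ∧
  (∀ i : Fin I.n, s.nat 1 0 i = parentCode (L.parents.ofSource i)) ∧
  (∀ j : Fin L.m, s.nat 2 0 j = parentCode (L.parents.ofSteiner j)) ∧
  (∀ j : Fin L.m, s.real 0 0 j = L.steinerPos j 0 ∧ s.real 1 0 j = L.steinerPos j 1)

end Flamecast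

/-!
A layout with one intermediate layer and `α = 0` is a partition of the sources into groups, each with
a Steiner point that is paid for by its distance to the sink; a source connected directly to the sink
has a Steiner point of its own at the sink. So the problem is to choose Steiner points and an
assignment of the sources to them (`assignCost`, `Layout.exists_assignCost_le`). An optimal choice
exists, with Steiner points in the convex hull `K` and each source assigned to a nearest Steiner point,
ties being broken consistently (`Optimal`, `exists_optimal`).

Sort the sources along the boundary of `K`. All of them are boundary points of `K`, so four sources in
cyclic order are in `Alternating` position, even if many of them are collinear or coincide. This gives
two facts about an optimal choice:

* two groups do not cross (`Optimal.noncrossing`), since Voronoi cells of two points are convex and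
  disjoint up to ties;
* no group has four arcs on the cyclic tour (`Optimal.no_four_gaps`). If the gaps between four arcs
  are met by groups with Steiner points `w₁, …, w₄` and `v` is the Steiner point of the group itself,
  then the vectors `wᵢ - v` have nonpositive inner products, three of which are negative, and this is
  impossible for four vectors in the plane (`no_four_obtuse`).

Hence, in a window of `n` positions that begins between two groups, every group consists of at most
three intervals, and the gaps between them are unions of groups. The dynamic program computes for each
interval `[i, l)` of the doubled tour a value `F i l`: the first group consists of three arcs `[i, j)`,
`[k, p)` and `[q, m)`, which are given to the Weber solver, and the intervals `[j, k)`, `[p, q)` and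
`[m, l)` are solved recursively. There are `O(n ^ 6)` choices of `i, j, k, p, q, m`, and the last
interval is split off in a separate minimization. No value found is less than the cost of the solution
stored in the tables (`DPTables.Correct.cost_le`), and in some window the value is at most `1 + ε` times
the optimum (`DPTables.Correct.exists_window_le`).

The tour must be found by arithmetic and comparisons alone. Its start is a source `S m` farthest from
the first source `S r`, so that all sources except for copies of `S m` lie in the open half plane at
`S m` around the direction to `S r`, and can be sorted by slope; sources in the same direction from
`S m` lie on the first or the last side of the tour, and the sum of the cross products with all sources
tells which (`tourKey`, `tour_of_tourKey_le`).

For the program, `Run` is a notion of total correctness with a time bound, with a rule for counting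
loops (`Run.for_pow`).
-/

namespace Flamecast

/-! ### Reasoning about programs -/

/-- Total correctness with a time bound: started in `s`, the program `P` halts after at most `B`
steps in a memory satisfying `Q`. -/
def Run (W : WeberSolver) (P : Program) (s : Memory) (B : ℕ) (Q : Memory → Prop) : Prop :=
  ∃ s' k, Exec W P s s' k ∧ k ≤ B ∧ Q s'

/-- The names of the arrays of natural numbers that a program may change. -/
def Program.natMods : Program → List ℕ
  | .setNat a _ _ _ => [a]
  | .seq P Q => P.natMods ++ Q.natMods
  | .ite _ P Q => P.natMods ++ Q.natMods
  | .while _ P => P.natMods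
  | _ => []

/-- The names of the arrays of real numbers that a program may change. -/
def Program.realMods : Program → List ℕ
  | .setReal a _ _ _ => [a]
  | .seq P Q => P.realMods ++ Q.realMods
  | .ite _ P Q => P.realMods ++ Q.realMods
  | .while _ P => P.realMods
  | .weber _ _ _ _ _ _ _ ox oy oc => [ox, oy, oc]
  | _ => []

/-- The memories agree outside of the arrays listed in `A` (natural) and `R` (real). -/
def Frame (A R : List ℕ) (s s' : Memory) : Prop :=
  (∀ a, a ∉ A → s'.nat a = s.nat a) ∧ (∀ a, a ∉ R → s'.real a = s.real a)

theorem Frame.refl (A R : List ℕ) (s : Memory) : Frame A R s s :=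
  ⟨fun _ _ => rfl, fun _ _ => rfl⟩

theorem Frame.trans {A R : List ℕ} {s s' s'' : Memory} (h : Frame A R s s')
    (h' : Frame A R s' s'') : Frame A R s s'' :=
  ⟨fun a ha => (h'.1 a ha).trans (h.1 a ha), fun a ha => (h'.2 a ha).trans (h.2 a ha)⟩

theorem Frame.mono {A R A' R' : List ℕ} {s s' : Memory} (h : Frame A R s s') (hA : A ⊆ A')
    (hR : R ⊆ R') : Frame A' R' s s' :=
  ⟨fun a ha => h.1 a fun h => ha (hA h), fun a ha => h.2 a fun h => ha (hR h)⟩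

theorem Frame.nat {A R : List ℕ} {s s' : Memory} (h : Frame A R s s') (a : ℕ) (ha : a ∉ A) :
    s'.nat a = s.nat a := h.1 a ha

theorem Frame.real {A R : List ℕ} {s s' : Memory} (h : Frame A R s s') (a : ℕ) (ha : a ∉ R) :
    s'.real a = s.real a := h.2 a ha

theorem Memory.setNat_nat (s : Memory) (a i j v a' i' j' : ℕ) :
    (s.setNat a i j v).nat a' i' j' = if a' = a ∧ i' = i ∧ j' = j then v else s.nat a' i' j' := rfl

theorem Memory.setReal_real (s : Memory) (a i j : ℕ) (v : ℝ) (a' i' j' : ℕ) :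
    (s.setReal a i j v).real a' i' j' =
      if a' = a ∧ i' = i ∧ j' = j then v else s.real a' i' j' := rfl

@[simp] theorem Memory.setNat_real (s : Memory) (a i j v : ℕ) :
    (s.setNat a i j v).real = s.real := rfl

@[simp] theorem Memory.setReal_nat (s : Memory) (a i j : ℕ) (v : ℝ) :
    (s.setReal a i j v).nat = s.nat := rfl

theorem Memory.setNat_nat_ne (s : Memory) {a a' : ℕ} (i j v : ℕ) (h : a' ≠ a) :
    (s.setNat a i j v).nat a' = s.nat a' := by
  funext i' j'; simp [Memory.setNat_nat, h]

theorem Memory.setReal_real_ne (s : Memory) {a a' : ℕ} (i j : ℕ) (v : ℝ) (h : a' ≠ a) :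
    (s.setReal a i j v).real a' = s.real a' := by
  funext i' j'; simp [Memory.setReal_real, h]

@[simp] theorem Memory.setNat_nat_self (s : Memory) (a i j v : ℕ) :
    (s.setNat a i j v).nat a i j = v := by
  simp [Memory.setNat_nat]

@[simp] theorem Memory.setReal_real_self (s : Memory) (a i j : ℕ) (v : ℝ) :
    (s.setReal a i j v).real a i j = v := by
  simp [Memory.setReal_real]

theorem Exec.frame {W : WeberSolver} {P : Program} {s s' : Memory} {k : ℕ}
    (h : Exec W P s s' k) : Frame P.natMods P.realMods s s' := by
  induction h with
  | skip s => exact Frame.refl _ _ _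
  | setNat s a i j e =>
    refine ⟨fun b hb => Memory.setNat_nat_ne _ _ _ _ ?_, fun _ _ => rfl⟩
    simpa [Program.natMods] using hb
  | setReal s a i j e =>
    refine ⟨fun _ _ => rfl, fun b hb => Memory.setReal_real_ne _ _ _ _ ?_⟩
    simpa [Program.realMods] using hb
  | seq _ _ h1 h2 =>
    exact (h1.mono (by simp [Program.natMods]) (by simp [Program.realMods])).trans
      (h2.mono (by simp [Program.natMods]) (by simp [Program.realMods]))
  | ite_true _ _ h1 => exact h1.mono (by simp [Program.natMods]) (by simp [Program.realMods])
  | ite_false _ _ h1 => exact h1.mono (by simp [Program.natMods]) (by simp [Program.realMods])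
  | while_true _ _ _ h1 h2 => exact Frame.trans h1 h2
  | while_false _ => exact Frame.refl _ _ _
  | weber s px py row len ε tx ty ox oy oc =>
    refine ⟨fun _ _ => rfl, fun b hb => ?_⟩
    simp only [Program.realMods, List.mem_cons, List.not_mem_nil, or_false, not_or] at hb
    simp only [Memory.storeAnswer]
    rw [Memory.setReal_real_ne _ _ _ _ hb.2.2, Memory.setReal_real_ne _ _ _ _ hb.2.1,
      Memory.setReal_real_ne _ _ _ _ hb.1]

section Run

variable {W : WeberSolver} {P P' : Program} {s : Memory} {B B' : ℕ} {Q Q' : Memory → Prop}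

theorem Run.mono (h : Run W P s B Q) (hB : B ≤ B') (hQ : ∀ s', Q s' → Q' s') :
    Run W P s B' Q' := by
  obtain ⟨s', k, h1, h2, h3⟩ := h
  exact ⟨s', k, h1, h2.trans hB, hQ _ h3⟩

theorem Run.imp (h : Run W P s B Q) (hQ : ∀ s', Q s' → Q' s') : Run W P s B Q' :=
  h.mono le_rfl hQ

/-- The frame condition is available at the end of every run. -/
theorem Run.with_frame (h : Run W P s B Q)
    (hQ : ∀ s', Frame P.natMods P.realMods s s' → Q s' → Q' s') : Run W P s B Q' := by
  obtain ⟨s', k, h1, h2, h3⟩ := h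
  exact ⟨s', k, h1, h2, hQ _ h1.frame h3⟩

theorem Run.skip (h : Q s) : Run W .skip s 1 Q := ⟨_, _, .skip _, le_rfl, h⟩

theorem Run.setNat {a : ℕ} {i j e : NatExp} (h : Q (s.setNat a (i.eval s) (j.eval s) (e.eval s))) :
    Run W (.setNat a i j e) s 1 Q := ⟨_, _, .setNat _ _ _ _ _, le_rfl, h⟩

theorem Run.setReal {a : ℕ} {i j : NatExp} {e : RealExp}
    (h : Q (s.setReal a (i.eval s) (j.eval s) (e.eval s))) :
    Run W (.setReal a i j e) s 1 Q := ⟨_, _, .setReal _ _ _ _ _, le_rfl, h⟩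

theorem Run.seq (h : Run W P s B fun s' => Run W P' s' B' Q) :
    Run W (.seq P P') s (B + B') Q := by
  obtain ⟨s', k, h1, h2, s'', l, h3, h4, h5⟩ := h
  exact ⟨_, _, .seq h1 h3, by omega, h5⟩

theorem Run.ite {b : Test} (h : b.Holds s → Run W P s B Q) (h' : ¬ b.Holds s → Run W P' s B Q) :
    Run W (.ite b P P') s (B + 1) Q := by
  by_cases hb : b.Holds s
  · obtain ⟨s', k, h1, h2, h3⟩ := h hb
    exact ⟨_, _, .ite_true hb h1, by omega, h3⟩
  · obtain ⟨s', k, h1, h2, h3⟩ := h' hb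
    exact ⟨_, _, .ite_false hb h1, by omega, h3⟩

end Run

/-- The scalar variable `v`, stored at position `(0, 0)` of the array `v`. -/
abbrev NatExp.var (v : ℕ) : NatExp := .get v (.const 0) (.const 0)

/-- The entry of a real array with a given column in row `0`. -/
abbrev RealExp.at (a : ℕ) (j : NatExp) : RealExp := .get a (.const 0) j

/-- Assignment to a scalar variable. -/
abbrev Program.assign (v : ℕ) (e : NatExp) : Program := .setNat v (.const 0) (.const 0) e

/-- The loop in which the variable `v` runs through `lo, …, hi - 1`. -/
def Program.for (v : ℕ) (lo hi : NatExp) (body : Program) : Program :=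
  .seq (.assign v lo)
    (.while (.natLe (.add (.var v) (.const 1)) hi)
      (.seq body (.assign v (.add (.var v) (.const 1)))))

/-- The rule for counting loops: an invariant `I x`, valid before the round with counter value `x`,
which does not depend on the counter variable itself. -/
theorem Run.for {W : WeberSolver} {v : ℕ} {lo hi : NatExp} {body : Program} {s₀ : Memory}
    {l b B : ℕ} (I : ℕ → Memory → Prop) (hlo : lo.eval s₀ = l) (hlb : l ≤ b)
    (hv : v ∉ body.natMods)
    (hhi : ∀ s, Frame (v :: body.natMods) body.realMods s₀ s → hi.eval s = b)
    (hI : ∀ x s y, I x s → I x (s.setNat v 0 0 y))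
    (h0 : I l s₀)
    (hbody : ∀ x s, l ≤ x → x < b → Frame (v :: body.natMods) body.realMods s₀ s →
      s.nat v 0 0 = x → I x s → Run W body s B (I (x + 1))) :
    Run W (.for v lo hi body) s₀ ((b - l) * (B + 2) + 2)
      fun s => I b s ∧ Frame (v :: body.natMods) body.realMods s₀ s := by
  have set_frame : ∀ (s : Memory) (y : ℕ),
      Frame (v :: body.natMods) body.realMods s (s.setNat v 0 0 y) := fun s y =>
    ⟨fun a ha => Memory.setNat_nat_ne _ _ _ _ (by simp at ha; exact ha.1), fun _ _ => rfl⟩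
  have main : ∀ d x s, x + d = b → l ≤ x → Frame (v :: body.natMods) body.realMods s₀ s →
      s.nat v 0 0 = x → I x s →
      Run W (.while (.natLe (.add (.var v) (.const 1)) hi)
        (.seq body (.assign v (.add (.var v) (.const 1))))) s (d * (B + 2) + 1)
        fun s => I b s ∧ Frame (v :: body.natMods) body.realMods s₀ s := by
    intro d
    induction d with
    | zero =>
      intro x s hx hl hf hs hIx
      refine ⟨s, 1, .while_false ?_, by omega, ?_⟩
      · simp [Test.Holds, NatExp.eval, hhi s hf, hs]; omega
      · obtain rfl : x = b := by omega
        exact ⟨hIx, hf⟩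
    | succ d ih =>
      intro x s hx hl hf hs hIx
      obtain ⟨s1, k1, h1, hk1, hI1⟩ := hbody x s hl (by omega) hf hs hIx
      have hf1 := h1.frame
      have hs1 : s1.nat v 0 0 = x := by rw [hf1.nat v hv, hs]
      have e1 : (NatExp.add (.var v) (.const 1)).eval s1 = x + 1 := by simp [NatExp.eval, hs1]
      obtain ⟨s2, k2, h2, hk2, hI2⟩ := ih (x + 1) (s1.setNat v 0 0 (x + 1)) (by omega) (by omega)
        ((hf.trans (hf1.mono (by simp) (by simp))).trans (set_frame _ _))
        (by simp) (hI _ _ _ hI1)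
      have h3 : Exec W (.seq body (.assign v (.add (.var v) (.const 1)))) s
          (s1.setNat v 0 0 (x + 1)) (k1 + 1) := by
        have := Exec.seq h1 (.setNat s1 v (.const 0) (.const 0) (.add (.var v) (.const 1)))
        rwa [e1] at this
      refine ⟨s2, (k1 + 1) + k2 + 1, .while_true ?_ h3 h2, ?_, hI2⟩
      · simp [Test.Holds, NatExp.eval, hhi s hf, hs]; omega
      · rw [add_mul]; omega
  have := main (b - l) l (s₀.setNat v 0 0 l) (by omega) le_rfl (set_frame _ _) (by simp)
    (hI _ _ _ h0)
  obtain ⟨s2, k2, h2, hk2, hI2⟩ := this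
  refine ⟨s2, 1 + k2, .seq (.setNat _ _ _ _ _) ?_, by omega, hI2⟩
  simpa [NatExp.eval, hlo] using h2

/-! ### Orientation and convexity in the plane -/

/-- The cross product of `b - a` and `p - a`: positive if `p` lies to the left of the line from `a`
to `b`, and zero if it lies on this line or `a = b`. -/
noncomputable def orient (a b p : Plane) : ℝ :=
  (b 0 - a 0) * (p 1 - a 1) - (b 1 - a 1) * (p 0 - a 0)

theorem Plane.ext {a b : Plane} (h0 : a 0 = b 0) (h1 : a 1 = b 1) : a = b := by
  ext i; fin_cases i <;> assumption

theorem mem_segment_iff_coord {a b p : Plane} :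
    p ∈ segment ℝ a b ↔ ∃ s : ℝ, 0 ≤ s ∧ s ≤ 1 ∧
      p 0 = (1 - s) * a 0 + s * b 0 ∧ p 1 = (1 - s) * a 1 + s * b 1 := by
  rw [segment_eq_image]
  constructor
  · rintro ⟨s, ⟨h0, h1⟩, rfl⟩
    exact ⟨s, h0, h1, by simp, by simp⟩
  · rintro ⟨s, h0, h1, e0, e1⟩
    exact ⟨s, ⟨h0, h1⟩, Plane.ext (by simp [e0]) (by simp [e1])⟩

/-- Near a point strictly between two points `a` and `b` of a convex set, all points of the closed
half plane that contains a third point `c` of the set belong to the set. -/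
theorem eventually_mem_of_orient_ne {K : Set Plane} (hK : Convex ℝ K) {a b c p : Plane}
    (ha : a ∈ K) (hb : b ∈ K) (hc : c ∈ K) {s : ℝ} (hs0 : 0 < s) (hs1 : s < 1)
    (p0 : p 0 = (1 - s) * a 0 + s * b 0) (p1 : p 1 = (1 - s) * a 1 + s * b 1)
    (h : orient a b c ≠ 0) :
    ∀ᶠ x in nhds p, 0 ≤ orient a b x / orient a b c → x ∈ K := by
  have hab : (b 0 - a 0) ^ 2 + (b 1 - a 1) ^ 2 ≠ 0 := by
    intro h0
    have e0 : b 0 - a 0 = 0 := by nlinarith [sq_nonneg (b 0 - a 0), sq_nonneg (b 1 - a 1)]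
    have e1 : b 1 - a 1 = 0 := by nlinarith [sq_nonneg (b 0 - a 0), sq_nonneg (b 1 - a 1)]
    exact h (by simp [orient, e0, e1])
  -- `x = (1 - β) • y + β • c` with `y` on the line through `a` and `b`, at the parameter `τ`.
  let β : Plane → ℝ := fun x => orient a b x / orient a b c
  let τ : Plane → ℝ := fun x =>
    (((x 0 - β x * c 0) / (1 - β x) - a 0) * (b 0 - a 0) +
      ((x 1 - β x * c 1) / (1 - β x) - a 1) * (b 1 - a 1)) /
        ((b 0 - a 0) ^ 2 + (b 1 - a 1) ^ 2)
  have hβp : β p = 0 := by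
    have : orient a b p = 0 := by simp only [orient, p0, p1]; ring
    simp [β, this]
  have hτp : τ p = s := by
    simp only [τ, hβp, p0, p1]
    field_simp
    ring
  have cβ : Continuous β := by
    unfold β orient
    fun_prop
  have cτ : ContinuousAt τ p := by
    have h1 : ContinuousAt (fun x : Plane => (x 0 - β x * c 0) / (1 - β x)) p :=
      ContinuousAt.div (by fun_prop) (by fun_prop) (by simp [hβp])
    have h2 : ContinuousAt (fun x : Plane => (x 1 - β x * c 1) / (1 - β x)) p :=
      ContinuousAt.div (by fun_prop) (by fun_prop) (by simp [hβp])
    exact (((h1.sub continuousAt_const).mul continuousAt_const).add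
      ((h2.sub continuousAt_const).mul continuousAt_const)).div_const _
  have e1 : ∀ᶠ x in nhds p, β x < 1 :=
    cβ.continuousAt.eventually_lt continuousAt_const (by simp [hβp])
  have e2 : ∀ᶠ x in nhds p, 0 < τ x :=
    continuousAt_const.eventually_lt cτ (by simpa [hτp] using hs0)
  have e3 : ∀ᶠ x in nhds p, τ x < 1 :=
    cτ.eventually_lt continuousAt_const (by simpa [hτp] using hs1)
  filter_upwards [e1, e2, e3] with x h1 h2 h3 h4
  have hy : (1 - τ x) • a + τ x • b ∈ K :=
    hK ha hb (by linarith) h2.le (by ring)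
  have hx := hK hy hc (by linarith : 0 ≤ 1 - β x) h4 (by ring)
  have hβ : 1 - β x ≠ 0 := by linarith
  have hβ' : β x * orient a b c = orient a b x := by simp only [β]; field_simp
  -- The point `y` really lies on the line.
  obtain ⟨y0, hy0⟩ : ∃ y0, y0 = (x 0 - β x * c 0) / (1 - β x) := ⟨_, rfl⟩
  obtain ⟨y1, hy1⟩ : ∃ y1, y1 = (x 1 - β x * c 1) / (1 - β x) := ⟨_, rfl⟩
  have y0e : (1 - β x) * y0 + β x * c 0 = x 0 := by rw [hy0]; field_simp; ring
  have y1e : (1 - β x) * y1 + β x * c 1 = x 1 := by rw [hy1]; field_simp; ring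
  have hline : (b 0 - a 0) * (y1 - a 1) - (b 1 - a 1) * (y0 - a 0) = 0 := by
    have : (1 - β x) * ((b 0 - a 0) * (y1 - a 1) - (b 1 - a 1) * (y0 - a 0)) = 0 := by
      simp only [orient] at hβ'
      linear_combination (b 0 - a 0) * y1e - (b 1 - a 1) * y0e - hβ'
    exact (mul_eq_zero.1 this).resolve_left hβ
  have hτ : τ x * ((b 0 - a 0) ^ 2 + (b 1 - a 1) ^ 2) =
      (y0 - a 0) * (b 0 - a 0) + (y1 - a 1) * (b 1 - a 1) := by
    simp only [τ, ← hy0, ← hy1]; field_simp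
  have z0 : (1 - τ x) * a 0 + τ x * b 0 = y0 := by
    apply mul_left_cancel₀ hab
    linear_combination (b 0 - a 0) * hτ + (b 1 - a 1) * hline
  have z1 : (1 - τ x) * a 1 + τ x * b 1 = y1 := by
    apply mul_left_cancel₀ hab
    linear_combination (b 1 - a 1) * hτ - (b 0 - a 0) * hline
  convert hx using 1
  refine Plane.ext ?_ ?_
  · simp only [PiLp.add_apply, PiLp.smul_apply, smul_eq_mul]
    rw [z0, y0e]
  · simp only [PiLp.add_apply, PiLp.smul_apply, smul_eq_mul]
    rw [z1, y1e]

/-- A point strictly between two points of a convex set is an interior point if the set has points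
strictly on both sides of the line. -/
theorem mem_interior_of_orient {K : Set Plane} (hK : Convex ℝ K) {a b c d p : Plane}
    (ha : a ∈ K) (hb : b ∈ K) (hc : c ∈ K) (hd : d ∈ K) {s : ℝ} (hs0 : 0 < s) (hs1 : s < 1)
    (p0 : p 0 = (1 - s) * a 0 + s * b 0) (p1 : p 1 = (1 - s) * a 1 + s * b 1)
    (h : orient a b c < 0) (h' : 0 < orient a b d) : p ∈ interior K := by
  rw [mem_interior_iff_mem_nhds]
  filter_upwards [eventually_mem_of_orient_ne hK ha hb hc hs0 hs1 p0 p1 h.ne,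
    eventually_mem_of_orient_ne hK ha hb hd hs0 hs1 p0 p1 h'.ne'] with x h1 h2
  rcases le_total 0 (orient a b x) with h0 | h0
  · exact h2 (div_nonneg h0 h'.le)
  · exact h1 (div_nonneg_of_nonpos h0 h.le)

/-- A relation for four points in cyclic order on the boundary of a convex set: the segment from `x`
to `z` separates `y` from `u`, strictly unless it contains one of them. -/
def Alternating (x y z u : Plane) : Prop :=
  y ∈ segment ℝ x z ∨ u ∈ segment ℝ x z ∨ (orient x z y < 0 ∧ 0 < orient x z u)

theorem Alternating.rotate_twice {x y z u : Plane} (h : Alternating x y z u) :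
    Alternating z u x y := by
  rcases h with h | h | ⟨h, h'⟩
  · right; left; rwa [segment_symm]
  · left; rwa [segment_symm]
  · right; right
    simp only [orient] at *
    constructor <;> linarith

/-- Three points met in this order on a tour of the boundary of a convex set that starts at `o`: a
left turn, or collinear in the right order up to a possible return to `o`. -/
def Tour (o x y z : Plane) : Prop :=
  0 ≤ orient x y z ∧
    (orient x y z = 0 → y ∈ segment ℝ x z ∨ (x = o ∧ z ∈ segment ℝ x y))

/-- Four points on a tour alternate. The hypotheses on `y` and `z` say that copies of `o` come first. -/
theorem Tour.alternating {o x y z u : Plane} (hxyz : Tour o x y z) (hxyu : Tour o x y u)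
    (hxzu : Tour o x z u) (hyzu : Tour o y z u) (hy : y = o → x = o) (hz : z = o → y = o) :
    Alternating x y z u := by
  have hl : ∀ a b : Plane, a ∈ segment ℝ a b := left_mem_segment ℝ
  have hr : ∀ a b : Plane, b ∈ segment ℝ a b := right_mem_segment ℝ
  by_cases h1 : orient x y z = 0
  · rcases hxyz.2 h1 with h | ⟨hxo, h⟩
    · exact .inl h
    obtain ⟨l, l0, l1, e0, e1⟩ := mem_segment_iff_coord.1 h
    by_cases hl1 : l = 1
    · subst hl1
      obtain rfl : z = y := Plane.ext (by linarith) (by linarith)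
      exact .inl (hr _ _)
    have f1 : orient y z u = -(1 - l) * orient x y u := by simp only [orient, e0, e1]; ring
    have f2 : orient x y u = 0 := by
      have := hyzu.1; have := hxyu.1
      have : 0 < 1 - l := by rcases l1.lt_or_eq with h | h <;> [linarith; exact absurd h hl1]
      nlinarith
    rcases hyzu.2 (by rw [f1, f2, mul_zero]) with h3 | ⟨h3, -⟩
    swap
    · obtain rfl : x = y := by rw [hy h3, h3]
      exact .inl (hl _ _)
    have f3 : orient x z u = 0 := by
      have : orient x z u = l * orient x y u := by simp only [orient, e0, e1]; ring
      rw [this, f2, mul_zero]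
    rcases hxzu.2 f3 with h4 | ⟨-, h4⟩
    swap
    · exact .inr (.inl h4)
    by_cases hl0 : l = 0
    · subst hl0
      have : z = x := Plane.ext (by linarith) (by linarith)
      have hyo := hz (this.trans hxo)
      obtain rfl : x = y := by rw [hyo, hxo]
      exact .inl (hl _ _)
    -- Now `z` lies between any two of `x`, `y` and `u`, hence coincides with one of them.
    obtain ⟨m, m0, m1, m2, m3⟩ := mem_segment_iff_coord.1 h4
    obtain ⟨r, r0, r1, r2, r3⟩ := mem_segment_iff_coord.1 h3
    have l0' : 0 < l := lt_of_le_of_ne l0 (Ne.symm hl0)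
    have l1' : l < 1 := lt_of_le_of_ne l1 hl1
    by_cases hzx : z = x
    · have hyo := hz (hzx.trans hxo)
      obtain rfl : x = y := by rw [hyo, hxo]
      exact .inl (hl _ _)
    have m0' : 0 < m := by
      refine lt_of_le_of_ne m0 fun hm => hzx ?_
      subst hm
      exact Plane.ext (by linarith) (by linarith)
    have key : (1 - r) * (1 - l) * m + r * (1 - m) * l = 0 := by
      by_contra hk
      apply hzx
      refine Plane.ext ?_ ?_ <;> apply mul_left_cancel₀ hk
      · linear_combination (1 - r) * m * e0 - l * m * r2 + r * l * m2
      · linear_combination (1 - r) * m * e1 - l * m * r3 + r * l * m3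
    have k1 : 0 ≤ (1 - r) * (1 - l) * m :=
      mul_nonneg (mul_nonneg (by linarith) (by linarith)) m0
    have k2 : 0 ≤ r * (1 - m) * l := mul_nonneg (mul_nonneg r0 (by linarith)) l0
    have k3 : (1 - r) * ((1 - l) * m) = 0 := by linarith
    have hr1 : r = 1 := by
      rcases mul_eq_zero.1 k3 with h | h
      · linarith
      · exact absurd h (mul_pos (by linarith) m0').ne'
    subst hr1
    obtain rfl : z = u := Plane.ext (by linarith) (by linarith)
    exact .inr (.inl (hr _ _))
  have h1' : 0 < orient x y z := lt_of_le_of_ne hxyz.1 (Ne.symm h1)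
  by_cases h2 : orient x z u = 0
  · rcases hxzu.2 h2 with h | ⟨-, h⟩
    swap
    · exact .inr (.inl h)
    obtain ⟨l, l0, l1, e0, e1⟩ := mem_segment_iff_coord.1 h
    have f1 : orient x y z = l * orient x y u := by simp only [orient, e0, e1]; ring
    have f2 : orient y z u = -(1 - l) * orient x y u := by simp only [orient, e0, e1]; ring
    have f3 := hyzu.1
    have f4 : 0 < orient x y u := by
      rcases hxyu.1.lt_or_eq with h | h
      · exact h
      · rw [← h, mul_zero] at f1; linarith
    have hl1 : l = 1 := by nlinarith
    subst hl1
    obtain rfl : z = u := Plane.ext (by linarith) (by linarith)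
    exact .inr (.inl (hr _ _))
  refine .inr (.inr ⟨?_, lt_of_le_of_ne hxzu.1 (Ne.symm h2)⟩)
  simp only [orient] at *
  linarith

/-- The same for the four points in the order that begins with the second one. -/
theorem Tour.alternating_rotate {o x y z u : Plane} (hxyz : Tour o x y z) (hxyu : Tour o x y u)
    (hxzu : Tour o x z u) (hyzu : Tour o y z u) (hy : y = o → x = o) :
    Alternating y z u x := by
  have hl : ∀ a b : Plane, a ∈ segment ℝ a b := left_mem_segment ℝ
  have hr : ∀ a b : Plane, b ∈ segment ℝ a b := right_mem_segment ℝ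
  by_cases h1 : orient y z u = 0
  · rcases hyzu.2 h1 with h | ⟨h3, -⟩
    · exact .inl h
    · obtain rfl : x = y := by rw [hy h3, h3]
      exact .inr (.inl (hl _ _))
  have h1' : 0 < orient y z u := lt_of_le_of_ne hyzu.1 (Ne.symm h1)
  by_cases h2 : orient x y u = 0
  · rcases hxyu.2 h2 with h | ⟨-, h⟩
    · obtain ⟨l, l0, l1, e0, e1⟩ := mem_segment_iff_coord.1 h
      have f1 : orient y z u = (1 - l) * orient x z u := by simp only [orient, e0, e1]; ring
      have f2 : orient x y z = -l * orient x z u := by simp only [orient, e0, e1]; ring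
      have f3 := hxyz.1
      have f4 : 0 < orient x z u := by
        rcases hxzu.1.lt_or_eq with h | h
        · exact h
        · rw [← h, mul_zero] at f1; linarith
      have hl1 : l = 0 := by nlinarith
      subst hl1
      obtain rfl : x = y := Plane.ext (by linarith) (by linarith)
      exact .inr (.inl (hl _ _))
    · obtain ⟨l, l0, l1, e0, e1⟩ := mem_segment_iff_coord.1 h
      have f1 : orient y z u = (1 - l) * orient x y z := by simp only [orient, e0, e1]; ring
      have f2 : orient x z u = -l * orient x y z := by simp only [orient, e0, e1]; ring
      have f3 := hxzu.1
      have f4 : 0 < orient x y z := by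
        rcases hxyz.1.lt_or_eq with h | h
        · exact h
        · rw [← h, mul_zero] at f1; linarith
      have hl1 : l = 0 := by nlinarith
      subst hl1
      obtain rfl : x = u := Plane.ext (by linarith) (by linarith)
      exact .inr (.inl (hr _ _))
  refine .inr (.inr ⟨?_, ?_⟩)
  · simp only [orient] at *
    linarith
  · have : 0 < orient x y u := lt_of_le_of_ne hxyu.1 (Ne.symm h2)
    simp only [orient] at *
    linarith

/-! ### Sorting boundary points -/

section TourKey

variable {n : ℕ} (S : Fin n → Plane) (r m : Fin n)

/-- The inner product of `S j - S m` with the reference direction `S r - S m`. -/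
noncomputable def keyD (j : Fin n) : ℝ :=
  (S r 0 - S m 0) * (S j 0 - S m 0) + (S r 1 - S m 1) * (S j 1 - S m 1)

/-- The sum of the cross products of `S j - S m` with all `S l - S m`. Of the points on a side of the
hull at `S m`, it is positive if that side is the first one of a counterclockwise tour, negative if
it is the last one. -/
noncomputable def keyE (j : Fin n) : ℝ := ∑ l, orient (S m) (S j) (S l)

/-- The key by which the points are sorted: copies of `S m` first, then by the direction seen from
`S m`; on the first side of the tour by increasing distance from `S m`, on the last one by
decreasing distance. The index breaks the remaining ties. Division by zero gives zero, so the first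
component is `0` for the copies of `S m` and `1` for all other points. -/
noncomputable def tourKey (j : Fin n) : ℝ ×ₗ ℝ ×ₗ ℝ ×ₗ ℝ ×ₗ ℕ :=
  toLex (keyD S r m j / keyD S r m j, toLex (orient (S m) (S r) (S j) / keyD S r m j,
    toLex (keyE S m j, toLex (keyD S r m j, (j : ℕ)))))

theorem tourKey_injective : Function.Injective (tourKey S r m) := by
  intro a b h
  have h1 := congrArg (fun x => (ofLex (ofLex (ofLex (ofLex x).2).2).2).2) h
  exact Fin.ext h1

theorem tourKey_lt_iff (a b : Fin n) :
    tourKey S r m a < tourKey S r m b ↔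
      (keyD S r m a / keyD S r m a < keyD S r m b / keyD S r m b ∨
        keyD S r m a / keyD S r m a = keyD S r m b / keyD S r m b ∧
      (orient (S m) (S r) (S a) / keyD S r m a < orient (S m) (S r) (S b) / keyD S r m b ∨
        orient (S m) (S r) (S a) / keyD S r m a = orient (S m) (S r) (S b) / keyD S r m b ∧
      (keyE S m a < keyE S m b ∨ keyE S m a = keyE S m b ∧
      (keyD S r m a < keyD S r m b ∨ keyD S r m a = keyD S r m b ∧ (a : ℕ) < b)))) := by
  simp [tourKey, Prod.Lex.toLex_lt_toLex]

variable {S r m}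

/-- If `S m` is farthest from `S r`, then all points lie in the half plane at `S m` around the direction
to `S r`. -/
theorem keyD_nonneg
    (hfar : ∀ j, (S j 0 - S r 0) ^ 2 + (S j 1 - S r 1) ^ 2 ≤
      (S m 0 - S r 0) ^ 2 + (S m 1 - S r 1) ^ 2) (j : Fin n) : 0 ≤ keyD S r m j := by
  have := hfar j
  simp only [keyD]
  nlinarith [sq_nonneg (S j 0 - S m 0), sq_nonneg (S j 1 - S m 1)]

theorem eq_of_keyD_eq_zero
    (hfar : ∀ j, (S j 0 - S r 0) ^ 2 + (S j 1 - S r 1) ^ 2 ≤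
      (S m 0 - S r 0) ^ 2 + (S m 1 - S r 1) ^ 2) {j : Fin n} (h : keyD S r m j = 0) :
    S j = S m := by
  have := hfar j
  simp only [keyD] at h
  have h1 : (S j 0 - S m 0) ^ 2 + (S j 1 - S m 1) ^ 2 ≤ 0 := by nlinarith
  refine Plane.ext ?_ ?_ <;>
    nlinarith [sq_nonneg (S j 0 - S m 0), sq_nonneg (S j 1 - S m 1)]

theorem keyD_eq_zero {j : Fin n} (h : S j = S m) : keyD S r m j = 0 := by
  simp [keyD, h]

/-- In the open half plane at `S m` around the direction to `S r`, sorting by slope is sorting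
counterclockwise. -/
theorem slope_le_iff {a b : Fin n} (ha : 0 < keyD S r m a) (hb : 0 < keyD S r m b) :
    orient (S m) (S r) (S a) / keyD S r m a ≤ orient (S m) (S r) (S b) / keyD S r m b ↔
      0 ≤ orient (S m) (S a) (S b) := by
  rw [div_le_div_iff₀ ha hb]
  have he : 0 < (S r 0 - S m 0) ^ 2 + (S r 1 - S m 1) ^ 2 := by
    by_contra h
    have e0 : S r 0 - S m 0 = 0 := by nlinarith [sq_nonneg (S r 0 - S m 0), sq_nonneg (S r 1 - S m 1)]
    have e1 : S r 1 - S m 1 = 0 := by nlinarith [sq_nonneg (S r 0 - S m 0), sq_nonneg (S r 1 - S m 1)]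
    simp [keyD, e0, e1] at ha
  have key : ((S r 0 - S m 0) ^ 2 + (S r 1 - S m 1) ^ 2) * orient (S m) (S a) (S b) =
      orient (S m) (S r) (S b) * keyD S r m a - orient (S m) (S r) (S a) * keyD S r m b := by
    simp only [orient, keyD]; ring
  constructor
  · intro h
    refine nonneg_of_mul_nonneg_right (b := orient (S m) (S a) (S b)) ?_ he
    linarith
  · intro h
    have := mul_nonneg he.le h
    linarith

theorem orient_swap (o a b : Plane) : orient o a b = - orient o b a := by
  simp only [orient]; ring

/-- The geometric content of the sorted order, for points other than copies of `S m`. -/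
theorem tourKey_le
    (hfar : ∀ j, (S j 0 - S r 0) ^ 2 + (S j 1 - S r 1) ^ 2 ≤
      (S m 0 - S r 0) ^ 2 + (S m 1 - S r 1) ^ 2) {a b : Fin n}
    (h : tourKey S r m a ≤ tourKey S r m b) (ha : 0 < keyD S r m a) :
    0 < keyD S r m b ∧ 0 ≤ orient (S m) (S a) (S b) ∧
      (orient (S m) (S a) (S b) = 0 → keyE S m a < keyE S m b ∨
        (keyE S m a = keyE S m b ∧ keyD S r m a ≤ keyD S r m b)) := by
  simp only [tourKey, Prod.Lex.toLex_le_toLex] at h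
  have hb : 0 < keyD S r m b := by
    refine lt_of_le_of_ne (keyD_nonneg hfar b) fun hb => ?_
    rw [← hb, div_self ha.ne'] at h
    norm_num at h
  rw [div_self ha.ne', div_self hb.ne'] at h
  simp only [lt_irrefl, true_and, false_or] at h
  refine ⟨hb, (slope_le_iff ha hb).1 ?_, fun h0 => ?_⟩
  · rcases h with h | h
    · exact h.le
    · exact h.1.le
  · have h1 : orient (S m) (S r) (S b) / keyD S r m b ≤ orient (S m) (S r) (S a) / keyD S r m a := by
      rw [slope_le_iff hb ha, orient_swap, h0, neg_zero]
    rcases h with h | h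
    · exact absurd h h1.not_gt
    · rcases h.2 with h | ⟨h, h'⟩
      · exact .inl h
      · refine .inr ⟨h, ?_⟩
        rcases h' with h' | h'
        · exact h'.le
        · exact h'.1.le

/-- The copies of `S m` come first in the sorted order. -/
theorem eq_of_tourKey_le
    (hfar : ∀ j, (S j 0 - S r 0) ^ 2 + (S j 1 - S r 1) ^ 2 ≤
      (S m 0 - S r 0) ^ 2 + (S m 1 - S r 1) ^ 2) {a b : Fin n}
    (h : tourKey S r m a ≤ tourKey S r m b) (hb : S b = S m) : S a = S m := by
  by_contra ha
  have h1 : 0 < keyD S r m a :=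
    lt_of_le_of_ne (keyD_nonneg hfar a) fun h0 => ha (eq_of_keyD_eq_zero hfar h0.symm)
  exact (tourKey_le hfar h h1).1.ne' (keyD_eq_zero hb)

theorem parallel_of_orient_eq_zero {a b : Fin n} (ha : 0 < keyD S r m a)
    (h : orient (S m) (S a) (S b) = 0) :
    ∀ i : Fin 2, S b i - S m i = keyD S r m b / keyD S r m a * (S a i - S m i) := by
  have h0 : keyD S r m a * (S b 0 - S m 0) = keyD S r m b * (S a 0 - S m 0) := by
    simp only [orient, keyD] at *
    linear_combination (-(S r 1 - S m 1)) * h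
  have h1 : keyD S r m a * (S b 1 - S m 1) = keyD S r m b * (S a 1 - S m 1) := by
    simp only [orient, keyD] at *
    linear_combination (S r 0 - S m 0) * h
  intro i
  rw [div_mul_eq_mul_div, eq_div_iff ha.ne']
  fin_cases i
  · simp only [Fin.zero_eta, Fin.isValue]; linarith
  · simp only [Fin.mk_one, Fin.isValue]; linarith

theorem keyE_of_parallel {a b : Fin n} {c : ℝ}
    (h : ∀ i : Fin 2, S b i - S m i = c * (S a i - S m i)) : keyE S m b = c * keyE S m a := by
  simp only [keyE, Finset.mul_sum, orient, h]
  exact Finset.sum_congr rfl fun l _ => by ring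

/-- On a ray from `S m`, the sorted order is monotone. -/
theorem mem_segment_of_parallel {a b c : Fin n} (ha : 0 < keyD S r m a)
    (hb : 0 < keyD S r m b) (hc : 0 < keyD S r m c)
    (hab : ∀ i : Fin 2, S b i - S m i = keyD S r m b / keyD S r m a * (S a i - S m i))
    (hac : ∀ i : Fin 2, S c i - S m i = keyD S r m c / keyD S r m a * (S a i - S m i))
    (h1 : keyE S m a < keyE S m b ∨ (keyE S m a = keyE S m b ∧ keyD S r m a ≤ keyD S r m b))
    (h2 : keyE S m b < keyE S m c ∨ (keyE S m b = keyE S m c ∧ keyD S r m b ≤ keyD S r m c)) :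
    S b ∈ segment ℝ (S a) (S c) := by
  have eb := keyE_of_parallel hab
  have ec := keyE_of_parallel hac
  generalize keyE S m a = E at *
  have eb' : keyE S m b * keyD S r m a = keyD S r m b * E := by rw [eb]; field_simp
  have ec' : keyE S m c * keyD S r m a = keyD S r m c * E := by rw [ec]; field_simp
  have mono : (keyD S r m a ≤ keyD S r m b ∧ keyD S r m b ≤ keyD S r m c) ∨
      (keyD S r m b ≤ keyD S r m a ∧ keyD S r m c ≤ keyD S r m b) := by
    have i1 : E ≤ keyE S m b := by rcases h1 with h | h <;> linarith
    have i2 : keyE S m b ≤ keyE S m c := by rcases h2 with h | h <;> linarith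
    rcases lt_trichotomy E 0 with hE | hE | hE
    · right; constructor <;> by_contra! h <;> nlinarith
    · subst hE
      have z1 : keyE S m b = 0 := by rw [eb, mul_zero]
      have z2 : keyE S m c = 0 := by rw [ec, mul_zero]
      left
      rw [z1] at h1 h2; rw [z2] at h2
      simp at h1 h2
      exact ⟨h1, h2⟩
    · left; constructor <;> by_contra! h <;> nlinarith
  rw [mem_segment_iff_coord]
  have b0 := hab 0; have b1 := hab 1; have c0 := hac 0; have c1 := hac 1
  generalize keyD S r m a = A at *
  generalize keyD S r m b = B at *
  generalize keyD S r m c = C at *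
  by_cases hAC : C = A
  · have hB : B = A := by rcases mono with h | h <;> linarith [h.1, h.2]
    subst hB
    rw [div_self hb.ne', one_mul] at b0 b1
    exact ⟨0, le_rfl, zero_le_one, by linarith, by linarith⟩
  · have hAC' : C - A ≠ 0 := sub_ne_zero.2 hAC
    refine ⟨(B - A) / (C - A), ?_, ?_, ?_, ?_⟩
    · rcases mono with h | h
      · exact div_nonneg (by linarith) (by linarith)
      · exact div_nonneg_of_nonpos (by linarith) (by linarith)
    · rcases mono with h | h
      · rw [div_le_one (lt_of_le_of_ne (by linarith) (Ne.symm hAC'))]; linarith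
      · rw [div_le_one_of_neg (lt_of_le_of_ne (by linarith) hAC')]; linarith
    · have e1 : S b 0 = S m 0 + B / A * (S a 0 - S m 0) := by linarith
      have e2 : S c 0 = S m 0 + C / A * (S a 0 - S m 0) := by linarith
      rw [e1, e2]; field_simp; ring
    · have e1 : S b 1 = S m 1 + B / A * (S a 1 - S m 1) := by linarith
      have e2 : S c 1 = S m 1 + C / A * (S a 1 - S m 1) := by linarith
      rw [e1, e2]; field_simp; ring

/-- Points on the boundary of a convex set, sorted by `tourKey`, are met in this order on a tour of
the boundary. -/
theorem tour_of_tourKey_le {K : Set Plane} (hK : Convex ℝ K) (hSK : ∀ j, S j ∈ K)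
    (hSi : ∀ j, S j ∉ interior K)
    (hfar : ∀ j, (S j 0 - S r 0) ^ 2 + (S j 1 - S r 1) ^ 2 ≤
      (S m 0 - S r 0) ^ 2 + (S m 1 - S r 1) ^ 2) {a b c : Fin n}
    (hab : tourKey S r m a ≤ tourKey S r m b) (hbc : tourKey S r m b ≤ tourKey S r m c) :
    Tour (S m) (S a) (S b) (S c) := by
  have pos : ∀ j, S j ≠ S m → 0 < keyD S r m j := fun j hj =>
    lt_of_le_of_ne (keyD_nonneg hfar j) fun h0 => hj (eq_of_keyD_eq_zero hfar h0.symm)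
  by_cases ha : S a = S m
  · rw [ha]
    by_cases hb : S b = S m
    · rw [hb]
      exact ⟨by simp [orient], fun _ => .inl (left_mem_segment ℝ _ _)⟩
    have hDb := pos b hb
    obtain ⟨hDc, h1, -⟩ := tourKey_le hfar hbc hDb
    refine ⟨h1, fun h0 => ?_⟩
    have par := parallel_of_orient_eq_zero hDb h0
    have e0 := par 0; have e1 := par 1
    rcases le_total (keyD S r m c) (keyD S r m b) with h | h
    · refine .inr ⟨rfl, mem_segment_iff_coord.2 ⟨_, by positivity, (div_le_one hDb).2 h, ?_, ?_⟩⟩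
      · linarith
      · linarith
    · refine .inl (mem_segment_iff_coord.2 ⟨keyD S r m b / keyD S r m c, by positivity,
        (div_le_one hDc).2 h, ?_, ?_⟩)
      · have : S c 0 = S m 0 + keyD S r m c / keyD S r m b * (S b 0 - S m 0) := by linarith
        rw [this]; field_simp; ring
      · have : S c 1 = S m 1 + keyD S r m c / keyD S r m b * (S b 1 - S m 1) := by linarith
        rw [this]; field_simp; ring
  have hDa := pos a ha
  obtain ⟨hDb, oab, tab⟩ := tourKey_le hfar hab hDa
  obtain ⟨hDc, obc, tbc⟩ := tourKey_le hfar hbc hDb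
  obtain ⟨-, oac, tac⟩ := tourKey_le hfar (hab.trans hbc) hDa
  have expand : orient (S a) (S b) (S c) = orient (S m) (S a) (S b) + orient (S m) (S b) (S c) -
      orient (S m) (S a) (S c) := by simp only [orient]; ring
  by_cases hac : orient (S m) (S a) (S c) = 0
  · -- All three points lie on one ray from `S m`.
    have pac := parallel_of_orient_eq_zero hDa hac
    have e1 : orient (S m) (S b) (S c) =
        - (keyD S r m c / keyD S r m a) * orient (S m) (S a) (S b) := by
      have e0 := pac 0; have e1 := pac 1
      simp only [orient, e0, e1]; ring
    have hab0 : orient (S m) (S a) (S b) = 0 := by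
      have : 0 < keyD S r m c / keyD S r m a := by positivity
      nlinarith
    have hbc0 : orient (S m) (S b) (S c) = 0 := by rw [e1, hab0, mul_zero]
    refine ⟨by rw [expand, hac, hab0, hbc0]; simp, fun _ => .inl ?_⟩
    exact mem_segment_of_parallel hDa hDb hDc (parallel_of_orient_eq_zero hDa hab0) pac (tab hab0)
      (tbc hbc0)
  have hac' : 0 < orient (S m) (S a) (S c) := lt_of_le_of_ne oac (Ne.symm hac)
  -- The coordinates of `S b` with respect to `S a` and `S c`, as seen from `S m`.
  obtain ⟨α, hα⟩ : ∃ α, α = orient (S m) (S b) (S c) / orient (S m) (S a) (S c) := ⟨_, rfl⟩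
  obtain ⟨β, hβ⟩ : ∃ β, β = orient (S m) (S a) (S b) / orient (S m) (S a) (S c) := ⟨_, rfl⟩
  have hα0 : 0 ≤ α := hα ▸ div_nonneg obc hac'.le
  have hβ0 : 0 ≤ β := hβ ▸ div_nonneg oab hac'.le
  have hα' : α * orient (S m) (S a) (S c) = orient (S m) (S b) (S c) := by
    rw [hα]; field_simp
  have hβ' : β * orient (S m) (S a) (S c) = orient (S m) (S a) (S b) := by
    rw [hβ]; field_simp
  have b0 : S b 0 = S m 0 + α * (S a 0 - S m 0) + β * (S c 0 - S m 0) := by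
    apply mul_left_cancel₀ hac
    simp only [orient] at *
    linear_combination (-(S a 0 - S m 0)) * hα' - (S c 0 - S m 0) * hβ'
  have b1 : S b 1 = S m 1 + α * (S a 1 - S m 1) + β * (S c 1 - S m 1) := by
    apply mul_left_cancel₀ hac
    simp only [orient] at *
    linear_combination (-(S a 1 - S m 1)) * hα' - (S c 1 - S m 1) * hβ'
  have expand' : orient (S a) (S b) (S c) = (α + β - 1) * orient (S m) (S a) (S c) := by
    rw [expand, ← hα', ← hβ']; ring
  have main : 1 ≤ α + β := by
    by_contra! hlt
    rcases hα0.lt_or_eq with hα1 | hα1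
    · rcases hβ0.lt_or_eq with hβ1 | hβ1
      · -- `S b` is inside of the triangle.
        have hsum : 0 < α + β := by linarith
        have hz : (α / (α + β)) • S a + (β / (α + β)) • S c ∈ K :=
          hK (hSK a) (hSK c) (by positivity) (by positivity) (by field_simp)
        refine hSi b (mem_interior_of_orient hK (hSK m) hz (hSK a) (hSK c) hsum hlt ?_ ?_ ?_ ?_)
        · simp only [PiLp.add_apply, PiLp.smul_apply, smul_eq_mul, b0]
          field_simp; ring
        · simp only [PiLp.add_apply, PiLp.smul_apply, smul_eq_mul, b1]
          field_simp; ring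
        · have : orient (S m) ((α / (α + β)) • S a + (β / (α + β)) • S c) (S a) =
              - (β / (α + β)) * orient (S m) (S a) (S c) := by
            simp only [orient, PiLp.add_apply, PiLp.smul_apply, smul_eq_mul]
            field_simp; ring
          rw [this, neg_mul, neg_lt_zero]
          positivity
        · have : orient (S m) ((α / (α + β)) • S a + (β / (α + β)) • S c) (S c) =
              (α / (α + β)) * orient (S m) (S a) (S c) := by
            simp only [orient, PiLp.add_apply, PiLp.smul_apply, smul_eq_mul]
            field_simp; ring
          rw [this]
          positivity
      · -- `S b` lies between `S m` and `S a`; the tie-breaking gives a point to the right of this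
        -- segment, while `S c` lies to the left of it.
        have hα1' : α < 1 := by linarith
        subst hβ1
        have hpar : ∀ i : Fin 2, S b i - S m i = α * (S a i - S m i) := by
          intro i; fin_cases i
          · simp only [Fin.zero_eta, Fin.isValue]; linarith
          · simp only [Fin.mk_one, Fin.isValue]; linarith
        have hE := keyE_of_parallel hpar
        have hD : keyD S r m b = α * keyD S r m a := by
          simp only [keyD, hpar]; ring
        have hneg : keyE S m a < 0 := by
          rcases tab (by rw [← hβ', zero_mul]) with h | ⟨-, h⟩
          · rw [hE] at h; nlinarith
          · rw [hD] at h; nlinarith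
        obtain ⟨l, -, hl⟩ := Finset.exists_lt_of_sum_lt (s := Finset.univ)
          (f := fun l => orient (S m) (S a) (S l)) (g := fun _ => 0) (by simpa [keyE] using hneg)
        exact hSi b (mem_interior_of_orient hK (hSK m) (hSK a) (hSK l) (hSK c) hα1 hα1'
          (by linarith) (by linarith) hl hac')
    · subst hα1
      have hβ1 : 0 < β := by
        refine lt_of_le_of_ne hβ0 fun h => ?_
        subst h
        have : S b = S m := Plane.ext (by linarith) (by linarith)
        exact hDb.ne' (keyD_eq_zero this)
      have hβ1' : β < 1 := by linarith
      have hpar : ∀ i : Fin 2, S b i - S m i = β * (S c i - S m i) := by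
        intro i; fin_cases i
        · simp only [Fin.zero_eta, Fin.isValue]; linarith
        · simp only [Fin.mk_one, Fin.isValue]; linarith
      have hE := keyE_of_parallel hpar
      have hpos : 0 ≤ keyE S m c := by
        have h : keyE S m b ≤ keyE S m c := by
          rcases tbc (by rw [← hα', zero_mul]) with h | h <;> linarith
        rw [hE] at h; nlinarith
      obtain ⟨l, hl⟩ : ∃ l, 0 < orient (S m) (S c) (S l) := by
        by_contra! h
        have : keyE S m c < 0 := by
          refine Finset.sum_neg' (fun i _ => h i) ⟨a, Finset.mem_univ _, ?_⟩
          rw [orient_swap]; linarith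
        linarith
      refine hSi b (mem_interior_of_orient hK (hSK m) (hSK c) (hSK a) (hSK l) hβ1 hβ1'
        (by linarith) (by linarith) ?_ hl)
      rw [orient_swap]; linarith
  refine ⟨by rw [expand']; exact mul_nonneg (by linarith) hac'.le, fun h0 => .inl ?_⟩
  have hsum : α + β = 1 := by
    rw [expand'] at h0
    have := (mul_eq_zero.1 h0).resolve_right hac
    linarith
  have hα2 : α = 1 - β := by linarith
  subst hα2
  exact mem_segment_iff_coord.2 ⟨β, hβ0, by linarith, by linarith, by linarith⟩

end TourKey

section TourRank

variable {n : ℕ} (S : Fin n → Plane) (r m : Fin n)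

/-- The position of a point in the sorted order. -/
noncomputable def tourRank (j : Fin n) : ℕ :=
  (Finset.univ.filter fun i => tourKey S r m i < tourKey S r m j).card

theorem tourRank_lt_iff (i j : Fin n) :
    tourRank S r m i < tourRank S r m j ↔ tourKey S r m i < tourKey S r m j := by
  have mono : ∀ i j, tourKey S r m i < tourKey S r m j → tourRank S r m i < tourRank S r m j := by
    intro i j h
    refine Finset.card_lt_card (Finset.ssubset_iff_of_subset ?_ |>.2 ⟨i, ?_, ?_⟩)
    · intro l hl
      simp only [Finset.mem_filter, Finset.mem_univ, true_and] at *
      exact hl.trans h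
    · simpa using h
    · simp
  refine ⟨fun h => ?_, mono i j⟩
  by_contra! h'
  rcases h'.lt_or_eq with h' | h'
  · exact absurd (mono _ _ h') h.not_gt
  · rw [tourKey_injective S r m h'] at h; exact absurd h (lt_irrefl _)

theorem tourRank_injective : Function.Injective (tourRank S r m) := by
  intro i j h
  apply tourKey_injective S r m
  have h1 := tourRank_lt_iff S r m i j
  have h2 := tourRank_lt_iff S r m j i
  rw [h] at h1 h2
  simp only [lt_irrefl, false_iff, not_lt] at h1 h2
  exact le_antisymm h2 h1

theorem tourRank_lt (j : Fin n) : tourRank S r m j < n := by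
  calc tourRank S r m j < (Finset.univ : Finset (Fin n)).card := by
        refine Finset.card_lt_card (Finset.ssubset_iff_of_subset (Finset.subset_univ _) |>.2
          ⟨j, Finset.mem_univ _, by simp⟩)
    _ = n := by simp

theorem exists_tourRank_eq (x : ℕ) : ∃ j, tourRank S r m j = x % n := by
  have hn : 0 < n := r.pos
  have hinj : Function.Injective fun j => (⟨tourRank S r m j, tourRank_lt S r m j⟩ : Fin n) := by
    intro i j h
    exact tourRank_injective S r m (by simpa using h)
  obtain ⟨j, hj⟩ := (Finite.injective_iff_surjective.1 hinj) ⟨x % n, Nat.mod_lt _ hn⟩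
  exact ⟨j, by simpa using hj⟩

/-- The point met at time `x` on a periodic tour in sorted order. -/
noncomputable def tourAt (x : ℕ) : Fin n := (exists_tourRank_eq S r m x).choose

theorem tourRank_tourAt (x : ℕ) : tourRank S r m (tourAt S r m x) = x % n :=
  (exists_tourRank_eq S r m x).choose_spec

theorem tourAt_mod (x : ℕ) : tourAt S r m (x % n) = tourAt S r m x :=
  tourRank_injective S r m (by simp [tourRank_tourAt])

theorem tourAt_add (x : ℕ) : tourAt S r m (x + n) = tourAt S r m x :=
  tourRank_injective S r m (by simp [tourRank_tourAt])

variable {S r m}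

/-- Points of a convex set on its boundary alternate on the periodic tour. -/
theorem alternating_tourAt {K : Set Plane} (hK : Convex ℝ K) (hSK : ∀ j, S j ∈ K)
    (hSi : ∀ j, S j ∉ interior K)
    (hfar : ∀ j, (S j 0 - S r 0) ^ 2 + (S j 1 - S r 1) ^ 2 ≤
      (S m 0 - S r 0) ^ 2 + (S m 1 - S r 1) ^ 2) {x y z u : ℕ}
    (hxy : x < y) (hyz : y < z) (hzu : z < u) (hux : u < x + n) :
    Alternating (S (tourAt S r m x)) (S (tourAt S r m y)) (S (tourAt S r m z))
      (S (tourAt S r m u)) := by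
  have le_of : ∀ x y, x < y → y < n →
      tourKey S r m (tourAt S r m x) ≤ tourKey S r m (tourAt S r m y) := by
    intro x y h h'
    refine ((tourRank_lt_iff S r m _ _).1 ?_).le
    rwa [tourRank_tourAt, tourRank_tourAt, Nat.mod_eq_of_lt h', Nat.mod_eq_of_lt (by omega)]
  have base : ∀ x y z u, x < y → y < z → z < u → u < n →
      Alternating (S (tourAt S r m x)) (S (tourAt S r m y)) (S (tourAt S r m z))
        (S (tourAt S r m u)) ∧
      Alternating (S (tourAt S r m y)) (S (tourAt S r m z)) (S (tourAt S r m u))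
        (S (tourAt S r m x)) := by
    intro x y z u h1 h2 h3 h4
    have t := fun {a b c} => tour_of_tourKey_le hK hSK hSi hfar (a := a) (b := b) (c := c)
    have kxy := le_of x y h1 (by omega)
    have kyz := le_of y z h2 (by omega)
    have kzu := le_of z u h3 (by omega)
    exact ⟨(t kxy kyz).alternating (t kxy (kyz.trans kzu)) (t (kxy.trans kyz) kzu) (t kyz kzu)
        (eq_of_tourKey_le hfar kxy) (eq_of_tourKey_le hfar kyz),
      (t kxy kyz).alternating_rotate (t kxy (kyz.trans kzu)) (t (kxy.trans kyz) kzu) (t kyz kzu)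
        (eq_of_tourKey_le hfar kxy)⟩
  have hn : 0 < n := r.pos
  -- Shift the first position below `n`.
  have shift : ∀ q x, tourAt S r m (q * n + x) = tourAt S r m x := by
    intro q x
    rw [← tourAt_mod, ← tourAt_mod S r m x, Nat.mul_add_mod_self_right]
  obtain ⟨q, hq⟩ : ∃ q, q = x / n := ⟨_, rfl⟩
  have hx := Nat.div_add_mod x n
  rw [← hq, mul_comm] at hx
  have hxn := Nat.mod_lt x hn
  obtain ⟨x', rfl⟩ : ∃ x', x = q * n + x' := ⟨x % n, hx.symm⟩
  have hx' : x' < n := by omega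
  obtain ⟨y', rfl⟩ : ∃ y', y = q * n + y' := ⟨y - q * n, by omega⟩
  obtain ⟨z', rfl⟩ : ∃ z', z = q * n + z' := ⟨z - q * n, by omega⟩
  obtain ⟨u', rfl⟩ : ∃ u', u = q * n + u' := ⟨u - q * n, by omega⟩
  simp only [shift]
  by_cases hu : u' < n
  · exact (base x' y' z' u' (by omega) (by omega) (by omega) hu).1
  obtain ⟨u, rfl⟩ : ∃ u, u' = u + n := ⟨u' - n, by omega⟩
  rw [tourAt_add]
  by_cases hz : z' < n
  · exact (base u x' y' z' (by omega) (by omega) (by omega) hz).2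
  obtain ⟨z, rfl⟩ : ∃ z, z' = z + n := ⟨z' - n, by omega⟩
  rw [tourAt_add]
  by_cases hy : y' < n
  · exact (base z u x' y' (by omega) (by omega) (by omega) hy).1.rotate_twice
  obtain ⟨y, rfl⟩ : ∃ y, y' = y + n := ⟨y' - n, by omega⟩
  rw [tourAt_add]
  exact (base y z u x' (by omega) (by omega) (by omega) hx').2.rotate_twice

end TourRank

/-! ### Optimal Steiner points -/

/-- The squared distance, in coordinates. -/
noncomputable def sqDist (a b : Plane) : ℝ := (a 0 - b 0) ^ 2 + (a 1 - b 1) ^ 2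

theorem dist_eq_sqrt_sqDist (a b : Plane) : dist a b = Real.sqrt (sqDist a b) := by
  rw [EuclideanSpace.dist_eq, Fin.sum_univ_two, sqDist, Real.dist_eq, Real.dist_eq, sq_abs, sq_abs]

theorem sqDist_nonneg (a b : Plane) : 0 ≤ sqDist a b := by unfold sqDist; positivity

theorem dist_le_dist_iff {a b c d : Plane} : dist a b ≤ dist c d ↔ sqDist a b ≤ sqDist c d := by
  rw [dist_eq_sqrt_sqDist, dist_eq_sqrt_sqDist, Real.sqrt_le_sqrt_iff (sqDist_nonneg _ _)]

/-- Every point has a substitute in a closed convex set that is at least as close to all points of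
this set. -/
theorem exists_projection {K : Set Plane} (hK : Convex ℝ K) (hc : IsCompact K)
    (hne : K.Nonempty) (q : Plane) : ∃ q' ∈ K, ∀ k ∈ K, dist q' k ≤ dist q k := by
  obtain ⟨q', hq', h⟩ := exists_norm_eq_iInf_of_complete_convex hne hc.isComplete hK q
  rw [norm_eq_iInf_iff_real_inner_le_zero hK hq'] at h
  refine ⟨q', hq', fun k hk => ?_⟩
  have h1 := h k hk
  rw [dist_eq_norm, dist_eq_norm]
  have e : q - k = (q - q') - (k - q') := by abel
  have h2 : ‖q - k‖ ^ 2 = ‖q - q'‖ ^ 2 - 2 * inner ℝ (q - q') (k - q') + ‖k - q'‖ ^ 2 := by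
    rw [e, norm_sub_sq_real]
  rw [norm_sub_rev q' k]
  refine le_of_sq_le_sq ?_ (norm_nonneg _)
  nlinarith [sq_nonneg ‖q - q'‖]

section Facilities

variable {n : ℕ}

/-- The cost of opening Steiner points at the positions `q i` (for free at the sink) and connecting
source `s` to number `g s`. -/
noncomputable def assignCost (S : Fin n → Plane) (t : Plane) (g : Fin n → Fin n)
    (q : Fin n → Plane) : ℝ :=
  ∑ i, dist (q i) t + ∑ s, dist (S s) (q (g s))

/-- For each assignment there are optimal positions in `K` by compactness, and projection to `K` does
not increase the cost of other positions. -/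
theorem exists_assignCost_min {K : Set Plane} (hK : Convex ℝ K) (hc : IsCompact K)
    {S : Fin n → Plane} {t : Plane} (ht : t ∈ K) (hS : ∀ s, S s ∈ K) :
    ∃ g q, (∀ i, q i ∈ K) ∧ ∀ g' q', assignCost S t g q ≤ assignCost S t g' q' := by
  have h1 : ∀ g : Fin n → Fin n, ∃ q : Fin n → Plane, (∀ i, q i ∈ K) ∧
      ∀ q', (∀ i, q' i ∈ K) → assignCost S t g q ≤ assignCost S t g q' := by
    intro g
    obtain ⟨q, hq, hmin⟩ := (isCompact_univ_pi fun _ : Fin n => hc).exists_isMinOn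
      (f := assignCost S t g) ⟨fun _ => t, fun _ _ => ht⟩ (by unfold assignCost; fun_prop)
    exact ⟨q, fun i => hq i (Set.mem_univ _), fun q' hq' => hmin fun i _ => hq' i⟩
  choose Q hQ hQmin using h1
  obtain ⟨g, -, hg⟩ := Finset.exists_min_image (Finset.univ : Finset (Fin n → Fin n))
    (fun g => assignCost S t g (Q g)) ⟨id, Finset.mem_univ _⟩
  refine ⟨g, Q g, hQ g, fun g' q' => ?_⟩
  choose p hp hpd using fun i => exists_projection hK hc ⟨t, ht⟩ (q' i)
  calc assignCost S t g (Q g) ≤ assignCost S t g' (Q g') := hg g' (Finset.mem_univ _)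
    _ ≤ assignCost S t g' p := hQmin g' p hp
    _ ≤ assignCost S t g' q' := by
      unfold assignCost
      gcongr with i _ s _
      · exact hpd i t ht
      · rw [dist_comm, dist_comm (S s)]
        exact hpd _ _ (hS s)

/-- The order in which ties between Steiner points are broken: points at the sink come last. -/
noncomputable def prio (t : Plane) (q : Fin n → Plane) (i : Fin n) : ℕ :=
  open Classical in if q i = t then n + i else i

theorem prio_injective (t : Plane) (q : Fin n → Plane) : Function.Injective (prio t q) := by
  intro i j h
  unfold prio at h
  have := i.2; have := j.2
  split_ifs at h <;> exact Fin.ext (by omega)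

/-- Optimal positions `q` of the Steiner points in `K`, and the assignment `col` of each source to
the nearest of them, with ties broken by `prio`. -/
structure Optimal (K : Set Plane) (S : Fin n → Plane) (t : Plane) (q : Fin n → Plane)
    (col : Fin n → Fin n) : Prop where
  mem : ∀ i, q i ∈ K
  le : ∀ g' q', assignCost S t col q ≤ assignCost S t g' q'
  near : ∀ s j, sqDist (S s) (q (col s)) ≤ sqDist (S s) (q j)
  tie : ∀ s j, sqDist (S s) (q j) = sqDist (S s) (q (col s)) → prio t q (col s) ≤ prio t q j

theorem exists_optimal {K : Set Plane} (hK : Convex ℝ K) (hc : IsCompact K)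
    {S : Fin n → Plane} {t : Plane} (ht : t ∈ K) (hS : ∀ s, S s ∈ K) :
    ∃ q col, Optimal K S t q col := by
  obtain ⟨g, q, hq, hmin⟩ := exists_assignCost_min hK hc ht hS
  have h : ∀ s : Fin n, ∃ i, (∀ j, sqDist (S s) (q i) ≤ sqDist (S s) (q j)) ∧
      ∀ j, sqDist (S s) (q j) = sqDist (S s) (q i) → prio t q i ≤ prio t q j := by
    intro s
    obtain ⟨i0, -, hi0⟩ := Finset.exists_min_image (Finset.univ : Finset (Fin n))
      (fun i => sqDist (S s) (q i)) ⟨s, Finset.mem_univ _⟩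
    obtain ⟨i, hi, hi'⟩ := Finset.exists_min_image
      (Finset.univ.filter fun i => sqDist (S s) (q i) = sqDist (S s) (q i0)) (prio t q)
      ⟨i0, by simp⟩
    simp only [Finset.mem_filter, Finset.mem_univ, true_and] at hi hi' hi0
    exact ⟨i, fun j => hi ▸ hi0 j trivial, fun j hj => hi' j (hj.trans hi)⟩
  choose col h1 h2 using h
  refine ⟨q, col, hq, fun g' q' => le_trans ?_ (hmin g' q'), h1, h2⟩
  unfold assignCost
  gcongr with s
  exact dist_le_dist_iff.2 (h1 s _)

namespace Optimal

variable {K : Set Plane} {S : Fin n → Plane} {t : Plane} {q : Fin n → Plane}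
  {col : Fin n → Fin n}

/-- Nonempty groups have different Steiner points, since ties are broken by a fixed order. -/
theorem pos_ne (h : Optimal K S t q col) {s s' : Fin n} (hs : col s ≠ col s') :
    q (col s) ≠ q (col s') := by
  intro he
  apply hs
  apply prio_injective t q
  exact le_antisymm (h.tie s _ (by rw [he])) (h.tie s' _ (by rw [he]))

theorem sqDist_pos {a b : Plane} (h : a ≠ b) : 0 < sqDist a b := by
  refine lt_of_le_of_ne (sqDist_nonneg _ _) fun h0 => h ?_
  unfold sqDist at h0
  refine Plane.ext ?_ ?_ <;> nlinarith [sq_nonneg (a 0 - b 0), sq_nonneg (a 1 - b 1)]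

/-- A source between two sources of the same group belongs to this group. -/
theorem col_eq_of_mem_segment (h : Optimal K S t q col) {a a' b : Fin n} (haa : col a' = col a)
    (hb : S b ∈ segment ℝ (S a) (S a')) : col b = col a := by
  by_contra hne
  obtain ⟨s, s0, s1, e0, e1⟩ := mem_segment_iff_coord.1 hb
  have i1 := h.near a (col b)
  have i2 := h.near a' (col b)
  have i3 := h.near b (col a)
  rw [haa] at i2
  -- The difference of the squared distances is an affine function.
  have aff : sqDist (S b) (q (col a)) - sqDist (S b) (q (col b)) =
      (1 - s) * (sqDist (S a) (q (col a)) - sqDist (S a) (q (col b))) +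
        s * (sqDist (S a') (q (col a)) - sqDist (S a') (q (col b))) := by
    simp only [sqDist, e0, e1]; ring
  have m1 : (1 - s) * (sqDist (S a) (q (col a)) - sqDist (S a) (q (col b))) ≤ 0 :=
    mul_nonpos_of_nonneg_of_nonpos (by linarith) (by linarith)
  have m2 : s * (sqDist (S a') (q (col a)) - sqDist (S a') (q (col b))) ≤ 0 :=
    mul_nonpos_of_nonneg_of_nonpos s0 (by linarith)
  have t1 : prio t q (col b) ≤ prio t q (col a) := h.tie b _ (by linarith)
  have t2 : prio t q (col a) ≤ prio t q (col b) := by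
    by_cases hs : s = 1
    · subst hs
      have := h.tie a' (col b) (by rw [haa]; linarith)
      rwa [haa] at this
    · have z : (1 - s) * (sqDist (S a) (q (col a)) - sqDist (S a) (q (col b))) = 0 := by linarith
      refine h.tie a (col b) ?_
      rcases mul_eq_zero.1 z with z | z
      · exact absurd (by linarith) hs
      · linarith
  exact hne (prio_injective t q (le_antisymm t1 t2))

/-- Each group has a source that is strictly nearer to its own Steiner point than to those of the
other groups: otherwise this Steiner point could be saved, or it is at the sink. -/
theorem exists_strict (h : Optimal K S t q col) (s₀ : Fin n) :
    ∃ s, col s = col s₀ ∧ ∀ s', col s' ≠ col s →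
      sqDist (S s) (q (col s)) < sqDist (S s) (q (col s')) := by
  by_cases ht : q (col s₀) = t
  · refine ⟨s₀, rfl, fun s' hs' => ?_⟩
    refine lt_of_le_of_ne (h.near _ _) fun he => ?_
    have h1 := h.tie s₀ _ he.symm
    have h2 : q (col s') ≠ t := fun h2 => h.pos_ne hs' (h2.trans ht.symm)
    unfold prio at h1
    rw [if_pos ht, if_neg h2] at h1
    have := (col s').2
    omega
  by_contra! hcon
  have hcon' : ∀ s, ∃ j, j ≠ col s₀ ∧
      sqDist (S s) (q j) ≤ sqDist (S s) (q (col s)) := by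
    intro s
    by_cases hs : col s = col s₀
    · obtain ⟨s', h1, h2⟩ := hcon s hs
      exact ⟨col s', hs ▸ h1, h2⟩
    · exact ⟨col s, hs, le_rfl⟩
  choose g hg hgd using hcon'
  have hlt : assignCost S t g (Function.update q (col s₀) t) < assignCost S t col q := by
    unfold assignCost
    refine add_lt_add_of_lt_of_le (Finset.sum_lt_sum (fun i _ => ?_) ⟨col s₀, Finset.mem_univ _, ?_⟩)
      (Finset.sum_le_sum fun s _ => ?_)
    · by_cases hi : i = col s₀
      · subst hi; simp
      · simp [hi]
    · simpa using ht
    · rw [Function.update_of_ne (hg s)]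
      exact dist_le_dist_iff.2 (hgd s)
  exact absurd (h.le _ _) hlt.not_ge

/-- If two sources `b`, `b'` are separated by the segment between two sources of another group, then
this segment also separates their Steiner points. -/
theorem exists_mem_segment (hK : Convex ℝ K) (hSK : ∀ s, S s ∈ K) (hSi : ∀ s, S s ∉ interior K)
    (h : Optimal K S t q col) {a a' b b' : Fin n} (haa : col a' = col a) (hb : col b ≠ col a)
    (hb' : col b' ≠ col a) (halt : Alternating (S a) (S b) (S a') (S b')) :
    ∃ y ∈ segment ℝ (q (col b)) (q (col b')), y ∈ segment ℝ (S a) (S a') := by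
  rcases halt with h1 | h1 | ⟨h1, h2⟩
  · exact absurd (h.col_eq_of_mem_segment haa h1) hb
  · exact absurd (h.col_eq_of_mem_segment haa h1) hb'
  -- A point of `K` on the line through `S a` and `S a'` lies between them.
  have hline : ∀ y ∈ K, orient (S a) (S a') y = 0 → ∀ c ∈ K, ∀ d ∈ K, orient (S a) (S a') c < 0 →
      0 < orient (S a) (S a') d → y ∈ segment ℝ (S a) (S a') := by
    intro y hy hy0 c hc d hd hc0 hd0
    have hne : (S a' 0 - S a 0) ^ 2 + (S a' 1 - S a 1) ^ 2 ≠ 0 := by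
      intro h0
      have e0 : S a' 0 - S a 0 = 0 := by
        nlinarith [sq_nonneg (S a' 0 - S a 0), sq_nonneg (S a' 1 - S a 1)]
      have e1 : S a' 1 - S a 1 = 0 := by
        nlinarith [sq_nonneg (S a' 0 - S a 0), sq_nonneg (S a' 1 - S a 1)]
      simp [orient, e0, e1] at hc0
    obtain ⟨τ, hτ⟩ : ∃ τ, τ = ((y 0 - S a 0) * (S a' 0 - S a 0) +
      (y 1 - S a 1) * (S a' 1 - S a 1)) / ((S a' 0 - S a 0) ^ 2 + (S a' 1 - S a 1) ^ 2) :=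
      ⟨_, rfl⟩
    rw [eq_div_iff hne] at hτ
    have y0 : y 0 = (1 - τ) * S a 0 + τ * S a' 0 := by
      apply mul_left_cancel₀ hne
      unfold orient at hy0
      linear_combination (-(S a' 0 - S a 0)) * hτ - (S a' 1 - S a 1) * hy0
    have y1 : y 1 = (1 - τ) * S a 1 + τ * S a' 1 := by
      apply mul_left_cancel₀ hne
      unfold orient at hy0
      linear_combination (-(S a' 1 - S a 1)) * hτ + (S a' 0 - S a 0) * hy0
    by_cases hτ0 : 0 ≤ τ
    · by_cases hτ1 : τ ≤ 1
      · exact mem_segment_iff_coord.2 ⟨τ, hτ0, hτ1, y0, y1⟩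
      · -- `S a'` lies between `S a` and `y`.
        exfalso
        push Not at hτ1
        have ho : ∀ p, orient (S a) y p = τ * orient (S a) (S a') p := by
          intro p; simp only [orient, y0, y1]; ring
        refine hSi a' (mem_interior_of_orient hK (hSK a) hy hc hd (s := 1 / τ) (by positivity)
          ((div_lt_one (by linarith)).2 hτ1) ?_ ?_ ?_ ?_)
        · rw [y0]; field_simp; ring
        · rw [y1]; field_simp; ring
        · rw [ho]; nlinarith
        · rw [ho]; nlinarith
    · -- `S a` lies between `y` and `S a'`.
      exfalso
      push Not at hτ0
      have ho : ∀ p, orient y (S a') p = (1 - τ) * orient (S a) (S a') p := by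
        intro p; simp only [orient, y0, y1]; ring
      have hτ2 : 1 - τ ≠ 0 := by linarith
      refine hSi a (mem_interior_of_orient hK hy (hSK a') hc hd (s := -τ / (1 - τ))
        (div_pos (by linarith) (by linarith)) ((div_lt_one (by linarith)).2 (by linarith))
        ?_ ?_ ?_ ?_)
      · rw [y0]; field_simp; ring
      · rw [y1]; field_simp; ring
      · rw [ho]; nlinarith
      · rw [ho]; nlinarith
  have cross_pt : ∀ c d : Plane, orient (S a) (S a') c ≤ 0 → 0 ≤ orient (S a) (S a') d →
      ∃ s : ℝ, 0 ≤ s ∧ s ≤ 1 ∧ orient (S a) (S a') ((1 - s) • c + s • d) = 0 := by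
    intro c d hc hd
    have ho : ∀ s : ℝ, orient (S a) (S a') ((1 - s) • c + s • d) =
        (1 - s) * orient (S a) (S a') c + s * orient (S a) (S a') d := by
      intro s
      simp only [orient, PiLp.add_apply, PiLp.smul_apply, smul_eq_mul]; ring
    by_cases he : orient (S a) (S a') d - orient (S a) (S a') c = 0
    · exact ⟨0, le_rfl, zero_le_one, by rw [ho]; linarith⟩
    · have hpos : 0 < orient (S a) (S a') d - orient (S a) (S a') c :=
        lt_of_le_of_ne (by linarith) (Ne.symm he)
      refine ⟨-orient (S a) (S a') c / (orient (S a) (S a') d - orient (S a) (S a') c),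
        div_nonneg (by linarith) hpos.le, (div_le_one hpos).2 (by linarith), ?_⟩
      rw [ho]; field_simp; ring
  -- The Steiner point of `b` is on the same side as `b`, since the cells of the two groups meet only
  -- on the perpendicular bisector.
  have cells : ∀ e : Fin n, col e ≠ col a → ∀ s : ℝ, 0 < s → s ≤ 1 →
      (1 - s) • S e + s • q (col e) ∉ segment ℝ (S a) (S a') := by
    intro e he s s0 s1 hmem
    obtain ⟨r, r0, r1, e0, e1⟩ := mem_segment_iff_coord.1 hmem
    simp only [PiLp.add_apply, PiLp.smul_apply, smul_eq_mul] at e0 e1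
    have i1 := h.near a (col e)
    have i2 := h.near a' (col e)
    have i3 := h.near e (col a)
    have i4 := sqDist_pos (h.pos_ne he)
    rw [haa] at i2
    have aff : (1 - s) * (sqDist (S e) (q (col a)) - sqDist (S e) (q (col e))) +
          s * sqDist (q (col e)) (q (col a)) =
        (1 - r) * (sqDist (S a) (q (col a)) - sqDist (S a) (q (col e))) +
          r * (sqDist (S a') (q (col a)) - sqDist (S a') (q (col e))) := by
      simp only [sqDist]
      linear_combination (2 * (q (col e) 0 - q (col a) 0)) * e0 +
        (2 * (q (col e) 1 - q (col a) 1)) * e1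
    have m1 : 0 ≤ (1 - s) * (sqDist (S e) (q (col a)) - sqDist (S e) (q (col e))) :=
      mul_nonneg (by linarith) (by linarith)
    have m2 : 0 < s * sqDist (q (col e)) (q (col a)) := mul_pos s0 i4
    have m3 : (1 - r) * (sqDist (S a) (q (col a)) - sqDist (S a) (q (col e))) ≤ 0 :=
      mul_nonpos_of_nonneg_of_nonpos (by linarith) (by linarith)
    have m4 : r * (sqDist (S a') (q (col a)) - sqDist (S a') (q (col e))) ≤ 0 :=
      mul_nonpos_of_nonneg_of_nonpos r0 (by linarith)
    linarith
  have hconv : ∀ c ∈ K, ∀ d ∈ K, ∀ s : ℝ, 0 ≤ s → s ≤ 1 → (1 - s) • c + s • d ∈ K :=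
    fun c hc d hd s s0 s1 => hK hc hd (by linarith) s0 (by ring)
  have side1 : orient (S a) (S a') (q (col b)) ≤ 0 := by
    by_contra! hw
    obtain ⟨s, s0, s1, hs⟩ := cross_pt (S b) (q (col b)) h1.le hw.le
    have s0' : 0 < s := by
      refine lt_of_le_of_ne s0 fun h0 => ?_
      subst h0; simp at hs; linarith
    exact cells b hb s s0' s1 (hline _ (hconv _ (hSK b) _ (h.mem _) s s0 s1) hs _ (hSK b) _
      (h.mem _) h1 hw)
  have side2 : 0 ≤ orient (S a) (S a') (q (col b')) := by
    by_contra! hw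
    obtain ⟨s, s0, s1, hs⟩ := cross_pt (q (col b')) (S b') hw.le h2.le
    have s1' : s < 1 := by
      refine lt_of_le_of_ne s1 fun h0 => ?_
      subst h0; simp at hs; linarith
    refine cells b' hb' (1 - s) (by linarith) (by linarith) ?_
    have e : (1 - (1 - s)) • S b' + (1 - s) • q (col b') = (1 - s) • q (col b') + s • S b' := by
      rw [add_comm]; congr 2; ring
    rw [e]
    exact hline _ (hconv _ (h.mem _) _ (hSK b') s s0 s1) hs _ (h.mem _) _ (hSK b') hw h2
  obtain ⟨s, s0, s1, hs⟩ := cross_pt _ _ side1 side2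
  refine ⟨_, ?_, hline _ (hconv _ (h.mem _) _ (h.mem _) s s0 s1) hs _ (hSK b) _ (hSK b') h1 h2⟩
  rw [segment_eq_image]
  exact ⟨s, ⟨s0, s1⟩, rfl⟩

end Optimal

end Facilities

/-! ### Groups do not cross and have no four gaps -/

section FourGaps

/-- Four vectors in the plane cannot form angles that are all at least right, if the angles of the
first with the third and fourth one, and of the second with the fourth one, are obtuse. -/
theorem no_four_obtuse {x₁ y₁ x₂ y₂ x₃ y₃ x₄ y₄ : ℝ} (h12 : x₁ * x₂ + y₁ * y₂ ≤ 0)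
    (h23 : x₂ * x₃ + y₂ * y₃ ≤ 0) (h34 : x₃ * x₄ + y₃ * y₄ ≤ 0)
    (h13 : x₁ * x₃ + y₁ * y₃ < 0) (h14 : x₁ * x₄ + y₁ * y₄ < 0)
    (h24 : x₂ * x₄ + y₂ * y₄ < 0) : False := by
  -- Coordinates with the first axis along the first vector, scaled by its length.
  obtain ⟨a, ha⟩ : ∃ a, a = x₁ * y₂ - y₁ * x₂ := ⟨_, rfl⟩
  obtain ⟨b, hb⟩ : ∃ b, b = x₁ * y₃ - y₁ * x₃ := ⟨_, rfl⟩
  obtain ⟨c, hc⟩ : ∃ c, c = x₁ * y₄ - y₁ * x₄ := ⟨_, rfl⟩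
  have hL : 0 ≤ x₁ ^ 2 + y₁ ^ 2 := by positivity
  have hL' : 0 < x₁ ^ 2 + y₁ ^ 2 := by
    refine lt_of_le_of_ne hL fun h0 => ?_
    have e0 : x₁ = 0 := by nlinarith [sq_nonneg x₁, sq_nonneg y₁]
    have e1 : y₁ = 0 := by nlinarith [sq_nonneg x₁, sq_nonneg y₁]
    simp [e0, e1] at h13
  have k23 : (x₁ * x₂ + y₁ * y₂) * (x₁ * x₃ + y₁ * y₃) + a * b =
      (x₁ ^ 2 + y₁ ^ 2) * (x₂ * x₃ + y₂ * y₃) := by rw [ha, hb]; ring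
  have k24 : (x₁ * x₂ + y₁ * y₂) * (x₁ * x₄ + y₁ * y₄) + a * c =
      (x₁ ^ 2 + y₁ ^ 2) * (x₂ * x₄ + y₂ * y₄) := by rw [ha, hc]; ring
  have k34 : (x₁ * x₃ + y₁ * y₃) * (x₁ * x₄ + y₁ * y₄) + b * c =
      (x₁ ^ 2 + y₁ ^ 2) * (x₃ * x₄ + y₃ * y₄) := by rw [hb, hc]; ring
  have l23 : a * b ≤ 0 := by
    have := mul_nonneg_of_nonpos_of_nonpos h12 h13.le
    have := mul_nonpos_of_nonneg_of_nonpos hL h23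
    linarith
  have l24 : a * c < 0 := by
    have := mul_nonneg_of_nonpos_of_nonpos h12 h14.le
    have := mul_neg_of_pos_of_neg hL' h24
    linarith
  have l34 : b * c < 0 := by
    have := mul_pos_of_neg_of_neg h13 h14
    have := mul_nonpos_of_nonneg_of_nonpos hL h34
    linarith
  have p1 : 0 < (a * c) * (b * c) := mul_pos_of_neg_of_neg l24 l34
  have p2 : (a * c) * (b * c) = (a * b) * c ^ 2 := by ring
  have p3 : (a * b) * c ^ 2 ≤ 0 := mul_nonpos_of_nonpos_of_nonneg l23 (sq_nonneg c)
  linarith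

/-- For vectors `u`, `w` with `a = ‖u‖ ^ 2`, `b = ‖w‖ ^ 2` and nonnegative inner product `p`, a point of
the segment from `u` to `w` is at least as near to the origin as to `u` and `w` only if it is the
midpoint. Here `s` is the parameter of this point, and `g`, `g'` are the differences of the squared
distances to the origin and to `u`, `w`; the first one is supposed to be negative if `r < 1`. -/
theorem inner_bound {a b p s g g' r : ℝ} (ha : 0 < a) (hb : 0 < b) (s0 : 0 ≤ s) (s1 : s ≤ 1)
    (h1 : 2 * ((1 - s) * a + s * p) - a = g) (h2 : 2 * ((1 - s) * p + s * b) - b = g')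
    (hg : g ≤ 0) (hg' : g' ≤ 0) (hr : r < 1 → g < 0) (hp : 0 ≤ p) (hr1 : r ≤ 1) :
    s = 1 / 2 ∧ r = 1 := by
  have q1 : 0 ≤ s * p := mul_nonneg s0 hp
  have q2 : 0 ≤ (1 - s) * p := mul_nonneg (by linarith) hp
  have i1 : 1 / 2 ≤ s := by
    by_contra! h
    have : 0 < (1 - 2 * s) * a := mul_pos (by linarith) ha
    linarith
  have i2 : s ≤ 1 / 2 := by
    by_contra! h
    have : 0 < (2 * s - 1) * b := mul_pos (by linarith) hb
    linarith
  have hs : s = 1 / 2 := le_antisymm i2 i1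
  refine ⟨hs, le_antisymm hr1 ?_⟩
  by_contra! h
  have := hr h
  subst hs
  linarith

variable {n : ℕ} {K : Set Plane} {S : Fin n → Plane} {t : Plane} {q : Fin n → Plane}
  {col : Fin n → Fin n}

/-- If `b` and `b'` are separated by the sources `a` and `a'` of another group, the first of which is
strict, then their Steiner points are seen from the Steiner point of this group at an angle which is
obtuse, or right with `a'` half-way between them. -/
theorem Optimal.angle (hK : Convex ℝ K) (hSK : ∀ s, S s ∈ K) (hSi : ∀ s, S s ∉ interior K)
    (h : Optimal K S t q col) {a a' b b' : Fin n} (haa : col a' = col a) (hb : col b ≠ col a)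
    (hb' : col b' ≠ col a)
    (hstrict : ∀ s', col s' ≠ col a → sqDist (S a) (q (col a)) < sqDist (S a) (q (col s')))
    (halt : Alternating (S a) (S b) (S a') (S b')) :
    (q (col b) 0 - q (col a) 0) * (q (col b') 0 - q (col a) 0) +
      (q (col b) 1 - q (col a) 1) * (q (col b') 1 - q (col a) 1) < 0 ∨
    ((q (col b) 0 - q (col a) 0) * (q (col b') 0 - q (col a) 0) +
      (q (col b) 1 - q (col a) 1) * (q (col b') 1 - q (col a) 1) ≤ 0 ∧
      S a' 0 = (q (col b) 0 + q (col b') 0) / 2 ∧ S a' 1 = (q (col b) 1 + q (col b') 1) / 2) := by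
  obtain ⟨y, hy1, hy2⟩ := h.exists_mem_segment hK hSK hSi haa hb hb' halt
  obtain ⟨s, s0, s1, e0, e1⟩ := mem_segment_iff_coord.1 hy1
  obtain ⟨r, r0, r1, f0, f1⟩ := mem_segment_iff_coord.1 hy2
  rw [or_iff_not_imp_left]
  intro hp
  push Not at hp
  -- The points of the segment are in the cell of the group of `a`.
  have cell : ∀ e, col e ≠ col a →
      sqDist y (q (col a)) - sqDist y (q (col e)) =
        (1 - r) * (sqDist (S a) (q (col a)) - sqDist (S a) (q (col e))) +
        r * (sqDist (S a') (q (col a)) - sqDist (S a') (q (col e))) ∧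
      sqDist y (q (col a)) - sqDist y (q (col e)) ≤ 0 ∧
      (r < 1 → sqDist y (q (col a)) - sqDist y (q (col e)) < 0) := by
    intro e he
    have i1 := hstrict e he
    have i2 := h.near a' (col e)
    rw [haa] at i2
    have aff : sqDist y (q (col a)) - sqDist y (q (col e)) =
        (1 - r) * (sqDist (S a) (q (col a)) - sqDist (S a) (q (col e))) +
        r * (sqDist (S a') (q (col a)) - sqDist (S a') (q (col e))) := by
      simp only [sqDist, f0, f1]; ring
    have m2 : r * (sqDist (S a') (q (col a)) - sqDist (S a') (q (col e))) ≤ 0 :=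
      mul_nonpos_of_nonneg_of_nonpos r0 (by linarith)
    refine ⟨aff, ?_, fun hr => ?_⟩
    · have m1 : (1 - r) * (sqDist (S a) (q (col a)) - sqDist (S a) (q (col e))) ≤ 0 :=
        mul_nonpos_of_nonneg_of_nonpos (by linarith) (by linarith)
      linarith
    · have m1 : (1 - r) * (sqDist (S a) (q (col a)) - sqDist (S a) (q (col e))) < 0 :=
        mul_neg_of_pos_of_neg (by linarith) (by linarith)
      linarith
  obtain ⟨-, c1, c2⟩ := cell b hb
  obtain ⟨-, c3, -⟩ := cell b' hb'
  have key := inner_bound (Optimal.sqDist_pos (h.pos_ne hb)) (Optimal.sqDist_pos (h.pos_ne hb'))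
    s0 s1 (g := sqDist y (q (col a)) - sqDist y (q (col b)))
    (g' := sqDist y (q (col a)) - sqDist y (q (col b')))
    (by simp only [sqDist, e0, e1]; ring) (by simp only [sqDist, e0, e1]; ring) c1 c3 c2 hp r1
  obtain ⟨hs, hr⟩ := key
  subst hs hr
  have g0 : S a' 0 = (q (col b) 0 + q (col b') 0) / 2 := by linarith
  have g1 : S a' 1 = (q (col b) 1 + q (col b') 1) / 2 := by linarith
  refine ⟨?_, g0, g1⟩
  have h3 : sqDist y (q (col a)) - sqDist y (q (col b)) ≤ 0 := c1
  simp only [sqDist, e0, e1] at h3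
  linarith

/-- Groups do not cross on the tour. -/
theorem Optimal.noncrossing (hK : Convex ℝ K) (hSK : ∀ s, S s ∈ K) (hSi : ∀ s, S s ∉ interior K)
    (h : Optimal K S t q col) {a a' b b' : Fin n} (haa : col a' = col a) (hb : col b ≠ col a)
    (hbb : col b' = col b) (halt : Alternating (S a) (S b) (S a') (S b')) : False := by
  obtain ⟨y, hy1, hy2⟩ := h.exists_mem_segment hK hSK hSi haa hb (hbb ▸ hb) halt
  rw [hbb, segment_same, Set.mem_singleton_iff] at hy1
  subst hy1
  obtain ⟨r, r0, r1, f0, f1⟩ := mem_segment_iff_coord.1 hy2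
  have i1 := h.near a (col b)
  have i2 := h.near a' (col b)
  rw [haa] at i2
  have i3 := Optimal.sqDist_pos (h.pos_ne hb)
  have aff : sqDist (q (col b)) (q (col a)) =
      (1 - r) * (sqDist (S a) (q (col a)) - sqDist (S a) (q (col b))) +
      r * (sqDist (S a') (q (col a)) - sqDist (S a') (q (col b))) := by
    simp only [sqDist]
    linear_combination (2 * (q (col b) 0 - q (col a) 0)) * f0 +
        (2 * (q (col b) 1 - q (col a) 1)) * f1
  have m1 : (1 - r) * (sqDist (S a) (q (col a)) - sqDist (S a) (q (col b))) ≤ 0 :=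
    mul_nonpos_of_nonneg_of_nonpos (by linarith) (by linarith)
  have m2 : r * (sqDist (S a') (q (col a)) - sqDist (S a') (q (col b))) ≤ 0 :=
    mul_nonpos_of_nonneg_of_nonpos r0 (by linarith)
  linarith

/-- A group does not have four gaps, if one of its sources before the first gap is strict. -/
theorem Optimal.no_four_gaps_of_strict (hK : Convex ℝ K) (hSK : ∀ s, S s ∈ K)
    (hSi : ∀ s, S s ∉ interior K) (h : Optimal K S t q col) {π : ℕ → Fin n} {N : ℕ}
    (halt : ∀ {x y z u}, x < y → y < z → z < u → u < x + N →
      Alternating (S (π x)) (S (π y)) (S (π z)) (S (π u)))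
    {x₁ x₂ x₃ x₄ y₁ y₂ y₃ y₄ : ℕ} (h1 : x₁ < y₁) (h2 : y₁ < x₂) (h3 : x₂ < y₂) (h4 : y₂ < x₃)
    (h5 : x₃ < y₃) (h6 : y₃ < x₄) (h7 : x₄ < y₄) (h8 : y₄ < x₁ + N)
    (c2 : col (π x₂) = col (π x₁)) (c3 : col (π x₃) = col (π x₁)) (c4 : col (π x₄) = col (π x₁))
    (d1 : col (π y₁) ≠ col (π x₁)) (d2 : col (π y₂) ≠ col (π x₁))
    (d3 : col (π y₃) ≠ col (π x₁)) (d4 : col (π y₄) ≠ col (π x₁))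
    (hstrict : ∀ s', col s' ≠ col (π x₁) →
      sqDist (S (π x₁)) (q (col (π x₁))) < sqDist (S (π x₁)) (q (col s'))) : False := by
  -- Three of the inner products must not vanish. Each of them would fix the separating source as the
  -- midpoint of the same two Steiner points for two sources at different positions.
  have ang := fun {a' b b'} => h.angle hK hSK hSi (a := π x₁) (a' := a') (b := b) (b' := b')
  have n23 : S (π x₂) ≠ S (π x₃) := by
    intro he
    rcases halt h3 h4 h5 (by omega) with e | e | e
    · exact d2 ((h.col_eq_of_mem_segment (c3.trans c2.symm) e).trans c2)
    · exact d3 ((h.col_eq_of_mem_segment (c3.trans c2.symm) e).trans c2)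
    · simp [he, orient] at e
  have n34 : S (π x₃) ≠ S (π x₄) := by
    intro he
    rcases halt h5 h6 h7 (by omega) with e | e | e
    · exact d3 ((h.col_eq_of_mem_segment (c4.trans c3.symm) e).trans c3)
    · exact d4 ((h.col_eq_of_mem_segment (c4.trans c3.symm) e).trans c3)
    · simp [he, orient] at e
  have a12 := ang c2 d1 d2 hstrict (halt h1 h2 h3 (by omega))
  have a13 := ang c2 d1 d3 hstrict (halt h1 h2 (by omega) (by omega))
  have a13' := ang c3 d1 d3 hstrict (halt h1 (by omega) h5 (by omega))
  have a14 := ang c2 d1 d4 hstrict (halt h1 h2 (by omega) (by omega))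
  have a14' := ang c3 d1 d4 hstrict (halt h1 (by omega) (by omega) (by omega))
  have a23 := ang c3 d2 d3 hstrict (halt (by omega) h4 h5 (by omega))
  have a24 := ang c3 d2 d4 hstrict (halt (by omega) h4 (by omega) (by omega))
  have a24' := ang c4 d2 d4 hstrict (halt (by omega) (by omega) (by omega) (by omega))
  have a34 := ang c4 d3 d4 hstrict (halt (by omega) h6 h7 (by omega))
  refine no_four_obtuse (a12.elim le_of_lt (·.1)) (a23.elim le_of_lt (·.1))
    (a34.elim le_of_lt (·.1)) ?_ ?_ ?_
  · rcases a13 with e | ⟨-, e, e'⟩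
    · exact e
    rcases a13' with f | ⟨-, f, f'⟩
    · exact f
    exact absurd (Plane.ext (e.trans f.symm) (e'.trans f'.symm)) n23
  · rcases a14 with e | ⟨-, e, e'⟩
    · exact e
    rcases a14' with f | ⟨-, f, f'⟩
    · exact f
    exact absurd (Plane.ext (e.trans f.symm) (e'.trans f'.symm)) n23
  · rcases a24 with e | ⟨-, e, e'⟩
    · exact e
    rcases a24' with f | ⟨-, f, f'⟩
    · exact f
    exact absurd (Plane.ext (e.trans f.symm) (e'.trans f'.symm)) n34

/-- A group does not have four gaps on the tour. -/
theorem Optimal.no_four_gaps (hK : Convex ℝ K) (hSK : ∀ s, S s ∈ K)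
    (hSi : ∀ s, S s ∉ interior K) (h : Optimal K S t q col) {π : ℕ → Fin n}
    (hπ : ∀ s, ∃ x < n, π x = s) (hper : ∀ x, π (x + n) = π x)
    (halt : ∀ {x y z u}, x < y → y < z → z < u → u < x + n →
      Alternating (S (π x)) (S (π y)) (S (π z)) (S (π u)))
    {x₁ x₂ x₃ x₄ y₁ y₂ y₃ y₄ : ℕ} (h1 : x₁ < y₁) (h2 : y₁ < x₂) (h3 : x₂ < y₂) (h4 : y₂ < x₃)
    (h5 : x₃ < y₃) (h6 : y₃ < x₄) (h7 : x₄ < y₄) (h8 : y₄ < x₁ + n)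
    (c2 : col (π x₂) = col (π x₁)) (c3 : col (π x₃) = col (π x₁)) (c4 : col (π x₄) = col (π x₁))
    (d1 : col (π y₁) ≠ col (π x₁)) (d2 : col (π y₂) ≠ col (π x₁))
    (d3 : col (π y₃) ≠ col (π x₁)) (d4 : col (π y₄) ≠ col (π x₁)) : False := by
  obtain ⟨s, hs, hstrict⟩ := h.exists_strict (π x₁)
  -- A position `z` of the strict source in the window that starts at `x₁`.
  obtain ⟨z, hz1, hz2, rfl⟩ : ∃ z, x₁ ≤ z ∧ z < x₁ + n ∧ π z = s := by
    obtain ⟨w, hw, rfl⟩ := hπ s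
    have hmul : ∀ k, π (w + k * n) = π w := by
      intro k
      induction k with
      | zero => simp
      | succ k ih => rw [Nat.succ_mul, ← add_assoc, hper, ih]
    have hn : 0 < n := by omega
    have hdm := Nat.div_add_mod x₁ n
    have hml := Nat.mod_lt x₁ hn
    rw [mul_comm] at hdm
    by_cases hle : x₁ % n ≤ w
    · exact ⟨w + x₁ / n * n, by omega, by omega, hmul _⟩
    · exact ⟨w + (x₁ / n + 1) * n, by rw [Nat.succ_mul]; omega, by rw [Nat.succ_mul]; omega,
        hmul _⟩
  have main := fun {b₁ a₂ b₂ a₃ b₃ a₄ b₄} =>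
    h.no_four_gaps_of_strict hK hSK hSi halt (x₁ := z) (y₁ := b₁) (x₂ := a₂) (y₂ := b₂)
      (x₃ := a₃) (y₃ := b₃) (x₄ := a₄) (y₄ := b₄)
  rw [← hs] at c2 c3 c4 d1 d2 d3 d4
  have p1 := hper x₁; have p2 := hper x₂; have p3 := hper x₃; have p4 := hper x₄
  have r1 := hper y₁; have r2 := hper y₂; have r3 := hper y₃; have r4 := hper y₄
  have c1' : col (π (x₁ + n)) = col (π z) := by rw [p1, hs]
  have c2' : col (π (x₂ + n)) = col (π z) := by rw [p2, c2]
  have c3' : col (π (x₃ + n)) = col (π z) := by rw [p3, c3]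
  have d1' : col (π (y₁ + n)) ≠ col (π z) := by rw [r1]; exact d1
  have d2' : col (π (y₂ + n)) ≠ col (π z) := by rw [r2]; exact d2
  have d3' : col (π (y₃ + n)) ≠ col (π z) := by rw [r3]; exact d3
  have d4' : col (π (y₄ + n)) ≠ col (π z) := by rw [r4]; exact d4
  have z1 : z ≠ y₁ := fun e => d1 (by rw [e])
  have z2 : z ≠ y₂ := fun e => d2 (by rw [e])
  have z3 : z ≠ y₃ := fun e => d3 (by rw [e])
  have z4 : z ≠ y₄ := fun e => d4 (by rw [e])
  -- The pattern of arcs and gaps is rotated so that it begins with the arc of `z`.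
  rcases lt_or_gt_of_ne z1 with l1 | l1
  · exact main l1 h2 h3 h4 h5 h6 h7 (by omega) c2 c3 c4 d1 d2 d3 d4 hstrict
  rcases lt_or_gt_of_ne z2 with l2 | l2
  · exact main l2 h4 h5 h6 h7 (b₃ := y₄) (a₄ := x₁ + n) (b₄ := y₁ + n) (by omega) (by omega)
      (by omega) c3 c4 c1' d2 d3 d4 d1' hstrict
  rcases lt_or_gt_of_ne z3 with l3 | l3
  · exact main l3 h6 h7 (a₃ := x₁ + n) (b₃ := y₁ + n) (a₄ := x₂ + n) (b₄ := y₂ + n) (by omega)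
      (by omega) (by omega) (by omega) (by omega) c4 c1' c2' d3 d4 d1' d2' hstrict
  rcases lt_or_gt_of_ne z4 with l4 | l4
  · exact main l4 (a₂ := x₁ + n) (b₂ := y₁ + n) (a₃ := x₂ + n) (b₃ := y₂ + n) (a₄ := x₃ + n)
      (b₄ := y₃ + n) (by omega) (by omega) (by omega) (by omega) (by omega) (by omega) (by omega)
      c1' c2' c3' d4 d1' d2' d3' hstrict
  · exact main (b₁ := y₁ + n) (a₂ := x₂ + n) (b₂ := y₂ + n) (a₃ := x₃ + n) (b₃ := y₃ + n)
      (a₄ := x₄ + n) (b₄ := y₄ + n) (by omega) (by omega) (by omega) (by omega) (by omega)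
      (by omega) (by omega) (by omega) c2' c3' (by rw [p4, c4]) d1' d2' d3' d4' hstrict

end FourGaps

/-! ### Layouts with one intermediate layer -/

section Layouts

variable {I : Instance}

theorem Layout.edgeCost_of_alpha_eq_zero (hα : I.α = 0) (L : Layout I)
    (u : Node I.n L.m I.τ) : L.edgeCost u = dist (L.pos u) (L.pos (L.parents.next u)) := by
  simp [Layout.edgeCost, hα]

theorem Layout.ofSteiner_eq (hlam : I.lam = 1) (L : Layout I) (j : Fin L.m) :
    ∃ k, L.parents.ofSteiner j = Sum.inr k := by
  rcases hj : L.parents.ofSteiner j with j' | k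
  swap
  · exact ⟨k, rfl⟩
  exfalso
  obtain ⟨u, hu⟩ := L.not_leaf j
  obtain ⟨k, hk, w, hw⟩ := L.height_le u
  have h2 : L.parents.next (Node.steiner j) = Node.steiner j' := by
    simp [ParentMap.next, hj, ParentMap.toNode]
  rw [hlam] at hk
  interval_cases k
  · rw [Function.iterate_zero, id] at hw
    rw [hw] at hu; simp [ParentMap.next] at hu
  · simp [hu] at hw
  · simp [hu, h2] at hw

theorem Layout.exists_ofSource_eq (hlam : I.lam = 1) (L : Layout I) (j : Fin L.m) :
    ∃ i, L.parents.ofSource i = Sum.inl j := by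
  obtain ⟨u, hu⟩ := L.not_leaf j
  cases u with
  | source i =>
    refine ⟨i, ?_⟩
    rcases h : L.parents.ofSource i with j' | k
    · simp [ParentMap.next, h, ParentMap.toNode] at hu; rw [hu]
    · simp [ParentMap.next, h, ParentMap.toNode] at hu
  | steiner j' =>
    obtain ⟨k, hk⟩ := L.ofSteiner_eq hlam j'
    simp [ParentMap.next, hk, ParentMap.toNode] at hu
  | sink k => simp [ParentMap.next] at hu

/-- Each layout gives an assignment of the same cost: a Steiner vertex gets the number of one of its
sources, and a source connected directly to the sink gets a Steiner point of its own at the sink. -/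
theorem Layout.exists_assignCost_le (hlam : I.lam = 1) (hα : I.α = 0) {t : Plane}
    (ht : ∀ k, I.sink k = t) (L : Layout I) :
    ∃ g q, assignCost I.source t g q ≤ L.cost := by
  classical
  choose r hr using L.exists_ofSource_eq hlam
  have hinj : Function.Injective r := by
    intro i j hij
    have h := hr i
    rw [hij, hr j] at h
    exact (Sum.inl_injective h).symm
  let q : Fin I.n → Plane := fun i => match L.parents.ofSource i with
    | Sum.inl j => if r j = i then L.steinerPos j else t
    | Sum.inr _ => t
  let g : Fin I.n → Fin I.n := fun i => match L.parents.ofSource i with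
    | Sum.inl j => r j
    | Sum.inr _ => i
  have hqr : ∀ j, q (r j) = L.steinerPos j := by
    intro j; simp [q, hr]
  refine ⟨g, q, le_of_eq ?_⟩
  have e1 : ∑ i, dist (q i) t = ∑ j, L.edgeCost (Node.steiner j) := by
    have h1 : ∀ j, L.edgeCost (Node.steiner j) = dist (q (r j)) t := by
      intro j
      obtain ⟨k, hk⟩ := L.ofSteiner_eq hlam j
      rw [L.edgeCost_of_alpha_eq_zero hα, hqr]
      simp [ParentMap.next, hk, ParentMap.toNode, Layout.pos, ht]
    simp only [h1]
    rw [← Finset.sum_image (f := fun i => dist (q i) t) (s := Finset.univ) (g := r)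
      (fun i _ j _ h => hinj h)]
    symm
    refine Finset.sum_subset (Finset.subset_univ _) fun i _ hi => ?_
    have : q i = t := by
      simp only [q]
      rcases L.parents.ofSource i with j | k
      · simp only
        rw [if_neg]
        rintro rfl
        exact hi (Finset.mem_image_of_mem _ (Finset.mem_univ _))
      · rfl
    simp [this]
  have e2 : ∀ s, L.edgeCost (Node.source s) = dist (I.source s) (q (g s)) := by
    intro s
    rw [L.edgeCost_of_alpha_eq_zero hα]
    rcases h : L.parents.ofSource s with j | k
    · have : g s = r j := by simp [g, h]
      rw [this, hqr]
      simp [ParentMap.next, h, ParentMap.toNode, Layout.pos]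
    · have h1 : g s = s := by simp [g, h]
      have h2 : q s = t := by simp [q, h]
      rw [h1, h2]
      simp [ParentMap.next, h, ParentMap.toNode, Layout.pos, ht]
  unfold assignCost Layout.cost
  simp only [e1, e2]
  exact add_comm _ _

/-- The layout in which source `i` is connected to Steiner vertex `par i`, and all Steiner vertices
to the sink `k`. -/
def starLayout (hlam : I.lam = 1) (k : Fin I.τ) (m : ℕ) (par : Fin I.n → Fin m)
    (hpar : Function.Surjective par) (P : Fin m → Plane) : Layout I where
  m := m
  parents := ⟨fun i => Sum.inl (par i), fun _ => Sum.inr k⟩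
  height_le := by
    intro u
    rw [hlam]
    cases u with
    | source i => exact ⟨2, by norm_num, k, rfl⟩
    | steiner j => exact ⟨1, by norm_num, k, rfl⟩
    | sink k' => exact ⟨0, by norm_num, k', rfl⟩
  not_leaf := by
    intro j
    obtain ⟨i, rfl⟩ := hpar j
    exact ⟨Node.source i, rfl⟩
  steinerPos := P

theorem starLayout_cost (hlam : I.lam = 1) (hα : I.α = 0) (k : Fin I.τ) (m : ℕ)
    (par : Fin I.n → Fin m) (hpar : Function.Surjective par) (P : Fin m → Plane) :
    (starLayout hlam k m par hpar P).cost =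
      ∑ i, dist (I.source i) (P (par i)) + ∑ j, dist (P j) (I.sink k) := by
  unfold Layout.cost
  simp only [Layout.edgeCost_of_alpha_eq_zero hα]
  rfl

end Layouts

/-! ### The dynamic program -/

/-- The positions in the union of the intervals `[i, j)`, `[k, p)` and `[q, m)`. -/
def arcs (i j k p q m : ℕ) : List ℕ :=
  List.range' i (j - i) ++ List.range' k (p - k) ++ List.range' q (m - q)

theorem starCost_arcs (t : Plane) (pt : ℕ → Plane) (v : Plane) (i j k p q m : ℕ) :
    starCost t ((arcs i j k p q m).map pt) v =
      ∑ x ∈ Finset.Ico i j, dist (pt x) v + ∑ x ∈ Finset.Ico k p, dist (pt x) v +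
        ∑ x ∈ Finset.Ico q m, dist (pt x) v + dist v t := by
  have h : ∀ a b, (List.map ((fun y => dist y v) ∘ pt) (List.range' a (b - a))).sum =
      ∑ x ∈ Finset.Ico a b, dist (pt x) v := fun a b => rfl
  simp only [starCost, arcs, List.map_append, List.map_map, List.sum_append, h]

/-- The tables of the dynamic program. `F a b` is the value found for the interval `[a, b)`, and
`M a b` the end of its first group; `G a m` is the value for `[a, m)` if its first group extends from
`a` to `m - 1`; `J`, `K`, `P`, `Q` describe the three arcs of this group, and `X`, `Y` its Steiner
point. -/
structure DPTables where
  F : ℕ → ℕ → ℝ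
  G : ℕ → ℕ → ℝ
  X : ℕ → ℕ → ℝ
  Y : ℕ → ℕ → ℝ
  J : ℕ → ℕ → ℕ
  K : ℕ → ℕ → ℕ
  P : ℕ → ℕ → ℕ
  Q : ℕ → ℕ → ℕ
  M : ℕ → ℕ → ℕ

namespace DPTables

/-- The value of a choice of three arcs for the group of the first point. -/
noncomputable def candidate (W : WeberSolver) (ε : ℝ) (t : Plane) (pt : ℕ → Plane)
    (F : ℕ → ℕ → ℝ) (i j k p q m : ℕ) : ℝ :=
  W.value ε t ((arcs i j k p q m).map pt) + F j k + F p q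

/-- The entry `G i m` is the value of the stored arcs. -/
def Stored (W : WeberSolver) (ε : ℝ) (t : Plane) (pt : ℕ → Plane) (T : DPTables) (i m : ℕ) : Prop :=
  i < T.J i m ∧ T.J i m ≤ T.K i m ∧ T.K i m ≤ T.P i m ∧ T.P i m ≤ T.Q i m ∧ T.Q i m ≤ m ∧
  T.G i m = candidate W ε t pt T.F i (T.J i m) (T.K i m) (T.P i m) (T.Q i m) m ∧
  T.X i m =
    W.point ε t ((arcs i (T.J i m) (T.K i m) (T.P i m) (T.Q i m) m).map pt) 0 ∧
  T.Y i m =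
    W.point ε t ((arcs i (T.J i m) (T.K i m) (T.P i m) (T.Q i m) m).map pt) 1

/-- The rows of the tables of the first points of groups from `lo` on satisfy the recursion of the
dynamic program, for intervals of at most `n` of `2 n` positions. -/
structure Correct (W : WeberSolver) (ε : ℝ) (t : Plane) (pt : ℕ → Plane) (n : ℕ) (T : DPTables)
    (lo : ℕ) : Prop where
  diag : ∀ a, T.F a a = 0
  stored : ∀ i m, lo ≤ i → i < m → m ≤ i + n → m ≤ n + n → T.Stored W ε t pt i m
  G_le : ∀ i j k p q m, lo ≤ i → i < j → j ≤ k → k ≤ p → p ≤ q → q ≤ m → m ≤ i + n → m ≤ n + n →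
    T.G i m ≤ candidate W ε t pt T.F i j k p q m
  M_mem : ∀ i l, lo ≤ i → i < l → l ≤ i + n → l ≤ n + n → i < T.M i l ∧ T.M i l ≤ l
  F_eq : ∀ i l, lo ≤ i → i < l → l ≤ i + n → l ≤ n + n →
    T.F i l = T.G i (T.M i l) + T.F (T.M i l) l
  F_le : ∀ i m l, lo ≤ i → i < m → m ≤ l → l ≤ i + n → l ≤ n + n →
    T.F i l ≤ T.G i m + T.F m l

/-- One step of the search for the group of position `x`, from an interval `[a, b)` containing `x` to
the interval of a subproblem containing `x`, or to `[a, b)` again if `x` is in its first group. -/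
def step (T : DPTables) (x : ℕ) (ab : ℕ × ℕ) : ℕ × ℕ :=
  if T.M ab.1 ab.2 ≤ x then (T.M ab.1 ab.2, ab.2)
  else if x < T.J ab.1 (T.M ab.1 ab.2) then ab
  else if x < T.K ab.1 (T.M ab.1 ab.2) then
    (T.J ab.1 (T.M ab.1 ab.2), T.K ab.1 (T.M ab.1 ab.2))
  else if x < T.P ab.1 (T.M ab.1 ab.2) then ab
  else if x < T.Q ab.1 (T.M ab.1 ab.2) then
    (T.P ab.1 (T.M ab.1 ab.2), T.Q ab.1 (T.M ab.1 ab.2))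
  else ab

/-- The Steiner point of the first group of the interval `[a, b)`. -/
noncomputable def steiner (T : DPTables) (ab : ℕ × ℕ) : Plane :=
  !₂[T.X ab.1 (T.M ab.1 ab.2), T.Y ab.1 (T.M ab.1 ab.2)]

theorem sum_indicator_Ico {a j : ℕ} (h : a < j) (c : ℝ) :
    ∑ x ∈ Finset.Ico a j, (if a = x then c else 0) = c := by
  rw [Finset.sum_ite_eq, if_pos (by simp [h])]

theorem sum_indicator_Ico_of_lt {a k p : ℕ} (h : a < k) (c : ℝ) :
    ∑ x ∈ Finset.Ico k p, (if a = x then c else 0) = 0 := by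
  rw [Finset.sum_ite_eq, if_neg (by simp; omega)]

/-- The solution stored in the tables costs at most the value found. The groups are named by the
interval at which the search for their elements ends, and the left end of this interval is the first
element of the group. -/
theorem Correct.cost_le {W : WeberSolver} {ε : ℝ} {t : Plane} {pt : ℕ → Plane} {n : ℕ}
    {T : DPTables} (hT : T.Correct W ε t pt n 0)
    (hW : ∀ A, A ≠ [] → starCost t A (W.point ε t A) ≤ W.value ε t A) {a b N : ℕ} (hab : a ≤ b)
    (hb : b ≤ a + n) (hb' : b ≤ n + n) (hN : b ≤ a + N) :
    (∀ x, a ≤ x → x < b → a ≤ ((T.step x)^[N] (a, b)).1 ∧ ((T.step x)^[N] (a, b)).1 ≤ x ∧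
      (T.step ((T.step x)^[N] (a, b)).1)^[N] (a, b) = (T.step x)^[N] (a, b)) ∧
    ∑ x ∈ Finset.Ico a b, (dist (pt x) (T.steiner ((T.step x)^[N] (a, b))) +
      if ((T.step x)^[N] (a, b)).1 = x then dist (T.steiner ((T.step x)^[N] (a, b))) t else 0) ≤
        T.F a b := by
  induction hd : b - a using Nat.strong_induction_on generalizing a b N with
  | _ d ih =>
  rcases hab.lt_or_eq with hlt | rfl
  swap
  · refine ⟨fun x h1 h2 => by omega, by simp [hT.diag]⟩
  obtain ⟨N, rfl⟩ : ∃ N', N = N' + 1 := ⟨N - 1, by omega⟩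
  obtain ⟨m1, m2⟩ := hT.M_mem a b (Nat.zero_le _) hlt hb hb'
  have hF := hT.F_eq a b (Nat.zero_le _) hlt hb hb'
  obtain ⟨s1, s2, s3, s4, s5, s6, s7, s8⟩ :=
    hT.stored a (T.M a b) (Nat.zero_le _) m1 (by omega) (by omega)
  obtain ⟨m, hm⟩ : ∃ m, m = T.M a b := ⟨_, rfl⟩
  rw [← hm] at m1 m2 hF s1 s2 s3 s4 s5 s6 s7 s8
  have step_def : ∀ x, T.step x (a, b) = if m ≤ x then (m, b)
      else if x < T.J a m then (a, b) else if x < T.K a m then (T.J a m, T.K a m)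
      else if x < T.P a m then (a, b) else if x < T.Q a m then (T.P a m, T.Q a m) else (a, b) := by
    intro x; simp only [step, ← hm]
  have steiner_ab : T.steiner (a, b) =
      W.point ε t ((arcs a (T.J a m) (T.K a m) (T.P a m) (T.Q a m) m).map pt) := by
    refine Plane.ext ?_ ?_
    · simpa [steiner, ← hm] using s7
    · simpa [steiner, ← hm] using s8
  generalize T.J a m = j at *
  generalize T.K a m = k at *
  generalize T.P a m = p at *
  generalize T.Q a m = q at *
  -- The searches from `[a, b)` in the six parts of the interval.
  have own : ∀ x, (a ≤ x ∧ x < j ∨ k ≤ x ∧ x < p ∨ q ≤ x ∧ x < m) →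
      (T.step x)^[N + 1] (a, b) = (a, b) := by
    intro x hx
    refine Function.iterate_fixed ?_ _
    rw [step_def]
    split_ifs <;> first | rfl | omega
  have gap1 : ∀ x, j ≤ x → x < k → (T.step x)^[N + 1] (a, b) = (T.step x)^[N] (j, k) := by
    intro x h1 h2
    rw [Function.iterate_succ_apply, step_def]
    split_ifs <;> first | rfl | omega
  have gap2 : ∀ x, p ≤ x → x < q → (T.step x)^[N + 1] (a, b) = (T.step x)^[N] (p, q) := by
    intro x h1 h2
    rw [Function.iterate_succ_apply, step_def]
    split_ifs <;> first | rfl | omega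
  have rest : ∀ x, m ≤ x → x < b → (T.step x)^[N + 1] (a, b) = (T.step x)^[N] (m, b) := by
    intro x h1 h2
    rw [Function.iterate_succ_apply, step_def, if_pos h1]
  obtain ⟨g1, g1'⟩ := ih (k - j) (by omega) (a := j) (b := k) (N := N) s2 (by omega) (by omega)
    (by omega) rfl
  obtain ⟨g2, g2'⟩ := ih (q - p) (by omega) (a := p) (b := q) (N := N) s4 (by omega) (by omega)
    (by omega) rfl
  obtain ⟨g3, g3'⟩ := ih (b - m) (by omega) (a := m) (b := b) (N := N) m2 (by omega) (by omega)
    (by omega) rfl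
  refine ⟨fun x h1 h2 => ?_, ?_⟩
  · by_cases hx : a ≤ x ∧ x < j ∨ k ≤ x ∧ x < p ∨ q ≤ x ∧ x < m
    · simp only [own x hx]
      exact ⟨le_rfl, h1, own a (.inl ⟨le_rfl, s1⟩)⟩
    · by_cases hx1 : j ≤ x ∧ x < k
      · obtain ⟨e1, e2, e3⟩ := g1 x hx1.1 hx1.2
        rw [gap1 x hx1.1 hx1.2]
        refine ⟨by omega, e2, ?_⟩
        rw [gap1 _ e1 (by omega), e3]
      · by_cases hx2 : p ≤ x ∧ x < q
        · obtain ⟨e1, e2, e3⟩ := g2 x hx2.1 hx2.2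
          rw [gap2 x hx2.1 hx2.2]
          refine ⟨by omega, e2, ?_⟩
          rw [gap2 _ e1 (by omega), e3]
        · have hx3 : m ≤ x := by omega
          obtain ⟨e1, e2, e3⟩ := g3 x hx3 h2
          rw [rest x hx3 h2]
          refine ⟨by omega, e2, ?_⟩
          rw [rest _ e1 (by omega), e3]
  · rw [← Finset.sum_Ico_consecutive _ (show a ≤ m by omega) m2,
      ← Finset.sum_Ico_consecutive _ (show a ≤ q by omega) s5,
      ← Finset.sum_Ico_consecutive _ (show a ≤ p by omega) s4,
      ← Finset.sum_Ico_consecutive _ (show a ≤ k by omega) s3,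
      ← Finset.sum_Ico_consecutive _ (show a ≤ j by omega) s2]
    rw [Finset.sum_congr (s₁ := Finset.Ico j k) rfl fun x hx => by
        rw [gap1 x (Finset.mem_Ico.1 hx).1 (Finset.mem_Ico.1 hx).2],
      Finset.sum_congr (s₁ := Finset.Ico p q) rfl fun x hx => by
        rw [gap2 x (Finset.mem_Ico.1 hx).1 (Finset.mem_Ico.1 hx).2],
      Finset.sum_congr (s₁ := Finset.Ico m b) rfl fun x hx => by
        rw [rest x (Finset.mem_Ico.1 hx).1 (Finset.mem_Ico.1 hx).2],
      Finset.sum_congr (s₁ := Finset.Ico a j) rfl fun x hx => by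
        rw [own x (.inl (Finset.mem_Ico.1 hx))],
      Finset.sum_congr (s₁ := Finset.Ico k p) rfl fun x hx => by
        rw [own x (.inr (.inl (Finset.mem_Ico.1 hx)))],
      Finset.sum_congr (s₁ := Finset.Ico q m) rfl fun x hx => by
        rw [own x (.inr (.inr (Finset.mem_Ico.1 hx)))]]
    simp only [Finset.sum_add_distrib, sum_indicator_Ico s1,
      sum_indicator_Ico_of_lt (show a < k by omega), sum_indicator_Ico_of_lt (show a < q by omega)]
      at g1' g2' g3' ⊢
    have hne : (arcs a j k p q m).map pt ≠ [] := by
      intro h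
      have := congrArg List.length h
      simp [arcs] at this
      omega
    have hw := hW _ hne
    rw [starCost_arcs, ← steiner_ab] at hw
    rw [hF, s6, candidate]
    linarith

theorem exists_run (p : ℕ → Prop) {a b : ℕ} (hab : a ≤ b) :
    ∃ r, a ≤ r ∧ r ≤ b ∧ (∀ x, a ≤ x → x < r → p x) ∧ (r < b → ¬ p r) := by
  induction b, hab using Nat.le_induction with
  | base => exact ⟨a, le_rfl, le_rfl, fun x _ _ => by omega, fun h => by omega⟩
  | succ b hab ih =>
    obtain ⟨r, h1, h2, h3, h4⟩ := ih
    rcases h2.lt_or_eq with h | rfl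
    · exact ⟨r, h1, by omega, h3, fun _ => h4 h⟩
    · by_cases hr : p r
      · refine ⟨r + 1, by omega, le_rfl, fun x e1 e2 => ?_, fun h => by omega⟩
        rcases Nat.lt_succ_iff_lt_or_eq.1 e2 with e | rfl
        · exact h3 x e1 e
        · exact hr
      · exact ⟨r, h1, by omega, h3, fun _ => hr⟩

/-- The value found for a window of `n` positions is at most that of every partition into groups that
do not cross and have at most three arcs each. -/
theorem Correct.F_le_of_noncrossing {W : WeberSolver} {ε : ℝ} {t : Plane} {pt : ℕ → Plane} {n : ℕ}
    {T : DPTables} (hT : T.Correct W ε t pt n 0)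
    (hε : 0 ≤ 1 + ε) (hW : ∀ A, A ≠ [] → ∀ v, W.value ε t A ≤ (1 + ε) * starCost t A v)
    {ι : Type*} [DecidableEq ι] (c : ℕ → ι) (v : ι → Plane) {s : ℕ} (hs : s ≤ n)
    (hcross : ∀ {x y z u}, s ≤ x → x < y → y < z → z < u → u < s + n → c z = c x → c u = c y →
      c y = c x)
    (hgaps : ∀ {x₁ x₂ x₃ x₄ y₁ y₂ y₃}, s ≤ x₁ → x₁ < y₁ → y₁ < x₂ → x₂ < y₂ → y₂ < x₃ → x₃ < y₃ →
      y₃ < x₄ → x₄ < s + n → c x₂ = c x₁ → c x₃ = c x₁ → c x₄ = c x₁ → c y₁ ≠ c x₁ → c y₂ ≠ c x₁ →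
      c y₃ ≠ c x₁ → False) {a b : ℕ} (ha : s ≤ a) (hab : a ≤ b) (hb : b ≤ s + n)
    (hclosed : ∀ x z, a ≤ x → x < b → s ≤ z → z < s + n → c z = c x → a ≤ z ∧ z < b) :
    T.F a b ≤ (1 + ε) * (∑ x ∈ Finset.Ico a b, dist (pt x) (v (c x)) +
      ∑ i ∈ (Finset.Ico a b).image c, dist (v i) t) := by
  induction hd : b - a using Nat.strong_induction_on generalizing a b with
  | _ d ih =>
  rcases hab.lt_or_eq with hlt | rfl
  swap
  · simp [hT.diag]
  -- The maximal runs of positions inside and outside of the group of `a`.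
  obtain ⟨j, j1, j2, j3, j4⟩ := exists_run (fun x => c x = c a) hab
  obtain ⟨k, k1, k2, k3, k4⟩ := exists_run (fun x => c x ≠ c a) j2
  obtain ⟨p, p1, p2, p3, p4⟩ := exists_run (fun x => c x = c a) k2
  obtain ⟨q, q1, q2, q3, q4⟩ := exists_run (fun x => c x ≠ c a) p2
  obtain ⟨m, m1, m2, m3, m4⟩ := exists_run (fun x => c x = c a) q2
  obtain ⟨r, r1, r2, r3, r4⟩ := exists_run (fun x => c x ≠ c a) m2
  simp only [ne_eq, not_not] at k4 q4 r4
  have haj : a < j := by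
    refine lt_of_le_of_ne j1 fun h => ?_
    subst h
    exact j4 hlt rfl
  have hr : r = b := by
    by_contra hne
    have hrb : r < b := by omega
    have e0 := r4 hrb
    have e1 := j4 (by omega)
    have e3 := p4 (by omega)
    have e5 := m4 (by omega)
    have e2 := k4 (by omega)
    have e4 := q4 (by omega)
    have n1 : j ≠ k := fun h => e1 (h ▸ e2)
    have n2 : k ≠ p := fun h => e3 (h ▸ e2)
    have n3 : p ≠ q := fun h => e3 (h ▸ e4)
    have n4 : q ≠ m := fun h => e5 (h ▸ e4)
    have n5 : m ≠ r := fun h => e5 (h ▸ e0)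
    exact hgaps ha haj (by omega : j < k) (by omega : k < p) (by omega : p < q)
      (by omega : q < m) (by omega : m < r) (by omega) e2 e4 e0 e1 e3 e5
  subst hr
  -- Positions of a group in two different gaps would cross the group of `a`.
  have cross : ∀ x y z, a < x → x < y → y < z → z < r → c y = c a → c z = c x → c x = c a :=
    fun x y z h1 h2 h3 h4 h5 h6 => hcross ha h1 h2 h3 (by omega) h5 h6
  have cl1 : ∀ x z, j ≤ x → x < k → s ≤ z → z < s + n → c z = c x → j ≤ z ∧ z < k := by
    intro x z h1 h2 h3 h4 h5
    obtain ⟨h6, h7⟩ := hclosed x z (by omega) (by omega) h3 h4 h5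
    have hx := k3 x h1 h2
    have hz : c z ≠ c a := fun h => hx (h5 ▸ h)
    have : ¬ z < j := fun h => hz (j3 z h6 h)
    refine ⟨by omega, ?_⟩
    by_contra! h8
    rcases h8.lt_or_eq with h8 | rfl
    · exact hx (cross x k z (by omega) h2 h8 h7 (k4 (by omega)) h5)
    · exact hz (k4 h7)
  have cl2 : ∀ x z, p ≤ x → x < q → s ≤ z → z < s + n → c z = c x → p ≤ z ∧ z < q := by
    intro x z h1 h2 h3 h4 h5
    obtain ⟨h6, h7⟩ := hclosed x z (by omega) (by omega) h3 h4 h5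
    have hx := q3 x h1 h2
    have hz : c z ≠ c a := fun h => hx (h5 ▸ h)
    constructor
    · by_contra! h8
      by_cases h9 : k ≤ z
      · exact hz (p3 z h9 h8)
      · have : ¬ z < j := fun h => hz (j3 z h6 h)
        exact hz (cross z k x (by omega) (by omega) (by
          rcases (show k ≤ x by omega).lt_or_eq with h | rfl
          · exact h
          · exact absurd (k4 (by omega)) hx) (by omega) (k4 (by omega)) h5.symm)
    · by_contra! h8
      rcases h8.lt_or_eq with h8 | rfl
      · exact hx (cross x q z (by omega) h2 h8 h7 (q4 (by omega)) h5)
      · exact hz (q4 h7)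
  have cl3 : ∀ x z, m ≤ x → x < r → s ≤ z → z < s + n → c z = c x → m ≤ z ∧ z < r := by
    intro x z h1 h2 h3 h4 h5
    obtain ⟨h6, h7⟩ := hclosed x z (by omega) (by omega) h3 h4 h5
    have hx := r3 x h1 h2
    have hz : c z ≠ c a := fun h => hx (h5 ▸ h)
    refine ⟨?_, h7⟩
    by_contra! h8
    by_cases h9 : q ≤ z
    · exact hz (m3 z h9 h8)
    · by_cases hkz : k ≤ z
      · have hzp : ¬ z < p := fun h => hz (p3 z hkz h)
        have hq := q4 (by omega)
        refine hz (cross z q x (by omega) (by omega) ?_ h2 hq h5.symm)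
        rcases (show q ≤ x by omega).lt_or_eq with h | rfl
        · exact h
        · exact absurd hq hx
      · have : ¬ z < j := fun h => hz (j3 z h6 h)
        have hk := k4 (by omega)
        refine hz (cross z k x (by omega) (by omega) ?_ h2 hk h5.symm)
        rcases (show k ≤ x by omega).lt_or_eq with h | rfl
        · exact h
        · exact absurd hk hx
  have i1 := ih (k - j) (by omega) (a := j) (b := k) (by omega) k1 (by omega) cl1 rfl
  have i2 := ih (q - p) (by omega) (a := p) (b := q) (by omega) q1 (by omega) cl2 rfl
  have i3 := ih (r - m) (by omega) (a := m) (b := r) (by omega) m2 (by omega) cl3 rfl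
  have hne : (arcs a j k p q m).map pt ≠ [] := by
    intro h
    have := congrArg List.length h
    simp [arcs] at this
    omega
  have hw := hW _ hne (v (c a))
  rw [starCost_arcs] at hw
  have f1 := hT.F_le a m r (Nat.zero_le _) (by omega) m2 (by omega) (by omega)
  have f2 := hT.G_le a j k p q m (Nat.zero_le _) haj k1 p1 q1 m1 (by omega) (by omega)
  rw [candidate] at f2
  have colors : dist (v (c a)) t + ∑ i ∈ (Finset.Ico j k).image c, dist (v i) t +
      ∑ i ∈ (Finset.Ico p q).image c, dist (v i) t + ∑ i ∈ (Finset.Ico m r).image c, dist (v i) t ≤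
      ∑ i ∈ (Finset.Ico a r).image c, dist (v i) t := by
    have d1 : c a ∉ (Finset.Ico j k).image c ∪ ((Finset.Ico p q).image c ∪
        (Finset.Ico m r).image c) := by
      simp only [Finset.mem_union, Finset.mem_image, Finset.mem_Ico, not_or, not_exists, not_and]
      exact ⟨fun x hx => k3 x hx.1 hx.2, fun x hx => q3 x hx.1 hx.2, fun x hx => r3 x hx.1 hx.2⟩
    have d2 : Disjoint ((Finset.Ico p q).image c) ((Finset.Ico m r).image c) := by
      rw [Finset.disjoint_left]
      simp only [Finset.mem_image, Finset.mem_Ico, not_exists, not_and]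
      rintro _ ⟨x, hx, rfl⟩ y hy he
      have := cl2 x y hx.1 hx.2 (by omega) (by omega) he
      omega
    have d3 : Disjoint ((Finset.Ico j k).image c) ((Finset.Ico p q).image c ∪
        (Finset.Ico m r).image c) := by
      rw [Finset.disjoint_left]
      simp only [Finset.mem_union, Finset.mem_image, Finset.mem_Ico, not_or, not_exists, not_and]
      rintro _ ⟨x, hx, rfl⟩
      constructor <;> intro y hy he
      · have := cl1 x y hx.1 hx.2 (by omega) (by omega) he
        omega
      · have := cl1 x y hx.1 hx.2 (by omega) (by omega) he
        omega
    calc _ = ∑ i ∈ insert (c a) ((Finset.Ico j k).image c ∪ ((Finset.Ico p q).image c ∪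
          (Finset.Ico m r).image c)), dist (v i) t := by
          rw [Finset.sum_insert d1, Finset.sum_union d3, Finset.sum_union d2]; ring
      _ ≤ _ := by
        refine Finset.sum_le_sum_of_subset_of_nonneg ?_ fun _ _ _ => dist_nonneg
        intro i hi
        simp only [Finset.mem_insert, Finset.mem_union, Finset.mem_image, Finset.mem_Ico] at hi ⊢
        rcases hi with rfl | ⟨x, hx, rfl⟩ | ⟨x, hx, rfl⟩ | ⟨x, hx, rfl⟩
        · exact ⟨a, by omega, rfl⟩
        all_goals exact ⟨x, by omega, rfl⟩
  have sum_eq : ∑ x ∈ Finset.Ico a r, dist (pt x) (v (c x)) =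
      ∑ x ∈ Finset.Ico a j, dist (pt x) (v (c a)) + ∑ x ∈ Finset.Ico k p, dist (pt x) (v (c a)) +
      ∑ x ∈ Finset.Ico q m, dist (pt x) (v (c a)) + ∑ x ∈ Finset.Ico j k, dist (pt x) (v (c x)) +
      ∑ x ∈ Finset.Ico p q, dist (pt x) (v (c x)) +
      ∑ x ∈ Finset.Ico m r, dist (pt x) (v (c x)) := by
    rw [← Finset.sum_Ico_consecutive _ (show a ≤ m by omega) m2,
      ← Finset.sum_Ico_consecutive _ (show a ≤ q by omega) m1,
      ← Finset.sum_Ico_consecutive _ (show a ≤ p by omega) q1,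
      ← Finset.sum_Ico_consecutive _ (show a ≤ k by omega) p1,
      ← Finset.sum_Ico_consecutive _ (show a ≤ j by omega) k1,
      Finset.sum_congr (s₁ := Finset.Ico a j) rfl fun x hx => by
        rw [j3 x (Finset.mem_Ico.1 hx).1 (Finset.mem_Ico.1 hx).2],
      Finset.sum_congr (s₁ := Finset.Ico k p) rfl fun x hx => by
        rw [p3 x (Finset.mem_Ico.1 hx).1 (Finset.mem_Ico.1 hx).2],
      Finset.sum_congr (s₁ := Finset.Ico q m) rfl fun x hx => by
        rw [m3 x (Finset.mem_Ico.1 hx).1 (Finset.mem_Ico.1 hx).2]]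
    ring
  rw [sum_eq]
  have := mul_le_mul_of_nonneg_left colors hε
  linarith

end DPTables

/-! ### The program for the dynamic program -/

/-!
Scalar variables occupy position `(0, 0)` of an array of their own. The program uses the following
arrays of natural numbers.
* `0`: the number `n` of sources, and in the end the number of Steiner vertices; `1`, `2`: the parents
  that are put out; `3`: the length `2 n` of the doubled tour.
* `4`, `5`, `9`, `26`, `29`: loop counters; `6`: the start of the tour; `7`: the rank of a source;
  `8`: the tour.
* `10`, `12`, …, `16`: the ends `i`, `j - 1`, `k`, `p`, `q`, `m` of the arcs; `11`: the greatest right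
  end of an interval that begins at `i`; `17`: the right end `l` of the interval to be split.
* `20`, …, `24`: the tables `J`, `K`, `P`, `Q`, `M`, in which zero stands for an empty entry.
* `25`: the best window; `27`, `28`: the interval reached by the search for a group; `30`, `31`: the
  numbers of the Steiner vertices, and how many there are; `32`: the end of the first group of the
  interval reached.

The arrays of real numbers are the following.
* `0`, …, `4`: the input, and in the end the coordinates of the Steiner vertices in `0` and `1`.
* `5`, `6`: the sums of the relative positions; `7`: the sorting keys, with one row for each component;
  `8`, `9`: the coordinates of the points of the tour.
* `10`, `11`: the list for the Weber solver; `12`, `13`, `14`: its answer; `15`, …, `18`: the tables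
  `F`, `G`, `X`, `Y`; `19`: the value to be compared.
-/

/-- The tables of the dynamic program, as stored in a memory. -/
def Memory.tables (s : Memory) : DPTables where
  F := s.real 15
  G := s.real 16
  X := s.real 17
  Y := s.real 18
  J := s.nat 20
  K := s.nat 21
  P := s.nat 22
  Q := s.nat 23
  M := s.nat 24

namespace Code

/-- The number of points of the first arc. -/
abbrev len1 : NatExp := .sub (.add (.var 12) (.const 1)) (.var 10)

/-- The number of points of the first two arcs. -/
abbrev len2 : NatExp := .add len1 (.sub (.var 14) (.var 13))

/-- The number of points of the three arcs. -/
abbrev len3 : NatExp := .add len2 (.sub (.var 16) (.var 15))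

/-- Write point number `x` to place `e` of the list for the Weber solver. -/
abbrev push (e x : NatExp) : Program :=
  .seq (.setReal 10 (.const 0) e (.at 8 x)) (.setReal 11 (.const 0) e (.at 9 x))

/-- Store the present arcs and the answer of the solver in the tables. -/
def store : Program :=
  .seq (.setReal 16 (.var 10) (.var 16) (.at 19 (.const 0)))
  (.seq (.setReal 17 (.var 10) (.var 16) (.at 12 (.const 0)))
  (.seq (.setReal 18 (.var 10) (.var 16) (.at 13 (.const 0)))
  (.seq (.setNat 20 (.var 10) (.var 16) (.add (.var 12) (.const 1)))
  (.seq (.setNat 21 (.var 10) (.var 16) (.var 13))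
  (.seq (.setNat 22 (.var 10) (.var 16) (.var 14))
  (.setNat 23 (.var 10) (.var 16) (.var 15)))))))

/-- Evaluate the present arcs, and store them if they are the first or better than those stored. -/
def evaluate : Program :=
  .seq (.weber 10 11 (.const 0) len3 (.at 4 (.const 0)) (.at 2 (.const 0)) (.at 3 (.const 0))
    12 13 14)
  (.seq (.setReal 19 (.const 0) (.const 0) (.add (.add (.at 14 (.const 0))
    (.get 15 (.add (.var 12) (.const 1)) (.var 13))) (.get 15 (.var 14) (.var 15))))
  (.ite (.conj (.neg (.natLe (.get 20 (.var 10) (.var 16)) (.const 0)))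
    (.realLe (.get 16 (.var 10) (.var 16)) (.at 19 (.const 0)))) .skip store))

/-- The loop over the end of the third arc. The list for the solver is a stack: each round extends it
by one point, so that the list is never built anew. -/
def loopM : Program :=
  .for 16 (.var 15) (.add (.var 11) (.const 1)) (.seq evaluate (push len3 (.var 16)))

/-- The loop over the beginning of the third arc. -/
def loopQ : Program := .for 15 (.var 14) (.add (.var 11) (.const 1)) loopM

/-- The loop over the end of the second arc. -/
def loopP : Program :=
  .for 14 (.var 13) (.add (.var 11) (.const 1)) (.seq loopQ (push len2 (.var 14)))

/-- The loop over the beginning of the second arc. -/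
def loopK : Program :=
  .for 13 (.add (.var 12) (.const 1)) (.add (.var 11) (.const 1)) loopP

/-- The loop over the last element of the first arc. -/
def loopJ : Program :=
  .for 12 (.var 10) (.var 11) (.seq (push (.sub (.var 12) (.var 10)) (.var 12)) loopK)

/-- The computation of the values of the intervals that begin at a given position. -/
def split : Program :=
  .for 17 (.add (.var 10) (.const 1)) (.add (.var 11) (.const 1))
    (.for 16 (.add (.var 10) (.const 1)) (.add (.var 17) (.const 1))
      (.seq (.setReal 19 (.const 0) (.const 0)
          (.add (.get 16 (.var 10) (.var 16)) (.get 15 (.var 16) (.var 17))))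
        (.ite (.conj (.neg (.natLe (.get 24 (.var 10) (.var 17)) (.const 0)))
            (.realLe (.get 15 (.var 10) (.var 17)) (.at 19 (.const 0)))) .skip
          (.seq (.setReal 15 (.var 10) (.var 17) (.at 19 (.const 0)))
            (.setNat 24 (.var 10) (.var 17) (.var 16))))))

/-- The dynamic program: the first element `i` of the interval runs downwards. Truncated subtraction
gives the greatest right end `min (i + n) (2 * n)`. -/
def dp : Program :=
  .for 9 (.const 0) (.var 3)
    (.seq (.assign 10 (.sub (.sub (.var 3) (.const 1)) (.var 9)))
    (.seq (.assign 11 (.sub (.var 3) (.sub (.var 3) (.add (.var 10) (.var 0)))))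
    (.seq loopJ split)))

end Code

/-- The rule for counting loops, with all times measured in units of `n ^ k * τ`. -/
theorem Run.for_pow {W : WeberSolver} {v : ℕ} {lo hi : NatExp} {body : Program} {s₀ : Memory}
    {n τ l b B k : ℕ} (I : ℕ → Memory → Prop) (hn : 0 < n) (hτ : 1 ≤ τ)
    (hlo : lo.eval s₀ = l) (hlb : l ≤ b) (hbl : b ≤ l + 2 * n)
    (hv : v ∉ body.natMods)
    (hhi : ∀ s, Frame (v :: body.natMods) body.realMods s₀ s → hi.eval s = b)
    (hI : ∀ x s y, I x s → I x (s.setNat v 0 0 y))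
    (h0 : I l s₀)
    (hbody : ∀ x s, l ≤ x → x < b → Frame (v :: body.natMods) body.realMods s₀ s →
      s.nat v 0 0 = x → I x s → Run W body s (B * (n ^ k * τ)) (I (x + 1))) :
    Run W (.for v lo hi body) s₀ ((2 * B + 6) * (n ^ (k + 1) * τ))
      fun s => I b s ∧ Frame (v :: body.natMods) body.realMods s₀ s := by
  refine (Run.for I hlo hlb hv hhi hI h0 hbody).mono ?_ fun _ h => h
  have h1 : 1 ≤ n ^ k * τ := Nat.one_le_iff_ne_zero.2 (by positivity)
  calc (b - l) * (B * (n ^ k * τ) + 2) + 2 ≤ (2 * n) * (B * (n ^ k * τ) + 2) + 2 := by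
        gcongr; omega
    _ ≤ (2 * n) * (B * (n ^ k * τ) + 2 * (n ^ k * τ)) + 2 * (n * (n ^ k * τ)) := by
        have h2 : 1 ≤ n * (n ^ k * τ) := Nat.one_le_iff_ne_zero.2 (by positivity)
        gcongr <;> omega
    _ = (2 * B + 6) * (n ^ (k + 1) * τ) := by ring

/-- The data that do not change while the groups of the point at position `i` are enumerated: `e` is
the bound for the right ends of the intervals. -/
structure DPContext (W : WeberSolver) (ε : ℝ) (t : Plane) (pt : ℕ → Plane) (n i e τ : ℕ)
    (s : Memory) : Prop where
  n_pos : 0 < n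
  one_le : 1 ≤ τ
  steps : ∀ A, A ≠ [] → A.length ≤ n → W.steps ε t A ≤ τ
  eps : s.real 4 0 0 = ε
  t0 : s.real 2 0 0 = t 0
  t1 : s.real 3 0 0 = t 1
  pts : ∀ x, pt x = !₂[s.real 8 0 x, s.real 9 0 x]
  i_eq : s.nat 10 0 0 = i
  e_eq : s.nat 11 0 0 = e
  i_lt : i < e
  e_le : e ≤ i + n

section DynamicProgram

variable {W : WeberSolver} {ε : ℝ} {t : Plane} {pt : ℕ → Plane} {n i e τ : ℕ} {s s' : Memory}

theorem DPContext.frame (h : DPContext W ε t pt n i e τ s) {A R : List ℕ} (hf : Frame A R s s')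
    (hA : 10 ∉ A ∧ 11 ∉ A := by decide)
    (hR : 2 ∉ R ∧ 3 ∉ R ∧ 4 ∉ R ∧ 8 ∉ R ∧ 9 ∉ R := by decide) :
    DPContext W ε t pt n i e τ s' where
  n_pos := h.n_pos
  one_le := h.one_le
  steps := h.steps
  eps := by rw [hf.real 4 hR.2.2.1, h.eps]
  t0 := by rw [hf.real 2 hR.1, h.t0]
  t1 := by rw [hf.real 3 hR.2.1, h.t1]
  pts := by rw [hf.real 8 hR.2.2.2.1, hf.real 9 hR.2.2.2.2]; exact h.pts
  i_eq := by rw [hf.nat 10 hA.1, h.i_eq]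
  e_eq := by rw [hf.nat 11 hA.2, h.e_eq]
  i_lt := h.i_lt
  e_le := h.e_le

/-- The list for the Weber solver begins with the points at the positions in `L`. -/
def Prefix (pt : ℕ → Plane) (L : List ℕ) (s : Memory) : Prop :=
  ∀ r (h : r < L.length), !₂[s.real 10 0 r, s.real 11 0 r] = pt L[r]

theorem Prefix.points {L : List ℕ} (h : Prefix pt L s) :
    s.points 10 11 0 L.length = L.map pt := by
  refine List.ext_getElem (by simp [Memory.points]) fun r h1 h2 => ?_
  simp only [Memory.points, List.getElem_map, List.getElem_range]
  exact h r (by simpa using h2)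

theorem Prefix.congr {L : List ℕ} (h : Prefix pt L s) (h0 : s'.real 10 = s.real 10)
    (h1 : s'.real 11 = s.real 11) : Prefix pt L s' := by
  unfold Prefix; rw [h0, h1]; exact h

theorem Prefix.of_append {L L' : List ℕ} (h : Prefix pt (L ++ L') s) : Prefix pt L s := by
  intro r hr
  rw [h r (by simp; omega), List.getElem_append_left]

theorem Prefix.run_push {L : List ℕ} {x : ℕ} {en ex : NatExp} (h : Prefix pt L s)
    (hpt : pt x = !₂[s.real 8 0 x, s.real 9 0 x]) (hn : en.eval s = L.length)
    (hx : ex.eval s = x) (hn' : ∀ v, en.eval (s.setReal 10 0 L.length v) = L.length)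
    (hx' : ∀ v, ex.eval (s.setReal 10 0 L.length v) = x) :
    Run W (Code.push en ex) s 2 fun s' => Prefix pt (L ++ [x]) s' ∧ s'.tables = s.tables := by
  refine Run.seq (B := 1) (B' := 1) (Run.setReal (Run.setReal ⟨?_, ?_⟩))
  · simp only [RealExp.eval, NatExp.eval, hn, hx, hn', hx']
    intro r hr
    simp only [List.length_append, List.length_singleton] at hr
    by_cases hrL : r < L.length
    · rw [List.getElem_append_left hrL, ← h r hrL]
      simp [Memory.setReal_real, hrL.ne]
    · obtain rfl : r = L.length := by omega
      simp [Memory.setReal_real, hpt]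
  · simp only [RealExp.eval, NatExp.eval, Memory.tables]
    simp [Memory.setReal_real_ne]

/-- The state of the tables while the groups of the point at position `i` are enumerated: `T₀` are the
tables at the beginning, and `D` holds for the choices of arcs considered so far. An entry `J i m = 0` shows that
nothing has been stored for the right end `m`. -/
structure Enumerated (W : WeberSolver) (ε : ℝ) (t : Plane) (pt : ℕ → Plane) (i : ℕ) (T₀ : DPTables)
    (D : ℕ → ℕ → ℕ → ℕ → ℕ → Prop) (T : DPTables) : Prop where
  F_eq : T.F = T₀.F
  M_eq : T.M = T₀.M
  G_eq : ∀ i', i' ≠ i → T.G i' = T₀.G i'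
  X_eq : ∀ i', i' ≠ i → T.X i' = T₀.X i'
  Y_eq : ∀ i', i' ≠ i → T.Y i' = T₀.Y i'
  J_eq : ∀ i', i' ≠ i → T.J i' = T₀.J i'
  K_eq : ∀ i', i' ≠ i → T.K i' = T₀.K i'
  P_eq : ∀ i', i' ≠ i → T.P i' = T₀.P i'
  Q_eq : ∀ i', i' ≠ i → T.Q i' = T₀.Q i'
  stored : ∀ m, T.J i m ≠ 0 → T.Stored W ε t pt i m
  done : ∀ j k p q m, D j k p q m → T.J i m ≠ 0 ∧
    T.G i m ≤ DPTables.candidate W ε t pt T₀.F i j k p q m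

theorem Enumerated.mono {T₀ T : DPTables} {D D' : ℕ → ℕ → ℕ → ℕ → ℕ → Prop}
    (h : Enumerated W ε t pt i T₀ D T) (hD : ∀ j k p q m, D' j k p q m → D j k p q m) :
    Enumerated W ε t pt i T₀ D' T :=
  { h with done := fun j k p q m hd => h.done j k p q m (hD _ _ _ _ _ hd) }

/-! ### Correctness of the dynamic program -/

theorem DPTables.Stored.congr {T T' : DPTables} {m : ℕ} (h : T.Stored W ε t pt i m)
    (hF : ∀ a b, i < a → T'.F a b = T.F a b) (hG : T'.G i m = T.G i m) (hX : T'.X i m = T.X i m)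
    (hY : T'.Y i m = T.Y i m) (hJ : T'.J i m = T.J i m) (hK : T'.K i m = T.K i m)
    (hP : T'.P i m = T.P i m) (hQ : T'.Q i m = T.Q i m) : T'.Stored W ε t pt i m := by
  obtain ⟨h1, h2, h3, h4, h5, h6, h7, h8⟩ := h
  unfold DPTables.Stored
  rw [hG, hX, hY, hJ, hK, hP, hQ]
  refine ⟨h1, h2, h3, h4, h5, ?_, h7, h8⟩
  rw [h6, DPTables.candidate, DPTables.candidate, hF _ _ (by omega), hF _ _ (by omega)]

/-- A choice of arcs is stored that is the first one for its right end, or at least as good as the one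
stored before. -/
theorem Enumerated.insert {T₀ T T' : DPTables} {D : ℕ → ℕ → ℕ → ℕ → ℕ → Prop} {j k p q m : ℕ}
    (h : Enumerated W ε t pt i T₀ D T) (hj : i < j) (hk : j ≤ k) (hp : k ≤ p) (hq : p ≤ q)
    (hm : q ≤ m) (hbetter : T.J i m = 0 ∨ DPTables.candidate W ε t pt T₀.F i j k p q m ≤ T.G i m)
    (hF : T'.F = T.F) (hM : T'.M = T.M)
    (hG : ∀ i' m', T'.G i' m' = if i' = i ∧ m' = m then
      DPTables.candidate W ε t pt T₀.F i j k p q m else T.G i' m')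
    (hX : ∀ i' m', T'.X i' m' = if i' = i ∧ m' = m then
      W.point ε t ((arcs i j k p q m).map pt) 0 else T.X i' m')
    (hY : ∀ i' m', T'.Y i' m' = if i' = i ∧ m' = m then
      W.point ε t ((arcs i j k p q m).map pt) 1 else T.Y i' m')
    (hJ : ∀ i' m', T'.J i' m' = if i' = i ∧ m' = m then j else T.J i' m')
    (hK : ∀ i' m', T'.K i' m' = if i' = i ∧ m' = m then k else T.K i' m')
    (hP : ∀ i' m', T'.P i' m' = if i' = i ∧ m' = m then p else T.P i' m')
    (hQ : ∀ i' m', T'.Q i' m' = if i' = i ∧ m' = m then q else T.Q i' m') :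
    Enumerated W ε t pt i T₀ (fun j' k' p' q' m' => D j' k' p' q' m' ∨
      (j' = j ∧ k' = k ∧ p' = p ∧ q' = q ∧ m' = m)) T' where
  F_eq := hF.trans h.F_eq
  M_eq := hM.trans h.M_eq
  G_eq i' hi := by rw [← h.G_eq i' hi]; funext m'; simp [hG, hi]
  X_eq i' hi := by rw [← h.X_eq i' hi]; funext m'; simp [hX, hi]
  Y_eq i' hi := by rw [← h.Y_eq i' hi]; funext m'; simp [hY, hi]
  J_eq i' hi := by rw [← h.J_eq i' hi]; funext m'; simp [hJ, hi]
  K_eq i' hi := by rw [← h.K_eq i' hi]; funext m'; simp [hK, hi]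
  P_eq i' hi := by rw [← h.P_eq i' hi]; funext m'; simp [hP, hi]
  Q_eq i' hi := by rw [← h.Q_eq i' hi]; funext m'; simp [hQ, hi]
  stored m' hm' := by
    by_cases hmm : m' = m
    · subst hmm
      unfold DPTables.Stored
      simp only [hG, hX, hY, hJ, hK, hP, hQ, and_self, if_true, hF, h.F_eq, and_true]
      exact ⟨hj, hk, hp, hq, hm⟩
    · rw [hJ, if_neg (by simp [hmm])] at hm'
      refine (h.stored m' hm').congr (by simp [hF]) ?_ ?_ ?_ ?_ ?_ ?_ ?_ <;>
        simp [hG, hX, hY, hJ, hK, hP, hQ, hmm]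
  done j' k' p' q' m' hd := by
    rw [hJ, hG]
    by_cases hmm : m' = m
    · subst hmm
      simp only [and_self, if_true]
      refine ⟨by omega, ?_⟩
      rcases hd with hd | ⟨rfl, rfl, rfl, rfl, -⟩
      · obtain ⟨h1, h2⟩ := h.done _ _ _ _ _ hd
        rcases hbetter with hb | hb
        · exact absurd hb h1
        · exact hb.trans h2
      · exact le_rfl
    · simp only [hmm, and_false, if_false]
      rcases hd with hd | ⟨-, -, -, -, hd⟩
      · exact h.done _ _ _ _ _ hd
      · exact absurd hd hmm

theorem length_arcs {i j k p q m : ℕ} :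
    (arcs i j k p q m).length = (j - i) + (p - k) + (m - q) := by
  simp [arcs, add_assoc]

/-- The solver is called within its time bound `τ`, since the three arcs have at most `n` points. -/
theorem run_evaluate {T₀ : DPTables} {D : ℕ → ℕ → ℕ → ℕ → ℕ → Prop} {j k p q m : ℕ}
    (hc : DPContext W ε t pt n i e τ s) (hT : Enumerated W ε t pt i T₀ D s.tables)
    (hL : Prefix pt (arcs i (j + 1) k p q m) s)
    (h12 : s.nat 12 0 0 = j) (h13 : s.nat 13 0 0 = k) (h14 : s.nat 14 0 0 = p)
    (h15 : s.nat 15 0 0 = q) (h16 : s.nat 16 0 0 = m)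
    (hj : i ≤ j) (hk : j + 1 ≤ k) (hp : k ≤ p) (hq : p ≤ q) (hm : q ≤ m) (hme : m ≤ e) :
    Run W Code.evaluate s (τ + 10) fun s' => Prefix pt (arcs i (j + 1) k p q m) s' ∧
      Enumerated W ε t pt i T₀ (fun j' k' p' q' m' => D j' k' p' q' m' ∨
        (j' = j + 1 ∧ k' = k ∧ p' = p ∧ q' = q ∧ m' = m)) s'.tables := by
  have hlen : Code.len3.eval s = (arcs i (j + 1) k p q m).length := by
    simp [NatExp.eval, length_arcs, h12, h13, h14, h15, h16, hc.i_eq]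
  have htt : !₂[s.real 2 0 0, s.real 3 0 0] = t := Plane.ext (by simp [hc.t0]) (by simp [hc.t1])
  obtain ⟨A, hA⟩ : ∃ A, A = (arcs i (j + 1) k p q m).map pt := ⟨_, rfl⟩
  have hpts := hL.points
  rw [← hA] at hpts
  have hAne : A ≠ [] := by
    intro h
    have := congrArg List.length h
    simp [hA, length_arcs] at this
    omega
  have hAl : A.length ≤ n := by
    have := hc.e_le
    simp [hA, length_arcs]; omega
  -- The memory after the call of the solver.
  have hweb : Exec W (.weber 10 11 (.const 0) Code.len3 (.at 4 (.const 0)) (.at 2 (.const 0))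
      (.at 3 (.const 0)) 12 13 14) s
      (s.storeAnswer 12 13 14 (W.point ε t A) (W.value ε t A)) (W.steps ε t A + 1) := by
    have := Exec.weber (W := W) s 10 11 (.const 0) Code.len3 (.at 4 (.const 0)) (.at 2 (.const 0))
      (.at 3 (.const 0)) 12 13 14
    rw [hlen] at this
    simp only [RealExp.eval, NatExp.eval, hc.eps, htt, hpts] at this
    exact this
  obtain ⟨s1, hs1⟩ : ∃ s1, s1 = s.storeAnswer 12 13 14 (W.point ε t A) (W.value ε t A) := ⟨_, rfl⟩
  rw [← hs1] at hweb
  have n1 : s1.nat = s.nat := by rw [hs1]; rfl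
  have r12 : s1.real 12 0 0 = W.point ε t A 0 := by
    simp [hs1, Memory.storeAnswer, Memory.setReal_real]
  have r13 : s1.real 13 0 0 = W.point ε t A 1 := by
    simp [hs1, Memory.storeAnswer, Memory.setReal_real]
  have r14 : s1.real 14 0 0 = W.value ε t A := by
    simp [hs1, Memory.storeAnswer]
  have hf1 := hweb.frame
  have t1 : s1.tables = s.tables := by
    simp only [Memory.tables, n1]
    rw [hf1.real 15 (by decide), hf1.real 16 (by decide), hf1.real 17 (by decide),
      hf1.real 18 (by decide)]
  have hL1 : Prefix pt (arcs i (j + 1) k p q m) s1 :=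
    hL.congr (hf1.real 10 (by decide)) (hf1.real 11 (by decide))
  rw [← n1] at h12 h13 h14 h15 h16
  have h10 : s1.nat 10 0 0 = i := by rw [n1, hc.i_eq]
  have hF1 : s1.real 15 = T₀.F := by
    have := hT.F_eq; rw [← t1] at this; exact this
  rw [← t1] at hT
  have hτ := hc.steps A hAne hAl
  refine Run.mono (B := (τ + 1) + (1 + (7 + 1))) (Run.seq ⟨s1, _, hweb, by omega, ?_⟩) (by omega)
    fun _ h => h
  refine Run.seq (Run.setReal ?_)
  simp only [RealExp.eval, NatExp.eval, h12, h13, h14, h15, r14, hF1]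
  have hval : W.value ε t A + T₀.F (j + 1) k + T₀.F p q =
      DPTables.candidate W ε t pt T₀.F i (j + 1) k p q m := by rw [hA]; rfl
  rw [hval]
  obtain ⟨s2, hs2⟩ : ∃ s2, s2 = s1.setReal 19 0 0
    (DPTables.candidate W ε t pt T₀.F i (j + 1) k p q m) := ⟨_, rfl⟩
  rw [← hs2]
  have n2 : s2.nat = s1.nat := by rw [hs2]; rfl
  have r2 : ∀ a, a ≠ 19 → s2.real a = s1.real a := fun a ha => by
    rw [hs2, Memory.setReal_real_ne _ _ _ _ ha]
  have r19 : s2.real 19 0 0 = DPTables.candidate W ε t pt T₀.F i (j + 1) k p q m := by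
    rw [hs2, Memory.setReal_real_self]
  have t2 : s2.tables = s1.tables := by
    simp only [Memory.tables, n2, r2 15 (by decide), r2 16 (by decide), r2 17 (by decide),
      r2 18 (by decide)]
  rw [← t2] at hT
  have hL2 := hL1.congr (r2 10 (by decide)) (r2 11 (by decide))
  rw [← r2 12 (by decide)] at r12
  rw [← r2 13 (by decide)] at r13
  rw [← n2] at h12 h13 h14 h15 h16 h10
  clear hs2 hs1
  refine Run.ite (fun hb => (Run.skip (W := W) ?_).mono (by omega) fun _ h => h) (fun hb => ?_)
  · simp only [Test.Holds, NatExp.eval, RealExp.eval, h10, h16, r19] at hb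
    refine ⟨hL2, { hT with done := fun j' k' p' q' m' hd => ?_ }⟩
    rcases hd with hd | ⟨rfl, rfl, rfl, rfl, rfl⟩
    · exact hT.done _ _ _ _ _ hd
    · exact ⟨fun h => hb.1 (Nat.le_of_eq h), hb.2⟩
  · simp only [Test.Holds, NatExp.eval, RealExp.eval, h10, h16, r19] at hb
    have hb' : s2.tables.J i m = 0 ∨
        DPTables.candidate W ε t pt T₀.F i (j + 1) k p q m ≤ s2.tables.G i m := by
      by_cases h0 : s2.nat 20 i m ≤ 0
      · exact .inl (Nat.le_zero.1 h0)
      · exact .inr (le_of_lt (not_le.1 fun h => hb ⟨h0, h⟩))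
    unfold Code.store
    refine Run.mono (B := 1 + (1 + (1 + (1 + (1 + (1 + 1)))))) ?_ (by omega) fun _ h => h
    refine .seq (.setReal (.seq (.setReal (.seq (.setReal (.seq (.setNat (.seq (.setNat
      (.seq (.setNat (.setNat ?_))))))))))))
    simp only [RealExp.eval, NatExp.eval, Memory.setNat_nat, Memory.setReal_real,
      Memory.setReal_nat, h10, h12, h13, h14, h15, h16, r12, r13, r19]
    norm_num only [and_self, if_true, if_false, false_and]
    refine ⟨hL2.congr ?_ ?_, hT.insert (by omega) hk hp hq hm hb' ?_ ?_ ?_ ?_ ?_ ?_ ?_ ?_ ?_⟩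
    all_goals first
      | (funext a b; simp [Memory.tables, Memory.setNat_nat, Memory.setReal_real])
      | (intro i' m'; simp [Memory.tables, Memory.setNat_nat, Memory.setReal_real, hA])

theorem arcs_concat_third {i j k p q m : ℕ} (h : q ≤ m) :
    arcs i j k p q (m + 1) = arcs i j k p q m ++ [m] := by
  simp only [arcs, List.append_assoc, List.append_cancel_left_eq]
  rw [show m + 1 - q = (m - q) + 1 by omega, List.range'_concat]
  simp; omega

theorem arcs_concat_second {i j k p : ℕ} (h : k ≤ p) :
    arcs i j k (p + 1) 0 0 = arcs i j k p 0 0 ++ [p] := by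
  simp only [arcs, List.range'_zero, List.append_nil, Nat.sub_self, List.append_assoc,
    List.append_cancel_left_eq]
  rw [show p + 1 - k = (p - k) + 1 by omega, List.range'_concat]
  simp; omega

theorem arcs_concat_first {i j : ℕ} (h : i ≤ j) :
    arcs i (j + 1) 0 0 0 0 = arcs i j 0 0 0 0 ++ [j] := by
  simp only [arcs, List.range'_zero, List.append_nil, Nat.sub_self]
  rw [show j + 1 - i = (j - i) + 1 by omega, List.range'_concat]
  simp; omega

theorem Prefix.first_two {i j k p q m : ℕ} (h : Prefix pt (arcs i j k p q m) s) :
    Prefix pt (arcs i j k p 0 0) s := by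
  have e : arcs i j k p q m = arcs i j k p 0 0 ++ List.range' q (m - q) := by simp [arcs]
  rw [e] at h
  exact h.of_append

theorem Prefix.first {i j k p : ℕ} (h : Prefix pt (arcs i j k p 0 0) s) :
    Prefix pt (arcs i j 0 0 0 0) s := by
  have e : arcs i j k p 0 0 = arcs i j 0 0 0 0 ++ List.range' k (p - k) := by simp [arcs]
  rw [e] at h
  exact h.of_append

theorem tables_setNat {a : ℕ} (s : Memory) (i j v : ℕ)
    (h : a ≠ 20 ∧ a ≠ 21 ∧ a ≠ 22 ∧ a ≠ 23 ∧ a ≠ 24) :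
    (s.setNat a i j v).tables = s.tables := by
  simp only [Memory.tables, Memory.setNat_real]
  rw [Memory.setNat_nat_ne _ _ _ _ h.1.symm, Memory.setNat_nat_ne _ _ _ _ h.2.1.symm,
    Memory.setNat_nat_ne _ _ _ _ h.2.2.1.symm, Memory.setNat_nat_ne _ _ _ _ h.2.2.2.1.symm,
    Memory.setNat_nat_ne _ _ _ _ h.2.2.2.2.symm]

theorem run_loopM {T₀ : DPTables} {D : ℕ → ℕ → ℕ → ℕ → ℕ → Prop} {j k p q : ℕ}
    (hc : DPContext W ε t pt n i e τ s) (hT : Enumerated W ε t pt i T₀ D s.tables)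
    (hL : Prefix pt (arcs i (j + 1) k p 0 0) s)
    (h12 : s.nat 12 0 0 = j) (h13 : s.nat 13 0 0 = k) (h14 : s.nat 14 0 0 = p)
    (h15 : s.nat 15 0 0 = q) (hj : i ≤ j) (hk : j + 1 ≤ k) (hp : k ≤ p) (hq : p ≤ q)
    (hqe : q ≤ e) :
    Run W Code.loopM s (32 * (n ^ 1 * τ)) fun s' => Prefix pt (arcs i (j + 1) k p 0 0) s' ∧
      Enumerated W ε t pt i T₀ (fun j' k' p' q' m' => D j' k' p' q' m' ∨
        (j' = j + 1 ∧ k' = k ∧ p' = p ∧ q' = q ∧ q ≤ m' ∧ m' ≤ e)) s'.tables := by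
  have hn := hc.n_pos
  have hτ := hc.one_le
  have hen := hc.e_le
  refine (Run.for_pow (n := n) (τ := τ) (k := 0) (B := 13) (l := q) (b := e + 1)
    (fun m s => Prefix pt (arcs i (j + 1) k p q m) s ∧
      Enumerated W ε t pt i T₀ (fun j' k' p' q' m' => D j' k' p' q' m' ∨
        (j' = j + 1 ∧ k' = k ∧ p' = p ∧ q' = q ∧ q ≤ m' ∧ m' < m)) s.tables) hn hτ
    (by simp [NatExp.eval, h15]) (by omega) (by omega) (by decide) ?_ ?_ ?_ ?_).imp ?_
  · intro s1 hf
    simp [NatExp.eval, hf.nat 11 (by decide), hc.e_eq]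
  · intro x s1 y h
    rw [tables_setNat _ _ _ _ (by decide)]
    exact ⟨h.1.congr rfl rfl, h.2⟩
  · refine ⟨?_, hT.mono fun j' k' p' q' m' h => ?_⟩
    · have e : arcs i (j + 1) k p q q = arcs i (j + 1) k p 0 0 := by simp [arcs]
      rwa [e]
    · rcases h with h | h
      · exact h
      · omega
  · intro m s1 hqm hme hf h16 ⟨hL1, hT1⟩
    have g12 := (congrFun₂ (hf.nat 12 (by decide)) 0 0).trans h12
    have g13 := (congrFun₂ (hf.nat 13 (by decide)) 0 0).trans h13
    have g14 := (congrFun₂ (hf.nat 14 (by decide)) 0 0).trans h14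
    have g15 := (congrFun₂ (hf.nat 15 (by decide)) 0 0).trans h15
    have hc1 := hc.frame hf
    refine Run.mono (B := (τ + 10) + 2) (Run.seq ?_) (by simp; omega) fun _ h => h
    refine (run_evaluate hc1 hT1 hL1 g12 g13 g14 g15 h16 hj hk hp hq hqm (by omega)).with_frame ?_
    intro s2 hf2 ⟨hL2, hT2⟩
    have hc2 := hc1.frame hf2
    have f12 := (congrFun₂ (hf2.nat 12 (by decide)) 0 0).trans g12
    have f13 := (congrFun₂ (hf2.nat 13 (by decide)) 0 0).trans g13
    have f14 := (congrFun₂ (hf2.nat 14 (by decide)) 0 0).trans g14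
    have f15 := (congrFun₂ (hf2.nat 15 (by decide)) 0 0).trans g15
    have f16 := (congrFun₂ (hf2.nat 16 (by decide)) 0 0).trans h16
    refine (hL2.run_push (x := m) (hc2.pts m) ?_ ?_ ?_ ?_).imp ?_
    · simp [NatExp.eval, length_arcs, f12, f13, f14, f15, f16, hc2.i_eq]
    · simp [NatExp.eval, f16]
    · intro v
      simp [NatExp.eval, length_arcs, f12, f13, f14, f15, f16, hc2.i_eq]
    · simp [NatExp.eval, f16]
    · rintro s3 ⟨hL3, ht3⟩
      rw [arcs_concat_third hqm, ht3]
      refine ⟨hL3, hT2.mono fun j' k' p' q' m' h => ?_⟩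
      rcases h with h | h
      · exact .inl (.inl h)
      · by_cases hmm : m' = m
        · exact .inr (by omega)
        · exact .inl (.inr (by omega))
  · rintro s1 ⟨⟨hL1, hT1⟩, -⟩
    exact ⟨hL1.first_two, hT1.mono fun j' k' p' q' m' h => h.imp id (by omega)⟩

theorem run_loopQ {T₀ : DPTables} {D : ℕ → ℕ → ℕ → ℕ → ℕ → Prop} {j k p : ℕ}
    (hc : DPContext W ε t pt n i e τ s) (hT : Enumerated W ε t pt i T₀ D s.tables)
    (hL : Prefix pt (arcs i (j + 1) k p 0 0) s)
    (h12 : s.nat 12 0 0 = j) (h13 : s.nat 13 0 0 = k) (h14 : s.nat 14 0 0 = p)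
    (hj : i ≤ j) (hk : j + 1 ≤ k) (hp : k ≤ p) (hpe : p ≤ e) :
    Run W Code.loopQ s (70 * (n ^ 2 * τ)) fun s' => Prefix pt (arcs i (j + 1) k p 0 0) s' ∧
      Enumerated W ε t pt i T₀ (fun j' k' p' q' m' => D j' k' p' q' m' ∨
        (j' = j + 1 ∧ k' = k ∧ p' = p ∧ p ≤ q' ∧ q' ≤ m' ∧ m' ≤ e)) s'.tables := by
  have hn := hc.n_pos
  have hτ := hc.one_le
  have hen := hc.e_le
  refine (Run.for_pow (n := n) (τ := τ) (k := 1) (B := 32) (l := p) (b := e + 1)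
    (fun q s => Prefix pt (arcs i (j + 1) k p 0 0) s ∧
      Enumerated W ε t pt i T₀ (fun j' k' p' q' m' => D j' k' p' q' m' ∨
        (j' = j + 1 ∧ k' = k ∧ p' = p ∧ p ≤ q' ∧ q' < q ∧ q' ≤ m' ∧ m' ≤ e)) s.tables) hn hτ
    (by simp [NatExp.eval, h14]) (by omega) (by omega) (by decide) ?_ ?_ ?_ ?_).imp ?_
  · intro s1 hf
    simp [NatExp.eval, hf.nat 11 (by decide), hc.e_eq]
  · intro x s1 y h
    rw [tables_setNat _ _ _ _ (by decide)]
    exact ⟨h.1.congr rfl rfl, h.2⟩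
  · exact ⟨hL, hT.mono fun j' k' p' q' m' h => h.elim id (by omega)⟩
  · intro q s1 hpq hqe hf h15 ⟨hL1, hT1⟩
    have g12 := (congrFun₂ (hf.nat 12 (by decide)) 0 0).trans h12
    have g13 := (congrFun₂ (hf.nat 13 (by decide)) 0 0).trans h13
    have g14 := (congrFun₂ (hf.nat 14 (by decide)) 0 0).trans h14
    refine (run_loopM (hc.frame hf) hT1 hL1 g12 g13 g14 h15 hj hk hp hpq (by omega)).imp ?_
    rintro s2 ⟨hL2, hT2⟩
    refine ⟨hL2, hT2.mono fun j' k' p' q' m' h => ?_⟩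
    rcases h with h | h
    · exact .inl (.inl h)
    · by_cases hqq : q' = q
      · exact .inr (by omega)
      · exact .inl (.inr (by omega))
  · rintro s1 ⟨⟨hL1, hT1⟩, -⟩
    exact ⟨hL1, hT1.mono fun j' k' p' q' m' h => h.imp id (by omega)⟩

theorem run_loopP {T₀ : DPTables} {D : ℕ → ℕ → ℕ → ℕ → ℕ → Prop} {j k : ℕ}
    (hc : DPContext W ε t pt n i e τ s) (hT : Enumerated W ε t pt i T₀ D s.tables)
    (hL : Prefix pt (arcs i (j + 1) 0 0 0 0) s)
    (h12 : s.nat 12 0 0 = j) (h13 : s.nat 13 0 0 = k)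
    (hj : i ≤ j) (hk : j + 1 ≤ k) (hke : k ≤ e) :
    Run W Code.loopP s (150 * (n ^ 3 * τ)) fun s' => Prefix pt (arcs i (j + 1) 0 0 0 0) s' ∧
      Enumerated W ε t pt i T₀ (fun j' k' p' q' m' => D j' k' p' q' m' ∨
        (j' = j + 1 ∧ k' = k ∧ k ≤ p' ∧ p' ≤ q' ∧ q' ≤ m' ∧ m' ≤ e)) s'.tables := by
  have hn := hc.n_pos
  have hτ := hc.one_le
  have hen := hc.e_le
  refine (Run.for_pow (n := n) (τ := τ) (k := 2) (B := 72) (l := k) (b := e + 1)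
    (fun p s => Prefix pt (arcs i (j + 1) k p 0 0) s ∧
      Enumerated W ε t pt i T₀ (fun j' k' p' q' m' => D j' k' p' q' m' ∨
        (j' = j + 1 ∧ k' = k ∧ k ≤ p' ∧ p' < p ∧ p' ≤ q' ∧ q' ≤ m' ∧ m' ≤ e)) s.tables) hn hτ
    (by simp [NatExp.eval, h13]) (by omega) (by omega) (by decide) ?_ ?_ ?_ ?_).imp ?_
  · intro s1 hf
    simp [NatExp.eval, hf.nat 11 (by decide), hc.e_eq]
  · intro x s1 y h
    rw [tables_setNat _ _ _ _ (by decide)]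
    exact ⟨h.1.congr rfl rfl, h.2⟩
  · refine ⟨?_, hT.mono fun j' k' p' q' m' h => h.elim id (by omega)⟩
    have e : arcs i (j + 1) k k 0 0 = arcs i (j + 1) 0 0 0 0 := by simp [arcs]
    rwa [e]
  · intro p s1 hkp hpe hf h14 ⟨hL1, hT1⟩
    have g12 := (congrFun₂ (hf.nat 12 (by decide)) 0 0).trans h12
    have g13 := (congrFun₂ (hf.nat 13 (by decide)) 0 0).trans h13
    have hc1 := hc.frame hf
    have hpos : 1 ≤ n ^ 2 * τ := Nat.one_le_iff_ne_zero.2 (by positivity)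
    refine Run.mono (B := 70 * (n ^ 2 * τ) + 2) (Run.seq ?_) (by omega) fun _ h => h
    refine (run_loopQ hc1 hT1 hL1 g12 g13 h14 hj hk hkp (by omega)).with_frame ?_
    intro s2 hf2 ⟨hL2, hT2⟩
    have hc2 := hc1.frame hf2
    have f12 := (congrFun₂ (hf2.nat 12 (by decide)) 0 0).trans g12
    have f13 := (congrFun₂ (hf2.nat 13 (by decide)) 0 0).trans g13
    have f14 := (congrFun₂ (hf2.nat 14 (by decide)) 0 0).trans h14
    refine (hL2.run_push (x := p) (hc2.pts p) ?_ ?_ ?_ ?_).imp ?_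
    · simp [NatExp.eval, length_arcs, f12, f13, f14, hc2.i_eq]
    · simp [NatExp.eval, f14]
    · intro v
      simp [NatExp.eval, length_arcs, f12, f13, f14, hc2.i_eq]
    · simp [NatExp.eval, f14]
    · rintro s3 ⟨hL3, ht3⟩
      rw [arcs_concat_second hkp, ht3]
      refine ⟨hL3, hT2.mono fun j' k' p' q' m' h => ?_⟩
      rcases h with h | h
      · exact .inl (.inl h)
      · by_cases hpp : p' = p
        · exact .inr (by omega)
        · exact .inl (.inr (by omega))
  · rintro s1 ⟨⟨hL1, hT1⟩, -⟩
    exact ⟨hL1.first, hT1.mono fun j' k' p' q' m' h => h.imp id (by omega)⟩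

theorem run_loopK {T₀ : DPTables} {D : ℕ → ℕ → ℕ → ℕ → ℕ → Prop} {j : ℕ}
    (hc : DPContext W ε t pt n i e τ s) (hT : Enumerated W ε t pt i T₀ D s.tables)
    (hL : Prefix pt (arcs i (j + 1) 0 0 0 0) s)
    (h12 : s.nat 12 0 0 = j) (hj : i ≤ j) (hje : j < e) :
    Run W Code.loopK s (306 * (n ^ 4 * τ)) fun s' => Prefix pt (arcs i (j + 1) 0 0 0 0) s' ∧
      Enumerated W ε t pt i T₀ (fun j' k' p' q' m' => D j' k' p' q' m' ∨
        (j' = j + 1 ∧ j' ≤ k' ∧ k' ≤ p' ∧ p' ≤ q' ∧ q' ≤ m' ∧ m' ≤ e)) s'.tables := by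
  have hn := hc.n_pos
  have hτ := hc.one_le
  have hen := hc.e_le
  refine (Run.for_pow (n := n) (τ := τ) (k := 3) (B := 150) (l := j + 1) (b := e + 1)
    (fun k s => Prefix pt (arcs i (j + 1) 0 0 0 0) s ∧
      Enumerated W ε t pt i T₀ (fun j' k' p' q' m' => D j' k' p' q' m' ∨
        (j' = j + 1 ∧ j' ≤ k' ∧ k' < k ∧ k' ≤ p' ∧ p' ≤ q' ∧ q' ≤ m' ∧ m' ≤ e)) s.tables) hn hτ
    (by simp [NatExp.eval, h12]) (by omega) (by omega) (by decide) ?_ ?_ ?_ ?_).imp ?_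
  · intro s1 hf
    simp [NatExp.eval, hf.nat 11 (by decide), hc.e_eq]
  · intro x s1 y h
    rw [tables_setNat _ _ _ _ (by decide)]
    exact ⟨h.1.congr rfl rfl, h.2⟩
  · exact ⟨hL, hT.mono fun j' k' p' q' m' h => h.elim id (by omega)⟩
  · intro k s1 hjk hke hf h13 ⟨hL1, hT1⟩
    have g12 := (congrFun₂ (hf.nat 12 (by decide)) 0 0).trans h12
    refine (run_loopP (hc.frame hf) hT1 hL1 g12 h13 hj hjk (by omega)).imp ?_
    rintro s2 ⟨hL2, hT2⟩
    refine ⟨hL2, hT2.mono fun j' k' p' q' m' h => ?_⟩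
    rcases h with h | h
    · exact .inl (.inl h)
    · by_cases hkk : k' = k
      · exact .inr (by omega)
      · exact .inl (.inr (by omega))
  · rintro s1 ⟨⟨hL1, hT1⟩, -⟩
    exact ⟨hL1, hT1.mono fun j' k' p' q' m' h => h.imp id (by omega)⟩

theorem run_loopJ {T₀ : DPTables} {D : ℕ → ℕ → ℕ → ℕ → ℕ → Prop}
    (hc : DPContext W ε t pt n i e τ s) (hT : Enumerated W ε t pt i T₀ D s.tables) :
    Run W Code.loopJ s (622 * (n ^ 5 * τ)) fun s' =>
      Enumerated W ε t pt i T₀ (fun j k p q m => i < j ∧ j ≤ k ∧ k ≤ p ∧ p ≤ q ∧ q ≤ m ∧ m ≤ e)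
        s'.tables := by
  have hn := hc.n_pos
  have hτ := hc.one_le
  have hen := hc.e_le
  have hie := hc.i_lt
  refine (Run.for_pow (n := n) (τ := τ) (k := 4) (B := 308) (l := i) (b := e)
    (fun j s => Prefix pt (arcs i j 0 0 0 0) s ∧
      Enumerated W ε t pt i T₀ (fun j' k' p' q' m' => i < j' ∧ j' ≤ j ∧ j' ≤ k' ∧ k' ≤ p' ∧
        p' ≤ q' ∧ q' ≤ m' ∧ m' ≤ e) s.tables) hn hτ
    (by simp [NatExp.eval, hc.i_eq]) (by omega) (by omega) (by decide) ?_ ?_ ?_ ?_).imp ?_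
  · intro s1 hf
    simp [NatExp.eval, hf.nat 11 (by decide), hc.e_eq]
  · intro x s1 y h
    rw [tables_setNat _ _ _ _ (by decide)]
    exact ⟨h.1.congr rfl rfl, h.2⟩
  · refine ⟨?_, hT.mono fun j' k' p' q' m' h => by omega⟩
    intro r hr
    simp [arcs] at hr
  · intro j s1 hij hje hf h12 ⟨hL1, hT1⟩
    have hc1 := hc.frame hf
    have hpos : 1 ≤ n ^ 4 * τ := Nat.one_le_iff_ne_zero.2 (by positivity)
    refine Run.mono (B := 2 + 306 * (n ^ 4 * τ)) (Run.seq ?_) (by omega) fun _ h => h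
    refine (hL1.run_push (x := j) (hc1.pts j) ?_ ?_ ?_ ?_).with_frame ?_
    · simp [NatExp.eval, length_arcs, h12, hc1.i_eq]
    · simp [NatExp.eval, h12]
    · intro v
      simp [NatExp.eval, length_arcs, h12, hc1.i_eq]
    · simp [NatExp.eval, h12]
    · rintro s2 hf2 ⟨hL2, ht2⟩
      have f12 := (congrFun₂ (hf2.nat 12 (by decide)) 0 0).trans h12
      rw [← arcs_concat_first hij] at hL2
      rw [← ht2] at hT1
      refine (run_loopK (hc1.frame hf2) hT1 hL2 f12 hij hje).imp ?_
      rintro s3 ⟨hL3, hT3⟩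
      refine ⟨hL3, hT3.mono fun j' k' p' q' m' h => ?_⟩
      by_cases hjj : j' = j + 1
      · exact .inr (by omega)
      · exact .inl (by omega)
  · rintro s1 ⟨⟨hL1, hT1⟩, -⟩
    exact hT1.mono fun j' k' p' q' m' h => by omega

/-- The state of the tables while the values of the intervals that begin at `i` are computed: `T₁` are
the tables at the beginning, and `D m l` holds if the end `m` of the first group has been considered
for the interval `[i, l)`. -/
structure Splitting (i : ℕ) (T₁ : DPTables) (D : ℕ → ℕ → Prop) (T : DPTables) : Prop where
  G_eq : T.G = T₁.G
  X_eq : T.X = T₁.X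
  Y_eq : T.Y = T₁.Y
  J_eq : T.J = T₁.J
  K_eq : T.K = T₁.K
  P_eq : T.P = T₁.P
  Q_eq : T.Q = T₁.Q
  F_eq : ∀ i', i' ≠ i → T.F i' = T₁.F i'
  M_eq : ∀ i', i' ≠ i → T.M i' = T₁.M i'
  F_diag : T.F i i = T₁.F i i
  stored : ∀ l, T.M i l ≠ 0 →
    i < T.M i l ∧ T.M i l ≤ l ∧ T.F i l = T₁.G i (T.M i l) + T₁.F (T.M i l) l
  done : ∀ m l, D m l → T.M i l ≠ 0 ∧ T.F i l ≤ T₁.G i m + T₁.F m l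

theorem Splitting.mono {T₁ T : DPTables} {D D' : ℕ → ℕ → Prop} (h : Splitting i T₁ D T)
    (hD : ∀ m l, D' m l → D m l) : Splitting i T₁ D' T :=
  { h with done := fun m l hd => h.done m l (hD _ _ hd) }

/-- An end of the first group is stored that is the first one considered, or at least as good as the
one stored before. -/
theorem Splitting.insert {T₁ T T' : DPTables} {D : ℕ → ℕ → Prop} {m l : ℕ}
    (h : Splitting i T₁ D T) (hm : i < m) (hl : m ≤ l)
    (hbetter : T.M i l = 0 ∨ T₁.G i m + T₁.F m l ≤ T.F i l)
    (hG : T'.G = T.G) (hX : T'.X = T.X) (hY : T'.Y = T.Y) (hJ : T'.J = T.J) (hK : T'.K = T.K)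
    (hP : T'.P = T.P) (hQ : T'.Q = T.Q)
    (hF : ∀ i' l', T'.F i' l' = if i' = i ∧ l' = l then T₁.G i m + T₁.F m l else T.F i' l')
    (hM : ∀ i' l', T'.M i' l' = if i' = i ∧ l' = l then m else T.M i' l') :
    Splitting i T₁ (fun m' l' => D m' l' ∨ (m' = m ∧ l' = l)) T' where
  G_eq := hG.trans h.G_eq
  X_eq := hX.trans h.X_eq
  Y_eq := hY.trans h.Y_eq
  J_eq := hJ.trans h.J_eq
  K_eq := hK.trans h.K_eq
  P_eq := hP.trans h.P_eq
  Q_eq := hQ.trans h.Q_eq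
  F_eq i' hi := by rw [← h.F_eq i' hi]; funext m'; simp [hF, hi]
  M_eq i' hi := by rw [← h.M_eq i' hi]; funext m'; simp [hM, hi]
  F_diag := by rw [hF, if_neg (by omega), h.F_diag]
  stored l' hl' := by
    by_cases hll : l' = l
    · subst hll
      simp only [hF, hM, and_self, if_true]
      exact ⟨hm, hl, trivial⟩
    · simp only [hF, hM, hll, and_false, if_false] at hl' ⊢
      exact h.stored l' hl'
  done m' l' hd := by
    by_cases hll : l' = l
    · subst hll
      simp only [hF, hM, and_self, if_true]
      refine ⟨by omega, ?_⟩
      rcases hd with hd | ⟨rfl, -⟩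
      · obtain ⟨h1, h2⟩ := h.done _ _ hd
        rcases hbetter with hb | hb
        · exact absurd hb h1
        · exact hb.trans h2
      · exact le_rfl
    · simp only [hF, hM, hll, and_false, if_false]
      rcases hd with hd | ⟨-, hd⟩
      · exact h.done _ _ hd
      · exact absurd hd hll

theorem run_split {T₁ : DPTables} (hc : DPContext W ε t pt n i e τ s)
    (hT : Splitting i T₁ (fun _ _ => False) s.tables) :
    Run W Code.split s (34 * (n ^ 2 * τ)) fun s' =>
      Splitting i T₁ (fun m l => i < m ∧ m ≤ l ∧ l ≤ e) s'.tables := by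
  have hn := hc.n_pos
  have hτ := hc.one_le
  have hen := hc.e_le
  have hie := hc.i_lt
  refine (Run.for_pow (n := n) (τ := τ) (k := 1) (B := 14) (l := i + 1) (b := e + 1)
    (fun l s => Splitting i T₁ (fun m' l' => i < m' ∧ m' ≤ l' ∧ l' < l) s.tables) hn hτ
    (by simp [NatExp.eval, hc.i_eq]) (by omega) (by omega) (by decide) ?_ ?_ ?_ ?_).imp ?_
  · intro s1 hf
    simp [NatExp.eval, hf.nat 11 (by decide), hc.e_eq]
  · intro x s1 y h
    rwa [tables_setNat _ _ _ _ (by decide)]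
  · exact hT.mono fun m' l' h => by omega
  swap
  · rintro s1 ⟨hT1, -⟩
    exact hT1.mono fun m' l' h => by omega
  intro l s1 hil hle hf h17 hT1
  have hc1 := hc.frame hf
  refine (Run.for_pow (n := n) (τ := τ) (k := 0) (B := 4) (l := i + 1) (b := l + 1)
    (fun m s => Splitting i T₁ (fun m' l' => i < m' ∧ m' ≤ l' ∧ (l' < l ∨ (l' = l ∧ m' < m)))
      s.tables) hn hτ
    (by simp [NatExp.eval, hc1.i_eq]) (by omega) (by omega) (by decide) ?_ ?_ ?_ ?_).imp ?_
  · intro s1 hf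
    simp [NatExp.eval, hf.nat 17 (by decide), h17]
  · intro x s1 y h
    rwa [tables_setNat _ _ _ _ (by decide)]
  · exact hT1.mono fun m' l' h => by omega
  swap
  · rintro s1 ⟨hT1, -⟩
    exact hT1.mono fun m' l' h => by omega
  intro m s2 him hml hf2 h16 hT2
  have h10 := (hc1.frame hf2).i_eq
  have f17 := (congrFun₂ (hf2.nat 17 (by decide)) 0 0).trans h17
  refine Run.mono (B := 1 + (2 + 1)) (Run.seq (Run.setReal ?_)) (by simp; omega) fun _ h => h
  have hGe : s2.real 16 = T₁.G := hT2.G_eq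
  have hFe : s2.real 15 m = T₁.F m := hT2.F_eq m (by omega)
  simp only [RealExp.eval, NatExp.eval, h10, h16, f17, hGe, hFe]
  obtain ⟨s3, hs3⟩ : ∃ s3, s3 = s2.setReal 19 0 0 (T₁.G i m + T₁.F m l) := ⟨_, rfl⟩
  rw [← hs3]
  have n3 : s3.nat = s2.nat := by rw [hs3]; rfl
  have r3 : ∀ a, a ≠ 19 → s3.real a = s2.real a := fun a ha => by
    rw [hs3, Memory.setReal_real_ne _ _ _ _ ha]
  have r19 : s3.real 19 0 0 = T₁.G i m + T₁.F m l := by rw [hs3, Memory.setReal_real_self]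
  have t3 : s3.tables = s2.tables := by
    simp only [Memory.tables, n3, r3 15 (by decide), r3 16 (by decide), r3 17 (by decide),
      r3 18 (by decide)]
  rw [← t3] at hT2
  rw [← n3] at h10 h16 f17
  clear hs3
  refine Run.ite (fun hb => (Run.skip (W := W) ?_).mono (by omega) fun _ h => h) (fun hb => ?_)
  · simp only [Test.Holds, NatExp.eval, RealExp.eval, h10, f17, r19] at hb
    refine { hT2 with done := fun m' l' hd => ?_ }
    by_cases hm' : m' = m ∧ l' = l
    · obtain ⟨rfl, rfl⟩ := hm'
      exact ⟨fun h => hb.1 (Nat.le_of_eq h), hb.2⟩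
    · exact hT2.done _ _ (by omega)
  · simp only [Test.Holds, NatExp.eval, RealExp.eval, h10, f17, r19] at hb
    have hb' : s3.tables.M i l = 0 ∨ T₁.G i m + T₁.F m l ≤ s3.tables.F i l := by
      by_cases h0 : s3.nat 24 i l ≤ 0
      · exact .inl (Nat.le_zero.1 h0)
      · exact .inr (le_of_lt (not_le.1 fun h => hb ⟨h0, h⟩))
    refine Run.mono (B := 1 + 1) (.seq (.setReal (.setNat ?_))) (by omega) fun _ h => h
    simp only [RealExp.eval, NatExp.eval, Memory.setReal_nat, h10, h16, f17, r19]
    refine (hT2.insert him (by omega) hb' ?_ ?_ ?_ ?_ ?_ ?_ ?_ ?_ ?_).mono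
      (D' := fun m' l' => i < m' ∧ m' ≤ l' ∧ (l' < l ∨ (l' = l ∧ m' < m + 1))) ?_
    all_goals first
      | (intro m' l' h; omega)
      | (funext a b; simp [Memory.tables, Memory.setNat_nat, Memory.setReal_real])
      | (intro i' m'; simp [Memory.tables, Memory.setNat_nat, Memory.setReal_real])

/-- One round of the dynamic program extends the correct part of the tables by one row. -/
theorem DPTables.Correct.extend {T₀ T₁ T : DPTables} (h : T₀.Correct W ε t pt n (i + 1))
    (hE : Enumerated W ε t pt i T₀
      (fun j k p q m => i < j ∧ j ≤ k ∧ k ≤ p ∧ p ≤ q ∧ q ≤ m ∧ m ≤ e) T₁)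
    (hS : Splitting i T₁ (fun m l => i < m ∧ m ≤ l ∧ l ≤ e) T)
    (he : ∀ m, m ≤ i + n → m ≤ n + n → m ≤ e) : T.Correct W ε t pt n i := by
  have hF : ∀ a, a ≠ i → T.F a = T₀.F a := fun a ha => by rw [hS.F_eq a ha, hE.F_eq]
  have hM : ∀ a, a ≠ i → T.M a = T₀.M a := fun a ha => by rw [hS.M_eq a ha, hE.M_eq]
  have hG : ∀ a, a ≠ i → T.G a = T₀.G a := fun a ha => by rw [hS.G_eq, hE.G_eq a ha]
  have hcand : ∀ i' j k p q m, i' ≥ i → i' < j → j ≤ k → k ≤ p →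
      candidate W ε t pt T.F i' j k p q m = candidate W ε t pt T₀.F i' j k p q m := by
    intro i' j k p q m h1 h2 h3 h4
    rw [candidate, candidate, hF j (by omega), hF p (by omega)]
  refine ⟨fun a => ?_, ?_, ?_, ?_, ?_, ?_⟩
  · by_cases ha : a = i
    · subst ha; rw [hS.F_diag, hE.F_eq, h.diag]
    · rw [hF a ha, h.diag]
  · intro a m h1 h2 h3 h4
    by_cases ha : a = i
    · subst ha
      refine (hE.stored m (hE.done m m m m m (by have := he m h3 h4; omega)).1).congr
        ?_ ?_ ?_ ?_ ?_ ?_ ?_ ?_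
      · intro x y hx
        rw [hS.F_eq x (by omega)]
      all_goals simp [hS.G_eq, hS.X_eq, hS.Y_eq, hS.J_eq, hS.K_eq, hS.P_eq, hS.Q_eq]
    · refine (h.stored a m (by omega) h2 h3 h4).congr ?_ ?_ ?_ ?_ ?_ ?_ ?_ ?_
      · intro x y hx
        rw [hF x (by omega)]
      · rw [hS.G_eq, hE.G_eq a ha]
      · rw [hS.X_eq, hE.X_eq a ha]
      · rw [hS.Y_eq, hE.Y_eq a ha]
      · rw [hS.J_eq, hE.J_eq a ha]
      · rw [hS.K_eq, hE.K_eq a ha]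
      · rw [hS.P_eq, hE.P_eq a ha]
      · rw [hS.Q_eq, hE.Q_eq a ha]
  · intro a j k p q m h1 h2 h3 h4 h5 h6 h7 h8
    rw [hcand a j k p q m h1 h2 h3 h4]
    by_cases ha : a = i
    · subst ha
      rw [hS.G_eq]
      exact (hE.done j k p q m ⟨h2, h3, h4, h5, h6, he m h7 h8⟩).2
    · rw [hG a ha]
      exact h.G_le a j k p q m (by omega) h2 h3 h4 h5 h6 h7 h8
  · intro a l h1 h2 h3 h4
    by_cases ha : a = i
    · subst ha
      have h5 := hS.stored l (hS.done l l ⟨h2, le_rfl, he l h3 h4⟩).1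
      exact ⟨h5.1, h5.2.1⟩
    · rw [hM a ha]
      exact h.M_mem a l (by omega) h2 h3 h4
  · intro a l h1 h2 h3 h4
    by_cases ha : a = i
    · subst ha
      have h5 := hS.stored l (hS.done l l ⟨h2, le_rfl, he l h3 h4⟩).1
      rw [h5.2.2, hS.G_eq, hS.F_eq _ (by omega)]
    · have h5 := h.M_mem a l (by omega) h2 h3 h4
      rw [hM a ha, hF a ha, hG a ha, hF _ (by omega)]
      exact h.F_eq a l (by omega) h2 h3 h4
  · intro a m l h1 h2 h3 h4 h5
    by_cases ha : a = i
    · subst ha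
      have h6 := (hS.done m l ⟨h2, h3, he l h4 h5⟩).2
      rwa [hS.G_eq, hS.F_eq m (by omega)]
    · rw [hF a ha, hG a ha, hF m (by omega)]
      exact h.F_le a m l (by omega) h2 h3 h4 h5

/-- The dynamic program fills the tables correctly. -/
theorem run_dp (hn : 0 < n) (hτ : 1 ≤ τ)
    (hsteps : ∀ A, A ≠ [] → A.length ≤ n → W.steps ε t A ≤ τ)
    (hε : s.real 4 0 0 = ε) (h2 : s.real 2 0 0 = t 0) (h3 : s.real 3 0 0 = t 1)
    (hpt : ∀ x, pt x = !₂[s.real 8 0 x, s.real 9 0 x])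
    (h0 : s.nat 0 0 0 = n) (hN : s.nat 3 0 0 = n + n)
    (hF : ∀ a b, s.real 15 a b = 0) (hJ : ∀ a b, s.nat 20 a b = 0)
    (hM : ∀ a b, s.nat 24 a b = 0) :
    Run W Code.dp s (1326 * (n ^ 6 * τ)) fun s' => s'.tables.Correct W ε t pt n 0 := by
  refine (Run.for_pow (n := n) (τ := τ) (k := 5) (B := 660) (l := 0) (b := n + n)
    (fun c s => s.tables.Correct W ε t pt n (n + n - c) ∧
      ∀ a b, a < n + n - c → s.tables.J a b = 0 ∧ s.tables.M a b = 0) hn hτ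
    (by simp [NatExp.eval]) (by omega) (by omega) (by decide) ?_ ?_ ?_ ?_).imp ?_
  · intro s1 hf
    simp [NatExp.eval, hf.nat 3 (by decide), hN]
  · intro x s1 y h
    rwa [tables_setNat _ _ _ _ (by decide)]
  · refine ⟨⟨fun a => hF a a, ?_, ?_, ?_, ?_, ?_⟩, fun a b _ => ⟨hJ a b, hM a b⟩⟩
    all_goals intros; omega
  swap
  · rintro s1 ⟨⟨h, -⟩, -⟩
    simpa using h
  rintro c s1 - hc hf h9 ⟨hT, hzero⟩
  obtain ⟨i, hi⟩ : ∃ i, i + 1 = n + n - c := ⟨n + n - c - 1, by omega⟩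
  rw [← hi] at hT hzero
  rw [show n + n - (c + 1) = i by omega]
  obtain ⟨e, he⟩ : ∃ e, e = n + n - (n + n - (i + n)) := ⟨_, rfl⟩
  have f3 : s1.nat 3 0 0 = n + n := by rw [hf.nat 3 (by decide), hN]
  have f0 : s1.nat 0 0 0 = n := by rw [hf.nat 0 (by decide), h0]
  have h1 : 1 ≤ n ^ 2 * τ := Nat.one_le_iff_ne_zero.2 (by positivity)
  have h25 : n ^ 2 * τ ≤ n ^ 5 * τ := by gcongr; all_goals omega
  refine Run.mono (B := 1 + (1 + (622 * (n ^ 5 * τ) + 34 * (n ^ 2 * τ))))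
    (.seq (.setNat (.seq (.setNat ?_)))) (by omega) fun _ h => h
  simp only [NatExp.eval, h9, f3]
  rw [show n + n - 1 - c = i by omega]
  simp only [Memory.setNat_nat, f0, f3]
  norm_num only [and_self, if_true, if_false, false_and]
  rw [← he]
  obtain ⟨s2, hs2⟩ : ∃ s2, s2 = (s1.setNat 10 0 0 i).setNat 11 0 0 e := ⟨_, rfl⟩
  rw [← hs2]
  have t2 : s2.tables = s1.tables := by
    rw [hs2, tables_setNat _ _ _ _ (by decide), tables_setNat _ _ _ _ (by decide)]
  have r2 : s2.real = s1.real := by rw [hs2]; rfl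
  have hc2 : DPContext W ε t pt n i e τ s2 := by
    refine ⟨hn, hτ, hsteps, ?_, ?_, ?_, fun x => ?_, ?_, ?_, by omega, by omega⟩
    · rw [r2, hf.real 4 (by decide), hε]
    · rw [r2, hf.real 2 (by decide), h2]
    · rw [r2, hf.real 3 (by decide), h3]
    · rw [r2, hf.real 8 (by decide), hf.real 9 (by decide), hpt]
    · simp [hs2, Memory.setNat_nat]
    · simp [hs2]
  have hE0 : Enumerated W ε t pt i s1.tables (fun _ _ _ _ _ => False) s2.tables := by
    rw [t2]
    refine ⟨rfl, rfl, ?_, ?_, ?_, ?_, ?_, ?_, ?_, ?_, fun _ _ _ _ _ h => h.elim⟩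
    iterate 7 exact fun _ _ => rfl
    exact fun m h => absurd (hzero i m (by omega)).1 h
  refine Run.seq ((run_loopJ hc2 hE0).with_frame ?_)
  intro s3 hf3 hE
  refine (run_split (T₁ := s3.tables) (hc2.frame hf3) ?_).imp ?_
  · refine ⟨rfl, rfl, rfl, rfl, rfl, rfl, rfl, fun _ _ => rfl, fun _ _ => rfl, rfl, ?_,
      fun _ _ h => h.elim⟩
    intro l h
    rw [hE.M_eq] at h
    exact absurd (hzero i l (by omega)).2 h
  · intro s4 hS
    refine ⟨hT.extend hE hS (by omega), fun a b ha => ?_⟩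
    rw [hS.J_eq, hE.J_eq a (by omega), hS.M_eq a (by omega), hE.M_eq]
    exact hzero a b (by omega)

end DynamicProgram

/-! ### The program for sorting the sources -/

namespace Code

/-- The squared distance of source number `j` from the first source. -/
abbrev sqDistFirst (j : NatExp) : RealExp :=
  .add (.mul (.sub (.at 0 j) (.at 0 (.const 0))) (.sub (.at 0 j) (.at 0 (.const 0))))
    (.mul (.sub (.at 1 j) (.at 1 (.const 0))) (.sub (.at 1 j) (.at 1 (.const 0))))

/-- Find a source that is farthest from the first one. -/
def findStart : Program :=
  .for 4 (.const 0) (.var 0)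
    (.ite (.realLe (sqDistFirst (.var 4)) (sqDistFirst (.var 6))) .skip (.assign 6 (.var 4)))

/-- A coordinate of source number `j` relative to the start. -/
abbrev rel (c : ℕ) (j : NatExp) : RealExp := .sub (.at c j) (.at c (.var 6))

/-- Sum the positions of all sources relative to the start. -/
def sums : Program :=
  .for 4 (.const 0) (.var 0)
    (.seq (.setReal 5 (.const 0) (.const 0) (.add (.at 5 (.const 0)) (rel 0 (.var 4))))
      (.setReal 6 (.const 0) (.const 0) (.add (.at 6 (.const 0)) (rel 1 (.var 4)))))

/-- A component of the key of source number `j`. -/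
abbrev key (c : ℕ) (j : NatExp) : RealExp := .get 7 (.const c) j

/-- Compute the keys by which the sources are sorted. -/
def keys : Program :=
  .for 4 (.const 0) (.var 0)
    (.seq (.setReal 7 (.const 3) (.var 4)
      (.add (.mul (rel 0 (.const 0)) (rel 0 (.var 4))) (.mul (rel 1 (.const 0)) (rel 1 (.var 4)))))
    (.seq (.setReal 7 (.const 0) (.var 4) (.div (key 3 (.var 4)) (key 3 (.var 4))))
    (.seq (.setReal 7 (.const 1) (.var 4)
      (.div (.sub (.mul (rel 0 (.const 0)) (rel 1 (.var 4)))
        (.mul (rel 1 (.const 0)) (rel 0 (.var 4)))) (key 3 (.var 4))))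
    (.setReal 7 (.const 2) (.var 4)
      (.sub (.mul (rel 0 (.var 4)) (.at 6 (.const 0))) (.mul (rel 1 (.var 4)) (.at 5 (.const 0))))))))

/-- Lexicographic comparison: `e < f`, or `e = f` and `b` holds. -/
abbrev lexLt (e f : RealExp) (b : Test) : Test :=
  .conj (.realLe e f) (.neg (.conj (.realLe f e) (.neg b)))

/-- The key of the source number `l` is less than that of the source number `j`. -/
abbrev before (l j : NatExp) : Test :=
  lexLt (key 0 l) (key 0 j) (lexLt (key 1 l) (key 1 j) (lexLt (key 2 l) (key 2 j)
    (lexLt (key 3 l) (key 3 j) (.natLe (.add l (.const 1)) j))))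

/-- Count the sources that come before source number `nat 4`. -/
def count : Program :=
  .for 5 (.const 0) (.var 0)
    (.ite (before (.var 5) (.var 4)) (.assign 7 (.add (.var 7) (.const 1))) .skip)

/-- Write source number `nat 4` to place `e` of the sorted list. -/
abbrev place (e : NatExp) : Program :=
  .seq (.setNat 8 (.const 0) e (.var 4))
    (.seq (.setReal 8 (.const 0) e (.at 0 (.var 4))) (.setReal 9 (.const 0) e (.at 1 (.var 4))))

/-- Sort the sources, and list them twice. -/
def sort : Program :=
  .for 4 (.const 0) (.var 0)
    (.seq (.assign 7 (.const 0))
    (.seq count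
    (.seq (place (.var 7)) (place (.add (.var 7) (.var 0))))))

/-- The part of the program that precedes the dynamic program. -/
def prepare : Program :=
  .seq (.assign 3 (.add (.var 0) (.var 0))) (.seq findStart (.seq sums (.seq keys sort)))

end Code

section Sorting

variable {W : WeberSolver} {n : ℕ} {S : Fin n → Plane} {r m : Fin n} {s : Memory}

theorem lexLt_holds {e f : RealExp} {b : Test} :
    (Code.lexLt e f b).Holds s ↔ e.eval s < f.eval s ∨ e.eval s = f.eval s ∧ b.Holds s := by
  simp only [Test.Holds, not_and, not_not]
  constructor
  · rintro ⟨h1, h2⟩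
    rcases h1.lt_or_eq with h | h
    · exact .inl h
    · exact .inr ⟨h, h2 h.ge⟩
  · rintro (h | ⟨h, h2⟩)
    · exact ⟨h.le, fun h' => absurd h' h.not_ge⟩
    · exact ⟨h.le, fun _ => h2⟩

/-- The coordinates of the `n` sources are stored in a memory. -/
structure Input (S : Fin n → Plane) (s : Memory) : Prop where
  n_eq : s.nat 0 0 0 = n
  x_eq : ∀ j : Fin n, s.real 0 0 j = S j 0
  y_eq : ∀ j : Fin n, s.real 1 0 j = S j 1

theorem Input.frame {s' : Memory} (h : Input S s) {A R : List ℕ} (hf : Frame A R s s')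
    (hA : 0 ∉ A := by decide) (hR : 0 ∉ R ∧ 1 ∉ R := by decide) : Input S s' where
  n_eq := by rw [hf.nat 0 hA, h.n_eq]
  x_eq := by rw [hf.real 0 hR.1]; exact h.x_eq
  y_eq := by rw [hf.real 1 hR.2]; exact h.y_eq

theorem run_findStart (hS : Input S s) (hr : (r : ℕ) = 0) (h6 : s.nat 6 0 0 = 0) :
    Run W Code.findStart s (10 * (n ^ 1 * 1)) fun s' => ∃ m : Fin n, s'.nat 6 0 0 = m ∧
      ∀ j, (S j 0 - S r 0) ^ 2 + (S j 1 - S r 1) ^ 2 ≤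
        (S m 0 - S r 0) ^ 2 + (S m 1 - S r 1) ^ 2 := by
  refine (Run.for_pow (n := n) (τ := 1) (k := 0) (B := 2) (l := 0) (b := n)
    (fun x s => ∃ m : Fin n, s.nat 6 0 0 = m ∧
      ∀ j : Fin n, (j : ℕ) < x → (S j 0 - S r 0) ^ 2 + (S j 1 - S r 1) ^ 2 ≤
        (S m 0 - S r 0) ^ 2 + (S m 1 - S r 1) ^ 2) r.pos le_rfl
    (by simp [NatExp.eval]) (by omega) (by omega) (by decide) ?_ ?_ ?_ ?_).imp ?_
  · intro s1 hf
    simpa [NatExp.eval] using (hS.frame hf).n_eq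
  · intro x s1 y h
    simpa [Memory.setNat_nat] using h
  · exact ⟨r, by omega, fun j hj => by omega⟩
  · rintro x s1 - hx hf h4 ⟨m, hm, hmax⟩
    have hS1 := hS.frame hf
    obtain ⟨j, rfl⟩ : ∃ j : Fin n, (j : ℕ) = x := ⟨⟨x, hx⟩, rfl⟩
    have hr0 := hS1.x_eq r
    have hr1 := hS1.y_eq r
    rw [hr] at hr0 hr1
    have test : (Test.realLe (Code.sqDistFirst (.var 4)) (Code.sqDistFirst (.var 6))).Holds s1 ↔
        (S j 0 - S r 0) ^ 2 + (S j 1 - S r 1) ^ 2 ≤ (S m 0 - S r 0) ^ 2 + (S m 1 - S r 1) ^ 2 := by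
      simp only [Test.Holds, RealExp.eval, NatExp.eval, h4, hm, hS1.x_eq, hS1.y_eq, hr0, hr1, sq]
    refine (Run.ite (B := 1) (fun hb => Run.skip ⟨m, hm, fun i hi => ?_⟩)
      fun hb => Run.setNat ⟨j, ?_, fun i hi => ?_⟩).mono (by simp) fun _ h => h
    · rcases Nat.lt_succ_iff_lt_or_eq.1 hi with h | h
      · exact hmax i h
      · rw [Fin.ext h]; exact test.1 hb
    · simp [NatExp.eval, h4]
    · rw [test, not_le] at hb
      rcases Nat.lt_succ_iff_lt_or_eq.1 hi with h | h
      · exact (hmax i h).trans hb.le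
      · rw [Fin.ext h]
  · rintro s1 ⟨⟨m, hm, hmax⟩, -⟩
    exact ⟨m, hm, fun j => hmax j j.isLt⟩

theorem run_sums (hS : Input S s) (h6 : s.nat 6 0 0 = m) (h50 : s.real 5 0 0 = 0)
    (h60 : s.real 6 0 0 = 0) :
    Run W Code.sums s (10 * (n ^ 1 * 1)) fun s' => s'.real 5 0 0 = ∑ l, (S l 0 - S m 0) ∧
      s'.real 6 0 0 = ∑ l, (S l 1 - S m 1) := by
  refine (Run.for_pow (n := n) (τ := 1) (k := 0) (B := 2) (l := 0) (b := n)
    (fun x s' => s'.real 5 0 0 = ∑ l ∈ Finset.range x, (s.real 0 0 l - S m 0) ∧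
      s'.real 6 0 0 = ∑ l ∈ Finset.range x, (s.real 1 0 l - S m 1)) m.pos le_rfl
    (by simp [NatExp.eval]) (by omega) (by omega) (by decide) ?_ ?_ ?_ ?_).imp ?_
  · intro s1 hf
    simpa [NatExp.eval] using (hS.frame hf).n_eq
  · intro x s1 y h
    simpa using h
  · simp [h50, h60]
  · rintro x s1 - hx hf h4 ⟨h5, h6'⟩
    have hS1 := hS.frame hf
    have f6 := (congrFun₂ (hf.nat 6 (by decide)) 0 0).trans h6
    refine (Run.seq (B := 1) (B' := 1) (Run.setReal (Run.setReal ?_))).mono (by simp) fun _ h => h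
    simp only [RealExp.eval, NatExp.eval, Memory.setReal_nat, Memory.setReal_real, h4, f6]
    norm_num only [and_self, if_true, if_false, false_and]
    rw [hS1.x_eq, hS1.y_eq, h5, h6', Finset.sum_range_succ, Finset.sum_range_succ,
      hf.real 0 (by decide), hf.real 1 (by decide)]
    exact ⟨rfl, rfl⟩
  · rintro s1 ⟨⟨h1, h2⟩, -⟩
    rw [h1, h2, Finset.sum_range, Finset.sum_range]
    simp only [hS.x_eq, hS.y_eq, and_self]

/-- The components of the sorting keys are stored in a memory. -/
structure Keys (S : Fin n → Plane) (r m j : Fin n) (s : Memory) : Prop where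
  key0 : s.real 7 0 j = keyD S r m j / keyD S r m j
  key1 : s.real 7 1 j = orient (S m) (S r) (S j) / keyD S r m j
  key2 : s.real 7 2 j = keyE S m j
  key3 : s.real 7 3 j = keyD S r m j

theorem Keys.before_holds (h : ∀ j, Keys S r m j s) {l j : Fin n} {a b : NatExp}
    (ha : a.eval s = l) (hb : b.eval s = j) :
    (Code.before a b).Holds s ↔ tourKey S r m l < tourKey S r m j := by
  rw [tourKey_lt_iff, lexLt_holds, lexLt_holds, lexLt_holds, lexLt_holds]
  simp only [RealExp.eval, NatExp.eval, Test.Holds, ha, hb, (h _).key0, (h _).key1, (h _).key2,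
    (h _).key3, Nat.succ_le_iff]

theorem keyE_eq (j : Fin n) : keyE S m j =
    (S j 0 - S m 0) * ∑ l, (S l 1 - S m 1) - (S j 1 - S m 1) * ∑ l, (S l 0 - S m 0) := by
  rw [Finset.mul_sum, Finset.mul_sum, ← Finset.sum_sub_distrib]
  rfl

theorem run_keys (hS : Input S s) (hr : (r : ℕ) = 0) (h6 : s.nat 6 0 0 = m)
    (h50 : s.real 5 0 0 = ∑ l, (S l 0 - S m 0)) (h60 : s.real 6 0 0 = ∑ l, (S l 1 - S m 1)) :
    Run W Code.keys s (14 * (n ^ 1 * 1)) fun s' => ∀ j, Keys S r m j s' := by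
  refine (Run.for_pow (n := n) (τ := 1) (k := 0) (B := 4) (l := 0) (b := n)
    (fun x s' => ∀ j : Fin n, (j : ℕ) < x → Keys S r m j s') m.pos le_rfl
    (by simp [NatExp.eval]) (by omega) (by omega) (by decide) ?_ ?_ ?_ ?_).imp ?_
  · intro s1 hf
    simpa [NatExp.eval] using (hS.frame hf).n_eq
  · intro x s1 y h j hj
    exact ⟨(h j hj).key0, (h j hj).key1, (h j hj).key2, (h j hj).key3⟩
  · intro j hj
    omega
  · rintro x s1 - hx hf h4 hK
    have hS1 := hS.frame hf
    have f6 := (congrFun₂ (hf.nat 6 (by decide)) 0 0).trans h6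
    have f50 := (congrFun₂ (hf.real 5 (by decide)) 0 0).trans h50
    have f60 := (congrFun₂ (hf.real 6 (by decide)) 0 0).trans h60
    obtain ⟨i, rfl⟩ : ∃ j : Fin n, (j : ℕ) = x := ⟨⟨x, hx⟩, rfl⟩
    have hr0 := hS1.x_eq r
    have hr1 := hS1.y_eq r
    rw [hr] at hr0 hr1
    refine (Run.seq (B := 1) (B' := 1 + (1 + 1)) (Run.setReal (Run.seq (Run.setReal
      (Run.seq (Run.setReal (Run.setReal ?_))))))).mono (by simp) fun _ h => h
    simp only [RealExp.eval, NatExp.eval, Memory.setReal_nat, Memory.setReal_real, h4, f6]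
    norm_num only [and_self, if_true, if_false, false_and, and_false, true_and]
    simp only [hr0, hr1, hS1.x_eq, hS1.y_eq, f50, f60]
    intro j hj
    by_cases hji : j = i
    · subst hji
      constructor
      · simp [Memory.setReal_real, keyD]
      · simp [Memory.setReal_real, keyD, orient]
      · simp [keyE_eq]
      · simp [Memory.setReal_real, keyD]
    · have hne : (j : ℕ) ≠ i := fun h => hji (Fin.ext h)
      have hk := hK j (by omega)
      constructor
      · simp [Memory.setReal_real, hne, hk.key0]
      · simp [Memory.setReal_real, hne, hk.key1]
      · simp [Memory.setReal_real, hne, hk.key2]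
      · simp [Memory.setReal_real, hne, hk.key3]
  · rintro s1 ⟨h, -⟩ j
    exact h j j.isLt

theorem run_count (hn : s.nat 0 0 0 = n) (hK : ∀ j, Keys S r m j s) {j : Fin n}
    (h4 : s.nat 4 0 0 = j) (h7 : s.nat 7 0 0 = 0) :
    Run W Code.count s (10 * (n ^ 1 * 1)) fun s' => s'.nat 7 0 0 = tourRank S r m j := by
  classical
  refine (Run.for_pow (n := n) (τ := 1) (k := 0) (B := 2) (l := 0) (b := n)
    (fun x s' => s'.nat 7 0 0 = (Finset.univ.filter fun i : Fin n =>
      (i : ℕ) < x ∧ tourKey S r m i < tourKey S r m j).card) j.pos le_rfl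
    (by simp [NatExp.eval]) (by omega) (by omega) (by decide) ?_ ?_ ?_ ?_).imp ?_
  · intro s1 hf
    simp [NatExp.eval, hf.nat 0 (by decide), hn]
  · intro x s1 y h
    simpa [Memory.setNat_nat] using h
  · simp [h7]
  · rintro x s1 - hx hf h5 h7
    have hK1 : ∀ j, Keys S r m j s1 := fun j => by
      have e := hf.real 7 (by decide)
      exact ⟨e ▸ (hK j).key0, e ▸ (hK j).key1, e ▸ (hK j).key2, e ▸ (hK j).key3⟩
    have f4 := (congrFun₂ (hf.nat 4 (by decide)) 0 0).trans h4
    obtain ⟨i, rfl⟩ : ∃ j : Fin n, (j : ℕ) = x := ⟨⟨x, hx⟩, rfl⟩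
    have test := Keys.before_holds hK1 (a := .var 5) (b := .var 4) (l := i) (j := j)
      (by simp [NatExp.eval, h5]) (by simp [NatExp.eval, f4])
    refine (Run.ite (B := 1) (fun hb => Run.setNat ?_) fun hb => Run.skip ?_).mono (by simp)
      fun _ h => h
    · rw [test] at hb
      simp only [NatExp.eval, Memory.setNat_nat_self, h7]
      rw [← Finset.card_insert_of_notMem (a := i) (by simp)]
      congr 1
      ext l
      simp only [Finset.mem_filter, Finset.mem_univ, true_and, Finset.mem_insert,
        Nat.lt_succ_iff_lt_or_eq, Fin.val_inj]
      constructor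
      · rintro (rfl | ⟨h, h'⟩)
        · exact ⟨.inr rfl, hb⟩
        · exact ⟨.inl h, h'⟩
      · rintro ⟨h | rfl, h'⟩
        · exact .inr ⟨h, h'⟩
        · exact .inl rfl
    · rw [test] at hb
      rw [h7]
      congr 1
      ext l
      simp only [Finset.mem_filter, Finset.mem_univ, true_and, Nat.lt_succ_iff_lt_or_eq,
        Fin.val_inj]
      constructor
      · exact fun h => ⟨.inl h.1, h.2⟩
      · rintro ⟨h | rfl, h'⟩
        · exact ⟨h, h'⟩
        · exact absurd h' hb
  · rintro s1 ⟨h, -⟩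
    rw [h, tourRank]
    congr 1
    ext l
    simp

/-- The sorted list contains source `j` at place `y`. -/
structure Placed (S : Fin n → Plane) (j : Fin n) (y : ℕ) (s : Memory) : Prop where
  perm : s.nat 8 0 y = j
  x_eq : s.real 8 0 y = S j 0
  y_eq : s.real 9 0 y = S j 1

theorem run_place {j : Fin n} {y : ℕ} {e : NatExp} (hS : Input S s) (h4 : s.nat 4 0 0 = j)
    (he : ∀ s', Frame [8] [8, 9] s s' → e.eval s' = y) :
    Run W (Code.place e) s 3 fun s' => Placed S j y s' ∧
      ∀ i y', y' ≠ y → Placed S i y' s → Placed S i y' s' := by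
  have hf1 : Frame [8] [8, 9] s (s.setNat 8 0 y j) :=
    ⟨fun a ha => Memory.setNat_nat_ne _ _ _ _ (by simpa using ha), fun _ _ => rfl⟩
  have hf2 : Frame [8] [8, 9] s ((s.setNat 8 0 y j).setReal 8 0 y (S j 0)) :=
    hf1.trans ⟨fun _ _ => rfl, fun a ha => Memory.setReal_real_ne _ _ _ _
      (by simp at ha; exact ha.1)⟩
  refine (Run.seq (B := 1) (B' := 1 + 1) (Run.setNat (Run.seq (Run.setReal (Run.setReal ?_)))))
  have e0 := he s (Frame.refl _ _ _)
  have e1 := he _ hf1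
  have e2 := he _ hf2
  have x4 : (s.setNat 8 0 y j).nat 4 0 0 = j := by simp [Memory.setNat_nat, h4]
  simp only [RealExp.eval, NatExp.eval, e0, h4, e1, x4, Memory.setNat_real, hS.x_eq, e2,
    Memory.setReal_nat]
  rw [Memory.setReal_real_ne _ _ _ _ (by decide), Memory.setNat_real, hS.y_eq]
  refine ⟨⟨?_, ?_, ?_⟩, fun i y' hy h => ⟨?_, ?_, ?_⟩⟩
  · simp
  · simp [Memory.setReal_real]
  · simp
  · simp [Memory.setNat_nat, hy, h.perm]
  · simp [Memory.setReal_real, hy, h.x_eq]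
  · simp [Memory.setReal_real, hy, h.y_eq]

theorem run_sort (hS : Input S s) (hK : ∀ j, Keys S r m j s) :
    Run W Code.sort s (40 * (n ^ 2 * 1)) fun s' =>
      ∀ y < n + n, Placed S (tourAt S r m y) y s' := by
  refine (Run.for_pow (n := n) (τ := 1) (k := 1) (B := 17) (l := 0) (b := n)
    (fun x s' => ∀ j : Fin n, (j : ℕ) < x →
      Placed S j (tourRank S r m j) s' ∧ Placed S j (tourRank S r m j + n) s') m.pos le_rfl
    (by simp [NatExp.eval]) (by omega) (by omega) (by decide) ?_ ?_ ?_ ?_).imp ?_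
  · intro s1 hf
    simpa [NatExp.eval] using (hS.frame hf).n_eq
  · intro x s1 y h j hj
    obtain ⟨h1, h2⟩ := h j hj
    refine ⟨⟨?_, h1.x_eq, h1.y_eq⟩, ⟨?_, h2.x_eq, h2.y_eq⟩⟩
    · rw [Memory.setNat_nat_ne _ _ _ _ (by decide)]; exact h1.perm
    · rw [Memory.setNat_nat_ne _ _ _ _ (by decide)]; exact h2.perm
  · intro j hj
    omega
  · rintro x s1 - hx hf h4 hP
    obtain ⟨i, rfl⟩ : ∃ j : Fin n, (j : ℕ) = x := ⟨⟨x, hx⟩, rfl⟩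
    have hn : 0 < n := m.pos
    have hS1 := hS.frame hf
    have hK1 : ∀ j, Keys S r m j s1 := fun j => by
      have e := hf.real 7 (by decide)
      exact ⟨e ▸ (hK j).key0, e ▸ (hK j).key1, e ▸ (hK j).key2, e ▸ (hK j).key3⟩
    refine (Run.seq (B := 1) (B' := 10 * (n ^ 1 * 1) + (3 + 3)) (Run.setNat (Run.seq ?_))).mono
      (by simp; omega) fun _ h => h
    simp only [NatExp.eval]
    refine (run_count (S := S) (r := r) (m := m) (j := i) ?_ ?_ ?_ ?_).with_frame ?_
    · simp [Memory.setNat_nat, hS1.n_eq]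
    · exact fun j => ⟨(hK1 j).key0, (hK1 j).key1, (hK1 j).key2, (hK1 j).key3⟩
    · simp [Memory.setNat_nat, h4]
    · simp
    intro s2 hf2 h7
    have hf12 : Frame [4, 5, 7] [] s1 s2 :=
      Frame.trans (s' := s1.setNat 7 0 0 0) ⟨fun a ha => Memory.setNat_nat_ne _ _ _ _ (by
        simp at ha; exact ha.2.2), fun _ _ => rfl⟩ (hf2.mono (by decide) (by decide))
    have hS2 := hS1.frame hf12
    have g4 : s2.nat 4 0 0 = i := by
      rw [hf2.nat 4 (by decide), Memory.setNat_nat_ne _ _ _ _ (by decide), h4]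
    have hP2 : ∀ j y, Placed S j y s1 → Placed S j y s2 := fun j y h =>
      ⟨by rw [hf12.nat 8 (by decide), h.perm], by rw [hf12.real 8 (by decide), h.x_eq],
        by rw [hf12.real 9 (by decide), h.y_eq]⟩
    refine Run.seq ((run_place (y := tourRank S r m i) hS2 g4 ?_).with_frame ?_)
    · intro s' hf'
      simp [NatExp.eval, hf'.nat 7 (by decide), h7]
    intro s3 hf3 ⟨p3, q3⟩
    refine (run_place (j := i) (y := tourRank S r m i + n) (hS2.frame hf3) ?_ ?_).imp ?_
    · rw [hf3.nat 4 (by simp [Program.natMods]), g4]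
    · intro s' hf'
      simp [NatExp.eval, hf'.nat 7 (by decide), hf3.nat 7 (by simp [Program.natMods]), h7,
        hf'.nat 0 (by decide), hf3.nat 0 (by simp [Program.natMods]), hS2.n_eq]
    rintro s4 ⟨p4, q4⟩ j hj
    by_cases hji : j = i
    · subst hji
      exact ⟨q4 _ _ (by omega) p3, p4⟩
    · have hne : (j : ℕ) ≠ i := fun h => hji (Fin.ext h)
      have hrk : tourRank S r m j ≠ tourRank S r m i := fun h =>
        hji (tourRank_injective S r m h)
      have b1 := tourRank_lt S r m j
      have b2 := tourRank_lt S r m i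
      obtain ⟨h1, h2⟩ := hP j (by omega)
      exact ⟨q4 _ _ (by omega) (q3 _ _ hrk (hP2 _ _ h1)),
        q4 _ _ (by omega) (q3 _ _ (by omega) (hP2 _ _ h2))⟩
  · rintro s1 ⟨h, -⟩ y hy
    obtain ⟨h1, h2⟩ := h (tourAt S r m y) (Fin.isLt _)
    rw [tourRank_tourAt] at h1 h2
    by_cases hyn : y < n
    · rwa [Nat.mod_eq_of_lt hyn] at h1
    · rw [Nat.mod_eq_sub_mod (by omega), Nat.mod_eq_of_lt (by omega),
        Nat.sub_add_cancel (by omega)] at h2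
      exact h2

theorem run_prepare (hS : Input S s) (hr : (r : ℕ) = 0) (h6 : s.nat 6 0 0 = 0)
    (h50 : s.real 5 0 0 = 0) (h60 : s.real 6 0 0 = 0) :
    Run W Code.prepare s (75 * (n ^ 2 * 1)) fun s' => s'.nat 3 0 0 = n + n ∧ ∃ m : Fin n,
      (∀ j, (S j 0 - S r 0) ^ 2 + (S j 1 - S r 1) ^ 2 ≤
        (S m 0 - S r 0) ^ 2 + (S m 1 - S r 1) ^ 2) ∧
      ∀ y < n + n, Placed S (tourAt S r m y) y s' := by
  have hn : 0 < n := r.pos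
  have h1 : n ^ 1 ≤ n ^ 2 := Nat.pow_le_pow_right hn (by omega)
  have h2 : 1 ≤ n ^ 2 := Nat.one_le_iff_ne_zero.2 (by positivity)
  refine Run.mono (B := 1 + (10 * (n ^ 1 * 1) + (10 * (n ^ 1 * 1) + (14 * (n ^ 1 * 1) +
    40 * (n ^ 2 * 1))))) (Run.seq (Run.setNat (Run.seq ?_))) (by omega) fun _ h => h
  simp only [NatExp.eval, hS.n_eq]
  obtain ⟨s0, hs0⟩ : ∃ s0, s0 = s.setNat 3 0 0 (n + n) := ⟨_, rfl⟩
  rw [← hs0]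
  have hf0 : Frame [3] [] s s0 := by
    rw [hs0]
    exact ⟨fun a ha => Memory.setNat_nat_ne _ _ _ _ (by simpa using ha), fun _ _ => rfl⟩
  have g3 : s0.nat 3 0 0 = n + n := by simp [hs0]
  have hS0 := hS.frame hf0
  refine (run_findStart hS0 hr (by rw [hf0.nat 6 (by decide), h6])).with_frame ?_
  rintro s1 hf1 ⟨m, hm, hfar⟩
  have hS1 := hS0.frame hf1
  refine Run.seq ((run_sums hS1 hm ?_ ?_).with_frame ?_)
  · rw [hf1.real 5 (by decide), hf0.real 5 (by decide), h50]
  · rw [hf1.real 6 (by decide), hf0.real 6 (by decide), h60]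
  rintro s2 hf2 ⟨e1, e2⟩
  have hS2 := hS1.frame hf2
  refine Run.seq ((run_keys hS2 hr (by rw [hf2.nat 6 (by decide), hm]) e1 e2).with_frame ?_)
  rintro s3 hf3 hK
  refine (run_sort (hS2.frame hf3) hK).with_frame ?_
  rintro s4 hf4 hP
  refine ⟨?_, m, hfar, hP⟩
  rw [hf4.nat 3 (by decide), hf3.nat 3 (by decide), hf2.nat 3 (by decide), hf1.nat 3 (by decide), g3]

end Sorting

/-! ### The program for the output -/

namespace Code

/-- Choose the best window of `n` positions. -/
def choose : Program :=
  .for 26 (.const 0) (.var 0)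
    (.ite (.realLe (.get 15 (.var 25) (.add (.var 25) (.var 0)))
      (.get 15 (.var 26) (.add (.var 26) (.var 0)))) .skip (.assign 25 (.var 26)))

/-- One step of the search for the group of a position, in the sense of `DPTables.step`. -/
def step : Program :=
  .seq (.assign 32 (.get 24 (.var 27) (.var 28)))
  (.ite (.natLe (.var 32) (.var 26)) (.assign 27 (.var 32))
  (.ite (.natLe (.add (.var 26) (.const 1)) (.get 20 (.var 27) (.var 32))) .skip
  (.ite (.natLe (.add (.var 26) (.const 1)) (.get 21 (.var 27) (.var 32)))
    (.seq (.assign 28 (.get 21 (.var 27) (.var 32))) (.assign 27 (.get 20 (.var 27) (.var 32))))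
  (.ite (.natLe (.add (.var 26) (.const 1)) (.get 22 (.var 27) (.var 32))) .skip
  (.ite (.natLe (.add (.var 26) (.const 1)) (.get 23 (.var 27) (.var 32)))
    (.seq (.assign 28 (.get 23 (.var 27) (.var 32))) (.assign 27 (.get 22 (.var 27) (.var 32))))
    .skip)))))

/-- The search for the group of a position. -/
def search : Program :=
  .seq (.assign 27 (.var 25))
    (.seq (.assign 28 (.add (.var 25) (.var 0))) (.for 29 (.const 0) (.var 0) step))

/-- Create a Steiner vertex if the present position is the first one of its group. The first position
of the group is at most the present one, so a single comparison suffices. -/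
def create : Program :=
  .ite (.natLe (.var 26) (.var 27))
    (.seq (.setNat 30 (.const 0) (.var 26) (.var 31))
    (.seq (.setReal 0 (.const 0) (.var 31) (.get 17 (.var 27) (.get 24 (.var 27) (.var 28))))
    (.seq (.setReal 1 (.const 0) (.var 31) (.get 18 (.var 27) (.get 24 (.var 27) (.var 28))))
    (.assign 31 (.add (.var 31) (.const 1)))))) .skip

/-- Write the output. The code of Steiner vertex number `x` as a parent is `x + 1`, since there is one
sink; the parent of every Steiner vertex is the sink with code `0`, the initial value in the memory. -/
def write : Program :=
  .seq
    (.for 26 (.var 25) (.add (.var 25) (.var 0))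
      (.seq search (.seq create
        (.setNat 1 (.const 0) (.get 8 (.const 0) (.var 26))
          (.add (.get 30 (.const 0) (.var 27)) (.const 1))))))
    (.assign 0 (.var 31))

end Code

section Output

variable {W : WeberSolver} {n a x : ℕ} {s : Memory} {T : DPTables}

theorem run_choose (hn : 0 < n) (h0 : s.nat 0 0 0 = n) (h25 : s.nat 25 0 0 = 0) :
    Run W Code.choose s (10 * (n ^ 1 * 1)) fun s' => s'.nat 25 0 0 < n ∧
      ∀ x < n, s.real 15 (s'.nat 25 0 0) (s'.nat 25 0 0 + n) ≤ s.real 15 x (x + n) := by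
  refine (Run.for_pow (n := n) (τ := 1) (k := 0) (B := 2) (l := 0) (b := n)
    (fun x s' => s'.nat 25 0 0 < n ∧
      ∀ y < x, s.real 15 (s'.nat 25 0 0) (s'.nat 25 0 0 + n) ≤ s.real 15 y (y + n)) hn le_rfl
    (by simp [NatExp.eval]) (by omega) (by omega) (by decide) ?_ ?_ ?_ ?_).imp ?_
  · intro s1 hf
    simp [NatExp.eval, hf.nat 0 (by decide), h0]
  · intro x s1 y h
    simpa [Memory.setNat_nat] using h
  · simp [h25, hn]
  · rintro x s1 - hx hf h26 ⟨hlt, hmin⟩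
    have f0 := (congrFun₂ (hf.nat 0 (by decide)) 0 0).trans h0
    have f15 := hf.real 15 (by decide)
    refine (Run.ite (B := 1) (fun hb => Run.skip ⟨hlt, fun y hy => ?_⟩)
      fun hb => Run.setNat ?_).mono (by simp) fun _ h => h
    · simp only [Test.Holds, RealExp.eval, NatExp.eval, f0, f15, h26, not_le] at hb
      simp only [NatExp.eval, h26, Memory.setNat_nat_self]
      refine ⟨hx, fun y hy => ?_⟩
      rcases Nat.lt_succ_iff_lt_or_eq.1 hy with h | rfl
      · exact hb.le.trans (hmin y h)
      · exact le_rfl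
    · simp only [Test.Holds, RealExp.eval, NatExp.eval, f0, f15, h26] at hb
      rcases Nat.lt_succ_iff_lt_or_eq.1 hy with h | rfl
      · exact hmin y h
      · exact hb
  · rintro s1 ⟨h, -⟩
    exact h

theorem run_step {ab : ℕ × ℕ} (hT : s.tables = T) (h26 : s.nat 26 0 0 = x)
    (h27 : s.nat 27 0 0 = ab.1) (h28 : s.nat 28 0 0 = ab.2) :
    Run W Code.step s 8 fun s' => s'.nat 27 0 0 = (T.step x ab).1 ∧
      s'.nat 28 0 0 = (T.step x ab).2 := by
  subst hT
  refine Run.seq (B := 1) (B' := 7) (Run.setNat ?_)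
  have hM : s.nat 24 = s.tables.M := rfl
  simp only [NatExp.eval, h27, h28, hM]
  generalize hm : s.tables.M ab.1 ab.2 = m
  obtain ⟨s1, hs1⟩ : ∃ s1, s1 = s.setNat 32 0 0 m := ⟨_, rfl⟩
  rw [← hs1]
  have h32 : s1.nat 32 0 0 = m := by simp [hs1]
  have ne : ∀ a, a ≠ 32 → s1.nat a = s.nat a := fun a ha => by
    rw [hs1, Memory.setNat_nat_ne _ _ _ _ ha]
  rw [← ne 26 (by decide)] at h26
  rw [← ne 27 (by decide)] at h27
  rw [← ne 28 (by decide)] at h28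
  have hJ : s1.nat 20 = s.tables.J := ne 20 (by decide)
  have hK : s1.nat 21 = s.tables.K := ne 21 (by decide)
  have hP : s1.nat 22 = s.tables.P := ne 22 (by decide)
  have hQ : s1.nat 23 = s.tables.Q := ne 23 (by decide)
  have skip : ∀ {Q : Memory → Prop} (B : ℕ), 1 ≤ B → Q s1 → Run W .skip s1 B Q :=
    fun B hB h => (Run.skip h).mono hB fun _ h => h
  refine Run.ite (B := 6) (fun hb => (Run.setNat ?_).mono (by omega) fun _ h => h) fun hb =>
    Run.ite (B := 5) (fun hb1 => skip _ (by omega) ?_) fun hb1 =>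
    Run.ite (B := 4) (fun hb2 => (Run.seq (B := 1) (B' := 1) (Run.setNat (Run.setNat ?_))).mono
      (by omega) fun _ h => h) fun hb2 =>
    Run.ite (B := 3) (fun hb3 => skip _ (by omega) ?_) fun hb3 =>
    Run.ite (B := 2) (fun hb4 => Run.seq (B := 1) (B' := 1) (Run.setNat (Run.setNat ?_)))
      fun hb4 => skip _ (by omega) ?_
  all_goals
    simp only [Test.Holds, NatExp.eval, h26, h27, h28, h32, hK, hQ] at hb ⊢
    try simp only [Test.Holds, NatExp.eval, h26, h27, h32, hJ, Nat.succ_le_iff] at hb1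
    try simp only [Test.Holds, NatExp.eval, h26, h27, h32, hK, Nat.succ_le_iff] at hb2
    try simp only [Test.Holds, NatExp.eval, h26, h27, h32, hP, Nat.succ_le_iff] at hb3
    try simp only [Test.Holds, NatExp.eval, h26, h27, h32, hQ, Nat.succ_le_iff] at hb4
  · simp [DPTables.step, hm, hb, Memory.setNat_nat, h28]
  · simp [DPTables.step, hm, hb, hb1]
  · simp [DPTables.step, hm, hb, hb1, hb2, Memory.setNat_nat, h27, h32, hJ]
  · simp [DPTables.step, hm, hb, hb1, hb2, hb3]
  · simp [DPTables.step, hm, hb, hb1, hb2, hb3, hb4, Memory.setNat_nat, h27, h32, hP]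
  · simp [DPTables.step, hm, hb, hb1, hb2, hb3, hb4]

theorem run_search (hn : 0 < n) (hT : s.tables = T) (h0 : s.nat 0 0 0 = n)
    (h25 : s.nat 25 0 0 = a) (h26 : s.nat 26 0 0 = x) :
    Run W Code.search s (24 * (n ^ 1 * 1)) fun s' =>
      s'.nat 27 0 0 = ((T.step x)^[n] (a, a + n)).1 ∧
      s'.nat 28 0 0 = ((T.step x)^[n] (a, a + n)).2 := by
  refine (Run.seq (B := 1) (B' := 1 + 22 * (n ^ 1 * 1)) (Run.setNat (Run.seq (Run.setNat ?_)))).mono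
    (by simp; omega) fun _ h => h
  simp only [NatExp.eval, Memory.setNat_nat, h25, h0]
  norm_num only [false_and, if_false]
  obtain ⟨s1, hs1⟩ : ∃ s1, s1 = (s.setNat 27 0 0 a).setNat 28 0 0 (a + n) := ⟨_, rfl⟩
  rw [← hs1]
  have ne : ∀ c, c ≠ 27 → c ≠ 28 → s1.nat c = s.nat c := fun c h h' => by
    rw [hs1, Memory.setNat_nat_ne _ _ _ _ h', Memory.setNat_nat_ne _ _ _ _ h]
  have hT1 : s1.tables = T := by
    rw [hs1, tables_setNat _ _ _ _ (by decide), tables_setNat _ _ _ _ (by decide), hT]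
  have g27 : s1.nat 27 0 0 = a := by simp [hs1, Memory.setNat_nat]
  have g28 : s1.nat 28 0 0 = a + n := by simp [hs1]
  refine (Run.for_pow (n := n) (τ := 1) (k := 0) (B := 8) (l := 0) (b := n)
    (fun c s' => s'.nat 27 0 0 = ((T.step x)^[c] (a, a + n)).1 ∧
      s'.nat 28 0 0 = ((T.step x)^[c] (a, a + n)).2) hn le_rfl
    (by simp [NatExp.eval]) (by omega) (by omega) (by decide) ?_ ?_ ?_ ?_).imp fun _ h => h.1
  · intro s2 hf
    simp [NatExp.eval, hf.nat 0 (by decide), ne, h0]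
  · intro x s2 y h
    simpa [Memory.setNat_nat] using h
  · exact ⟨g27, g28⟩
  · rintro c s2 - hc hf h29 ⟨e1, e2⟩
    rw [Function.iterate_succ_apply']
    refine (run_step (T := T) ?_ ?_ e1 e2).mono (by simp) fun _ h => h
    · rw [← hT1]
      simp only [Memory.tables]
      rw [hf.real 15 (by decide), hf.real 16 (by decide), hf.real 17 (by decide),
        hf.real 18 (by decide), hf.nat 20 (by decide), hf.nat 21 (by decide),
        hf.nat 22 (by decide), hf.nat 23 (by decide), hf.nat 24 (by decide)]
    · rw [hf.nat 26 (by decide), ne 26 (by decide) (by decide), h26]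

/-- The output for the positions in `[a, x)`, where `g` gives the group of a position. The Steiner
vertices are numbered in the order of the first positions of their groups. -/
structure Written (T : DPTables) (a : ℕ) (g : ℕ → ℕ × ℕ) (π : ℕ → ℕ) (x x' : ℕ) (s : Memory) :
    Prop where
  cnt : s.nat 31 0 0 = Nat.count (fun y => a ≤ y ∧ (g y).1 = y) x'
  num : ∀ y < x', a ≤ y → (g y).1 = y →
    s.nat 30 0 y = Nat.count (fun y => a ≤ y ∧ (g y).1 = y) y
  pos : ∀ y < x', a ≤ y → (g y).1 = y →
    s.real 0 0 (Nat.count (fun y => a ≤ y ∧ (g y).1 = y) y) = T.steiner (g y) 0 ∧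
    s.real 1 0 (Nat.count (fun y => a ≤ y ∧ (g y).1 = y) y) = T.steiner (g y) 1
  parent : ∀ y < x, a ≤ y →
    s.nat 1 0 (π y) = Nat.count (fun y => a ≤ y ∧ (g y).1 = y) (g y).1 + 1

theorem Written.frame {s' : Memory} {g : ℕ → ℕ × ℕ} {π : ℕ → ℕ} {x' : ℕ}
    (h : Written T a g π x x' s) {A R : List ℕ} (hf : Frame A R s s')
    (hA : 1 ∉ A ∧ 30 ∉ A ∧ 31 ∉ A := by decide) (hR : 0 ∉ R ∧ 1 ∉ R := by decide) :
    Written T a g π x x' s' where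
  cnt := by rw [hf.nat 31 hA.2.2]; exact h.cnt
  num := by rw [hf.nat 30 hA.2.1]; exact h.num
  pos := by rw [hf.real 0 hR.1, hf.real 1 hR.2]; exact h.pos
  parent := by rw [hf.nat 1 hA.1]; exact h.parent

theorem run_create {g : ℕ → ℕ × ℕ} {π : ℕ → ℕ} (hT : s.tables = T) (hx : a ≤ x)
    (hg : (g x).1 ≤ x) (h26 : s.nat 26 0 0 = x) (h27 : s.nat 27 0 0 = (g x).1)
    (h28 : s.nat 28 0 0 = (g x).2) (hw : Written T a g π x x s) :
    Run W Code.create s 5 (Written T a g π x (x + 1)) := by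
  subst hT
  have hM : s.nat 24 = s.tables.M := rfl
  have hX : s.real 17 = s.tables.X := rfl
  have hY : s.real 18 = s.tables.Y := rfl
  refine Run.ite (B := 4) (fun hb => Run.seq (B := 1) (B' := 1 + (1 + 1)) (Run.setNat
    (Run.seq (Run.setReal (Run.seq (Run.setReal (Run.setNat ?_))))))) fun hb =>
    (Run.skip ?_).mono (by omega) fun _ h => h
  · simp only [Test.Holds, NatExp.eval, h26, h27] at hb
    have hhead : (g x).1 = x := le_antisymm hg hb
    simp only [RealExp.eval, NatExp.eval, Memory.setNat_nat, Memory.setReal_nat,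
      Memory.setReal_real, Memory.setNat_real, h26, hw.cnt, h27, h28]
    norm_num only [false_and, if_false]
    rw [hM, hX, hY]
    have lt : ∀ y < x, a ≤ y → (g y).1 = y → Nat.count (fun y => a ≤ y ∧ (g y).1 = y) y ≠
        Nat.count (fun y => a ≤ y ∧ (g y).1 = y) x := fun y hy h h' =>
      (Nat.count_strict_mono (p := fun y => a ≤ y ∧ (g y).1 = y) ⟨h, h'⟩ hy).ne
    constructor
    · rw [Nat.count_succ, if_pos ⟨hx, hhead⟩]
      simp
    · intro y hy h h'
      by_cases hyx : y = x
      · subst hyx; simp [Memory.setNat_nat]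
      · simp [Memory.setNat_nat, hyx, hw.num y (by omega) h h']
    · intro y hy h h'
      by_cases hyx : y = x
      · subst hyx; simp [Memory.setReal_real, DPTables.steiner]
      · have := hw.pos y (by omega) h h'
        simp [Memory.setReal_real, lt y (by omega) h h', this]
    · intro y hy h
      simp [Memory.setNat_nat, hw.parent y hy h]
  · simp only [Test.Holds, NatExp.eval, h26, h27, not_le] at hb
    have hne : (g x).1 ≠ x := hb.ne
    refine ⟨?_, fun y hy h h' => ?_, fun y hy h h' => ?_, hw.parent⟩
    · rw [Nat.count_succ, if_neg (fun h => hne h.2), hw.cnt, add_zero]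
    · have : y ≠ x := fun e => hne (e ▸ h')
      exact hw.num y (by omega) h h'
    · have : y ≠ x := fun e => hne (e ▸ h')
      exact hw.pos y (by omega) h h'

theorem run_write {π : ℕ → ℕ} (hn : 0 < n) (hT : s.tables = T) (h0 : s.nat 0 0 0 = n)
    (h25 : s.nat 25 0 0 = a) (h31 : s.nat 31 0 0 = 0) (hπ : ∀ y < a + n, s.nat 8 0 y = π y)
    (hinj : ∀ y y', a ≤ y → y < a + n → a ≤ y' → y' < a + n → π y = π y' → y = y')
    {g : ℕ → ℕ × ℕ} (hgdef : ∀ x, g x = (T.step x)^[n] (a, a + n))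
    (hg : ∀ x, a ≤ x → x < a + n → a ≤ (g x).1 ∧ (g x).1 ≤ x ∧ g (g x).1 = g x) :
    Run W Code.write s (67 * (n ^ 2 * 1)) fun s' =>
      s'.nat 0 0 0 = Nat.count (fun y => a ≤ y ∧ (g y).1 = y) (a + n) ∧
      Written T a g π (a + n) (a + n) s' := by
  have h1 : 1 ≤ n ^ 2 := Nat.one_le_iff_ne_zero.2 (by positivity)
  refine Run.mono (B := 66 * (n ^ 2 * 1) + 1) (Run.seq ?_) (by omega) fun _ h => h
  refine (Run.for_pow (n := n) (τ := 1) (k := 1) (B := 30) (l := a) (b := a + n)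
    (fun x => Written T a g π x x) hn le_rfl
    (by simp [NatExp.eval, h25]) (by omega) (by omega) (by decide) ?_ ?_ ?_ ?_).imp ?_
  · intro s1 hf
    simp [NatExp.eval, hf.nat 0 (by decide), hf.nat 25 (by decide), h0, h25]
  · intro x s1 y h
    exact h.frame (A := [26]) (R := [])
      ⟨fun c hc => Memory.setNat_nat_ne _ _ _ _ (by simpa using hc), fun _ _ => rfl⟩
  · refine ⟨?_, fun y hy h => by omega, fun y hy h => by omega, fun y hy h => by omega⟩
    rw [h31, eq_comm, Nat.count_eq_card_filter_range, Finset.card_eq_zero,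
      Finset.filter_eq_empty_iff]
    intro y hy h
    have := Finset.mem_range.1 hy
    omega
  · intro x s1 hax hx hf h26 hw
    obtain ⟨g1, g2, g3⟩ := hg x hax hx
    have hT1 : s1.tables = T := by
      rw [← hT]
      simp only [Memory.tables]
      rw [hf.real 15 (by decide), hf.real 16 (by decide), hf.real 17 (by decide),
        hf.real 18 (by decide), hf.nat 20 (by decide), hf.nat 21 (by decide),
        hf.nat 22 (by decide), hf.nat 23 (by decide), hf.nat 24 (by decide)]
    refine Run.mono (B := 24 * (n ^ 1 * 1) + (5 + 1)) (Run.seq ?_) (by simp; omega) fun _ h => h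
    refine (run_search hn hT1 ((congrFun₂ (hf.nat 0 (by decide)) 0 0).trans h0)
      ((congrFun₂ (hf.nat 25 (by decide)) 0 0).trans h25) h26).with_frame ?_
    rintro s2 hf2 ⟨e1, e2⟩
    rw [← hgdef] at e1 e2
    have hT2 : s2.tables = T := by
      rw [← hT1]
      simp only [Memory.tables]
      rw [hf2.real 15 (by decide), hf2.real 16 (by decide), hf2.real 17 (by decide),
        hf2.real 18 (by decide), hf2.nat 20 (by decide), hf2.nat 21 (by decide),
        hf2.nat 22 (by decide), hf2.nat 23 (by decide), hf2.nat 24 (by decide)]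
    refine Run.seq ((run_create hT2 hax g2
      ((congrFun₂ (hf2.nat 26 (by decide)) 0 0).trans h26) e1 e2 (hw.frame hf2)).with_frame ?_)
    intro s3 hf3 hw3
    refine Run.setNat ?_
    have f26 : s3.nat 26 0 0 = x := by
      rw [hf3.nat 26 (by decide), hf2.nat 26 (by decide), h26]
    have f27 : s3.nat 27 0 0 = (g x).1 := by rw [hf3.nat 27 (by decide), e1]
    have f8 : s3.nat 8 0 x = π x := by
      rw [hf3.nat 8 (by decide), hf2.nat 8 (by decide), hf.nat 8 (by decide), hπ x hx]
    simp only [NatExp.eval, f26, f27, f8]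
    rw [hw3.num (g x).1 (by omega) g1 (by rw [g3])]
    refine ⟨?_, ?_, hw3.pos, fun y hy h => ?_⟩
    · rw [Memory.setNat_nat_ne _ _ _ _ (by decide)]; exact hw3.cnt
    · rw [Memory.setNat_nat_ne _ _ _ _ (by decide)]; exact hw3.num
    · by_cases hyx : y = x
      · subst hyx; simp
      · have hne : π y ≠ π x := fun e => hyx (hinj y x h (by omega) hax hx e)
        simp [Memory.setNat_nat, hne, hw3.parent y (by omega) h]
  · rintro s1 ⟨hw, -⟩
    refine Run.setNat ⟨by simp [NatExp.eval, hw.cnt], hw.frame (A := [0]) (R := [])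
      ⟨fun c hc => Memory.setNat_nat_ne _ _ _ _ (by simpa using hc), fun _ _ => rfl⟩⟩

end Output

/-! ### Correctness and running time -/

section Window

variable {n : ℕ} {S : Fin n → Plane} {r m : Fin n}

theorem tourAt_injOn {s y y' : ℕ} (h1 : s ≤ y) (h2 : y < s + n) (h3 : s ≤ y') (h4 : y' < s + n)
    (h : tourAt S r m y = tourAt S r m y') : y = y' := by
  have e := congrArg (tourRank S r m) h
  rw [tourRank_tourAt, tourRank_tourAt] at e
  wlog hy : y ≤ y' generalizing y y'
  · exact (this h3 h4 h1 h2 h.symm e.symm (by omega)).symm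
  have hd := (Nat.modEq_iff_dvd' hy).1 e
  have := Nat.eq_zero_of_dvd_of_lt hd (by omega)
  omega

theorem image_tourAt_Ico (s : ℕ) :
    (Finset.Ico s (s + n)).image (tourAt S r m) = Finset.univ := by
  refine Finset.eq_univ_of_card _ ?_
  rw [Finset.card_image_of_injOn, Nat.card_Ico, Fintype.card_fin]
  · omega
  · intro y hy y' hy' h
    simp only [Finset.coe_Ico, Set.mem_Ico] at hy hy'
    exact tourAt_injOn hy.1 hy.2 hy'.1 hy'.2 h

theorem exists_tourAt_eq (s : ℕ) (j : Fin n) : ∃ y, s ≤ y ∧ y < s + n ∧ tourAt S r m y = j := by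
  have h : j ∈ (Finset.Ico s (s + n)).image (tourAt S r m) := by
    rw [image_tourAt_Ico]; exact Finset.mem_univ _
  obtain ⟨y, hy, rfl⟩ := Finset.mem_image.1 h
  exact ⟨y, (Finset.mem_Ico.1 hy).1, (Finset.mem_Ico.1 hy).2, rfl⟩

theorem sum_tourAt (s : ℕ) (f : Fin n → ℝ) :
    ∑ y ∈ Finset.Ico s (s + n), f (tourAt S r m y) = ∑ j, f j := by
  rw [← image_tourAt_Ico (S := S) (r := r) (m := m) s, Finset.sum_image]
  intro y hy y' hy' h
  simp only [Finset.coe_Ico, Set.mem_Ico] at hy hy'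
  exact tourAt_injOn hy.1 hy.2 hy'.1 hy'.2 h

/-- Some window of the tour has a value at most `1 + ε` times the optimum. If the window begins
between two groups, then a group with four arcs in the window also has four arcs on the cyclic tour;
so all groups have at most three arcs. -/
theorem DPTables.Correct.exists_window_le {W : WeberSolver} {ε : ℝ} {t : Plane} {pt : ℕ → Plane}
    {T : DPTables} (hT : T.Correct W ε t pt n 0) (hε : 0 ≤ 1 + ε)
    (hW : ∀ A, A ≠ [] → ∀ v, W.value ε t A ≤ (1 + ε) * starCost t A v)
    (hpt : ∀ x < n + n, pt x = S (tourAt S r m x))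
    {K : Set Plane} (hK : Convex ℝ K) (hSK : ∀ j, S j ∈ K) (hSi : ∀ j, S j ∉ interior K)
    (hfar : ∀ j, (S j 0 - S r 0) ^ 2 + (S j 1 - S r 1) ^ 2 ≤
      (S m 0 - S r 0) ^ 2 + (S m 1 - S r 1) ^ 2)
    {q : Fin n → Plane} {col : Fin n → Fin n} (h : Optimal K S t q col) :
    ∃ s < n, T.F s (s + n) ≤ (1 + ε) * assignCost S t col q := by
  have hn : 0 < n := r.pos
  have halt := fun {x y z u : ℕ} => alternating_tourAt hK hSK hSi hfar (x := x) (y := y) (z := z)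
    (u := u)
  have hper : ∀ x, col (tourAt S r m (x + n)) = col (tourAt S r m x) := fun x => by
    rw [tourAt_add]
  -- Either there is only one group, or some window begins between two groups.
  obtain ⟨s, hs, hstart⟩ : ∃ s < n, (∀ x, s ≤ x → x < s + n →
      col (tourAt S r m x) = col (tourAt S r m s)) ∨
      col (tourAt S r m s) ≠ col (tourAt S r m (s + n - 1)) := by
    by_cases hall : ∃ s < n, col (tourAt S r m s) ≠ col (tourAt S r m (s + n - 1))
    · obtain ⟨s, hs, h⟩ := hall
      exact ⟨s, hs, .inr h⟩
    · push Not at hall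
      refine ⟨0, hn, .inl fun x _ hx => ?_⟩
      have hx : x < n := by omega
      clear * - hx hall hper
      induction x with
      | zero => rfl
      | succ x ih =>
        rw [hall (x + 1) hx, show x + 1 + n - 1 = x + n by omega, hper, ih (by omega)]
  refine ⟨s, hs, ?_⟩
  refine (hT.F_le_of_noncrossing hε hW (fun x => col (tourAt S r m x)) q (s := s) (by omega)
    ?_ ?_ (a := s) (b := s + n) le_rfl (by omega) le_rfl fun x z _ _ h1 h2 _ => ⟨h1, h2⟩).trans ?_
  · intro x y z u h1 h2 h3 h4 h5 e1 e2
    by_contra hne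
    exact h.noncrossing hK hSK hSi e1 hne e2 (halt h2 h3 h4 (by omega))
  · intro x₁ x₂ x₃ x₄ y₁ y₂ y₃ h0 h1 h2 h3 h4 h5 h6 h7 c2 c3 c4 d1 d2 d3
    rcases hstart with hs' | hs'
    · exact d1 ((hs' y₁ (by omega) (by omega)).trans (hs' x₁ (by omega) (by omega)).symm)
    -- A fourth gap is met at one of the two ends of the window.
    obtain ⟨y₄, h8, h9, d4⟩ : ∃ y₄, x₄ < y₄ ∧ y₄ < x₁ + n ∧
        col (tourAt S r m y₄) ≠ col (tourAt S r m x₁) := by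
      by_cases hc : col (tourAt S r m s) = col (tourAt S r m x₁)
      · refine ⟨s + n - 1, ?_, by omega, fun e => hs' (hc.trans e.symm)⟩
        have : x₄ ≠ s + n - 1 := fun e => hs' (hc.trans (e ▸ c4.symm))
        omega
      · have : s ≠ x₁ := fun e => hc (e ▸ rfl)
        exact ⟨s + n, h7, by omega, by rwa [hper]⟩
    refine h.no_four_gaps hK hSK hSi (π := tourAt S r m) (fun j => ?_) (fun x => tourAt_add S r m x)
      halt h1 h2 h3 h4 h5 h6 h8 h9 c2 c3 c4 d1 d2 d3 d4
    obtain ⟨y, -, hy, rfl⟩ := exists_tourAt_eq (S := S) (r := r) (m := m) 0 j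
    exact ⟨y, by omega, rfl⟩
  · refine mul_le_mul_of_nonneg_left ?_ hε
    rw [Finset.sum_congr rfl fun x hx => by
      rw [hpt x (by have := (Finset.mem_Ico.1 hx).2; omega)],
      sum_tourAt s fun j => dist (S j) (q (col j)), assignCost]
    have := Finset.sum_le_univ_sum_of_nonneg (f := fun i => dist (q i) t)
      (s := (Finset.Ico s (s + n)).image fun x => col (tourAt S r m x)) fun _ => dist_nonneg
    linarith

end Window

theorem exists_count_eq {p : ℕ → Prop} [DecidablePred p] {j N : ℕ} (h : j < Nat.count p N) :
    ∃ y < N, p y ∧ Nat.count p y = j := by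
  induction N with
  | zero => simp at h
  | succ N ih =>
    by_cases hj : j < Nat.count p N
    · obtain ⟨y, hy, h'⟩ := ih hj
      exact ⟨y, by omega, h'⟩
    · rw [Nat.count_succ] at h
      by_cases hp : p N
      · rw [if_pos hp] at h
        exact ⟨N, by omega, hp, by omega⟩
      · rw [if_neg hp] at h
        omega

/-- The output is a layout, and its cost is the cost of the groups `g`. -/
theorem Written.exists_layout {I : Instance} (hτ : I.τ = 1) (hlam : I.lam = 1) (hα : I.α = 0)
    {t : Plane} (ht : ∀ k, I.sink k = t) {T : DPTables} {a : ℕ} {g : ℕ → ℕ × ℕ}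
    {π : ℕ → Fin I.n} {s : Memory} (hw : Written T a g (fun y => (π y : ℕ)) (a + I.n) (a + I.n) s)
    (h0 : s.nat 0 0 0 = Nat.count (fun y => a ≤ y ∧ (g y).1 = y) (a + I.n))
    (h2 : ∀ j, s.nat 2 0 j = 0)
    (hg : ∀ x, a ≤ x → x < a + I.n → a ≤ (g x).1 ∧ (g x).1 ≤ x ∧ g (g x).1 = g x)
    (hinj : ∀ {y y'}, a ≤ y → y < a + I.n → a ≤ y' → y' < a + I.n → π y = π y' → y = y')
    (hsurj : ∀ i, ∃ y, a ≤ y ∧ y < a + I.n ∧ π y = i) :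
    ∃ L : Layout I, L.IsOutput s ∧ L.cost = ∑ x ∈ Finset.Ico a (a + I.n),
      (dist (I.source (π x)) (T.steiner (g x)) +
        if (g x).1 = x then dist (T.steiner (g x)) t else 0) := by
  choose ι hι1 hι2 hι3 using hsurj
  have hιπ : ∀ y, a ≤ y → y < a + I.n → ι (π y) = y := fun y h h' =>
    hinj (hι1 _) (hι2 _) h h' (hι3 _)
  let m := Nat.count (fun y => a ≤ y ∧ (g y).1 = y) (a + I.n)
  have head : ∀ y, a ≤ y → y < a + I.n → a ≤ (g y).1 ∧ (g (g y).1).1 = (g y).1 := by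
    intro y h h'
    obtain ⟨h1, -, h3⟩ := hg y h h'
    exact ⟨h1, by rw [h3]⟩
  have hlt : ∀ i, Nat.count (fun y => a ≤ y ∧ (g y).1 = y) (g (ι i)).1 < m := by
    intro i
    refine Nat.count_strict_mono (p := fun y => a ≤ y ∧ (g y).1 = y)
      (head _ (hι1 i) (hι2 i)) ?_
    have := (hg _ (hι1 i) (hι2 i)).2.1
    have := hι2 i
    omega
  let P : ℕ → Plane := fun j => !₂[s.real 0 0 j, s.real 1 0 j]
  have hP : ∀ y, a ≤ y → y < a + I.n → (g y).1 = y →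
      P (Nat.count (fun y => a ≤ y ∧ (g y).1 = y) y) = T.steiner (g y) := by
    intro y h h' hy
    obtain ⟨e1, e2⟩ := hw.pos y h' h hy
    exact Plane.ext (by simpa [P] using e1) (by simpa [P] using e2)
  have hpar : Function.Surjective fun i =>
      (⟨Nat.count (fun y => a ≤ y ∧ (g y).1 = y) (g (ι i)).1, hlt i⟩ : Fin m) := by
    intro j
    obtain ⟨y, hy, ⟨hay, hgy⟩, hj⟩ := exists_count_eq j.isLt
    refine ⟨π y, Fin.ext ?_⟩
    simp only [hιπ y hay hy, hgy, hj]
  refine ⟨starLayout hlam ⟨0, by omega⟩ m _ hpar fun j => P j, ⟨h0, fun i => ?_, fun j => ?_,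
    fun j => ?_⟩, ?_⟩
  · have := hw.parent (ι i) (hι2 i) (hι1 i)
    simp only [hι3] at this
    rw [this]
    simp [starLayout, parentCode, hτ, add_comm]
  · rw [h2]
    rfl
  · simp [starLayout, P]
  · rw [starLayout_cost hlam hα, ht, Finset.sum_add_distrib]
    congr 1
    · symm
      refine Finset.sum_bij (fun y _ => π y) (fun _ _ => Finset.mem_univ _) ?_ ?_ ?_
      · intro y hy y' hy' h
        simp only [Finset.mem_Ico] at hy hy'
        exact hinj hy.1 hy.2 hy'.1 hy'.2 h
      · intro i _
        exact ⟨ι i, Finset.mem_Ico.2 ⟨hι1 i, hι2 i⟩, hι3 i⟩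
      · intro y hy
        obtain ⟨h1, h2⟩ := Finset.mem_Ico.1 hy
        simp only [hιπ y h1 h2]
        obtain ⟨g1, g2, g3⟩ := hg y h1 h2
        rw [hP _ g1 (by omega) (by rw [g3]), g3]
    · rw [← Finset.sum_filter]
      symm
      refine Finset.sum_bij (fun y hy => (⟨Nat.count (fun y => a ≤ y ∧ (g y).1 = y) y, ?_⟩ : Fin m))
        (fun _ _ => Finset.mem_univ _) ?_ ?_ ?_
      · simp only [Finset.mem_filter, Finset.mem_Ico] at hy
        exact Nat.count_strict_mono (p := fun y => a ≤ y ∧ (g y).1 = y) ⟨hy.1.1, hy.2⟩ hy.1.2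
      · intro y hy y' hy' h
        simp only [Finset.mem_filter, Finset.mem_Ico] at hy hy'
        exact Nat.count_injective (p := fun y => a ≤ y ∧ (g y).1 = y) ⟨hy.1.1, hy.2⟩
          ⟨hy'.1.1, hy'.2⟩ (Fin.mk.inj h)
      · intro j _
        obtain ⟨y, hy, ⟨hay, hgy⟩, hj⟩ := exists_count_eq j.isLt
        exact ⟨y, by simp only [Finset.mem_filter, Finset.mem_Ico]; exact ⟨⟨hay, hy⟩, hgy⟩,
          Fin.ext hj⟩
      · intro y hy
        simp only [Finset.mem_filter, Finset.mem_Ico] at hy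
        rw [hP y hy.1.1 hy.1.2 hy.2]

/-- The whole algorithm. -/
def Code.main : Program := .seq Code.prepare (.seq Code.dp (.seq Code.choose Code.write))

/-- Sorting, the choice of the window and the output take quadratic time; the dynamic program takes
the rest. -/
theorem run_main {W : WeberSolver} {T : ℕ → ℝ → ℕ} (hW : W.Correct T)
    (hmono : ∀ ε : ℝ, 0 < ε → Monotone fun k => T k ε)
    (hone : ∀ (k : ℕ) (ε : ℝ), 0 < k → 0 < ε → 1 ≤ T k ε) {ε : ℝ} (hε : 0 < ε) {I : Instance}
    (hI : I.IsConvex) (hn : 0 < I.n) (hτ : I.τ = 1) (hlam : I.lam = 1) (hα : I.α = 0) :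
    Run W Code.main (I.input ε) (1478 * (I.n ^ 6 * T I.n ε)) fun s =>
      ∃ L : Layout I, L.IsOutput s ∧ ∀ L' : Layout I, L.cost ≤ (1 + ε) * L'.cost := by
  obtain ⟨t, ht⟩ : ∃ t, ∀ k, I.sink k = t :=
    ⟨I.sink ⟨0, by omega⟩, fun k => congrArg _ (Fin.ext (by have := k.isLt; simp; omega))⟩
  have hT1 := hone I.n ε hn hε
  have h26 : I.n ^ 2 * 1 ≤ I.n ^ 6 * T I.n ε :=
    Nat.mul_le_mul (Nat.pow_le_pow_right hn (by omega)) hT1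
  have h16 : I.n ^ 1 * 1 ≤ I.n ^ 6 * T I.n ε :=
    Nat.mul_le_mul (Nat.pow_le_pow_right hn (by omega)) hT1
  refine Run.mono (B := 75 * (I.n ^ 2 * 1) + (1326 * (I.n ^ 6 * T I.n ε) + (10 * (I.n ^ 1 * 1) +
    67 * (I.n ^ 2 * 1)))) (Run.seq ?_) (by omega) fun _ h => h
  obtain ⟨s0, hs0⟩ : ∃ s0, s0 = I.input ε := ⟨_, rfl⟩
  rw [← hs0]
  have hS : Input I.source s0 :=
    ⟨by simp [hs0, Instance.input], fun j => by simp [hs0, Instance.input],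
      fun j => by simp [hs0, Instance.input]⟩
  have nat0 : ∀ a, a ≠ 0 → a ≠ 1 → ∀ i j, s0.nat a i j = 0 := fun a h h' i j => by
    simp [hs0, Instance.input, h, h']
  have real0 : ∀ a, 4 < a → ∀ i j, s0.real a i j = 0 := fun a h i j => by
    simp only [hs0, Instance.input]
    split_ifs <;> first | rfl | omega
  have e2 : s0.real 2 0 0 = t 0 := by
    rw [← ht ⟨0, by omega⟩]; simp [hs0, Instance.input, hτ]
  have e3 : s0.real 3 0 0 = t 1 := by
    rw [← ht ⟨0, by omega⟩]; simp [hs0, Instance.input, hτ]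
  have e4 : s0.real 4 0 0 = ε := by simp [hs0, Instance.input]
  refine (run_prepare (r := ⟨0, hn⟩) hS rfl (nat0 6 (by decide) (by decide) 0 0)
    (real0 5 (by decide) 0 0) (real0 6 (by decide) 0 0)).with_frame ?_
  rintro s1 hf1 ⟨g3, m, hfar, hplaced⟩
  obtain ⟨pt, hpt⟩ : ∃ pt : ℕ → Plane, ∀ x, pt x = !₂[s1.real 8 0 x, s1.real 9 0 x] :=
    ⟨_, fun _ => rfl⟩
  have hptS : ∀ x < I.n + I.n, pt x = I.source (tourAt I.source ⟨0, hn⟩ m x) := by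
    intro x hx
    have := hplaced x hx
    exact Plane.ext (by simp [hpt, this.x_eq]) (by simp [hpt, this.y_eq])
  have hS1 := hS.frame hf1
  refine Run.seq ((run_dp (ε := ε) (t := t) (pt := pt) hn hT1 (fun A hA hAn =>
    (hW ε hε t A hA).2.2.trans (hmono ε hε hAn)) ?_ ?_ ?_ hpt hS1.n_eq g3 ?_ ?_ ?_).with_frame ?_)
  · rw [hf1.real 4 (by decide), e4]
  · rw [hf1.real 2 (by decide), e2]
  · rw [hf1.real 3 (by decide), e3]
  · intro a b
    rw [hf1.real 15 (by decide), real0 15 (by decide)]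
  · intro a b
    rw [hf1.nat 20 (by decide), nat0 20 (by decide) (by decide)]
  · intro a b
    rw [hf1.nat 24 (by decide), nat0 24 (by decide) (by decide)]
  intro s2 hf2 hT
  have hS2 := hS1.frame hf2
  refine Run.seq ((run_choose hn hS2.n_eq ?_).with_frame ?_)
  · rw [hf2.nat 25 (by decide), hf1.nat 25 (by decide), nat0 25 (by decide) (by decide)]
  rintro s3 hf3 ⟨hlt, hbest⟩
  have hS3 := hS2.frame hf3
  obtain ⟨a, ha⟩ : ∃ a, a = s3.nat 25 0 0 := ⟨_, rfl⟩
  rw [← ha] at hlt hbest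
  have hT3 : s3.tables = s2.tables := by
    simp only [Memory.tables]
    rw [hf3.real 15 (by decide), hf3.real 16 (by decide), hf3.real 17 (by decide),
      hf3.real 18 (by decide), hf3.nat 20 (by decide), hf3.nat 21 (by decide),
      hf3.nat 22 (by decide), hf3.nat 23 (by decide), hf3.nat 24 (by decide)]
  obtain ⟨hg, hcost⟩ := hT.cost_le (fun A hA => (hW ε hε t A hA).1) (a := a) (b := a + I.n)
    (N := I.n) (by omega) le_rfl (by omega) le_rfl
  obtain ⟨g, hgdef⟩ : ∃ g : ℕ → ℕ × ℕ, ∀ x, g x = (s2.tables.step x)^[I.n] (a, a + I.n) :=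
    ⟨_, fun _ => rfl⟩
  simp only [← hgdef] at hg hcost
  refine (run_write (π := fun y => (tourAt I.source ⟨0, hn⟩ m y : ℕ)) hn hT3 hS3.n_eq ha.symm
    ?_ ?_ ?_ hgdef hg).with_frame ?_
  · rw [hf3.nat 31 (by decide), hf2.nat 31 (by decide), hf1.nat 31 (by decide),
      nat0 31 (by decide) (by decide)]
  · intro y hy
    rw [hf3.nat 8 (by decide), hf2.nat 8 (by decide), (hplaced y (by omega)).perm]
  · intro y y' h1 h2 h3 h4 h
    exact tourAt_injOn h1 h2 h3 h4 (Fin.ext h)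
  rintro s4 hf4 ⟨h0, hw⟩
  obtain ⟨L, hL, hLcost⟩ := hw.exists_layout hτ hlam hα ht h0 (fun j => by
      rw [hf4.nat 2 (by decide), hf3.nat 2 (by decide), hf2.nat 2 (by decide),
        hf1.nat 2 (by decide), nat0 2 (by decide) (by decide)]) hg
    (fun h1 h2 h3 h4 h => tourAt_injOn h1 h2 h3 h4 h) (fun i => exists_tourAt_eq a i)
  refine ⟨L, hL, fun L' => ?_⟩
  have hle : L.cost ≤ s2.real 15 a (a + I.n) := by
    rw [hLcost]
    refine le_trans (le_of_eq (Finset.sum_congr rfl fun x hx => ?_)) hcost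
    rw [hptS x (by have := (Finset.mem_Ico.1 hx).2; omega)]
  -- The optimum is attained by Steiner points in the convex hull.
  obtain ⟨K, hKdef⟩ : ∃ K, K = convexHull ℝ (Set.range I.source ∪ Set.range I.sink) := ⟨_, rfl⟩
  have hK : Convex ℝ K := hKdef ▸ convex_convexHull ℝ _
  have hKc : IsCompact K :=
    hKdef ▸ ((Set.finite_range _).union (Set.finite_range _)).isCompact_convexHull ℝ
  have hSK : ∀ j, I.source j ∈ K := fun j =>
    hKdef ▸ subset_convexHull ℝ _ (.inl ⟨j, rfl⟩)
  have htK : t ∈ K := hKdef ▸ subset_convexHull ℝ _ (.inr ⟨⟨0, by omega⟩, ht _⟩)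
  have hSi : ∀ j, I.source j ∉ interior K := fun j => by
    have := hI j
    rw [← hKdef] at this
    exact this.2
  obtain ⟨q, col, hopt⟩ := exists_optimal hK hKc htK hSK
  obtain ⟨s, hs, hwin⟩ := hT.exists_window_le (by linarith) (fun A hA => (hW ε hε t A hA).2.1)
    hptS hK hSK hSi hfar hopt
  obtain ⟨g', q', hL'⟩ := L'.exists_assignCost_le hlam hα ht
  calc L.cost ≤ s2.real 15 a (a + I.n) := hle
    _ ≤ s2.real 15 s (s + I.n) := hbest s hs
    _ ≤ (1 + ε) * assignCost I.source t col q := hwin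
    _ ≤ (1 + ε) * L'.cost :=
      mul_le_mul_of_nonneg_left ((hopt.le g' q').trans hL') (by linarith)

end Flamecast

theorem mainTheorem9 :
    ∃ (P : Flamecast.Program) (C : ℕ),
      ∀ (W : Flamecast.WeberSolver) (T : ℕ → ℝ → ℕ),
        W.Correct T →
        (∀ ε : ℝ, 0 < ε → Monotone fun k => T k ε) →
        (∀ (k : ℕ) (ε : ℝ), 0 < k → 0 < ε → 1 ≤ T k ε) →
        ∀ (ε : ℝ), 0 < ε →
        ∀ (I : Flamecast.Instance), I.IsConvex → 0 < I.n → I.τ = 1 → I.lam = 1 →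
          (∀ i, I.cap i = ⊤) → I.α = 0 →
          ∃ (s : Flamecast.Memory) (k : ℕ),
            Flamecast.Exec W P (I.input ε) s k ∧
            k ≤ C * I.n ^ 6 * T I.n ε ∧
            ∃ L : Flamecast.Layout I, L.IsOutput s ∧ L.Valid ∧
              ∀ L' : Flamecast.Layout I, L'.Valid → L.cost ≤ (1 + ε) * L'.cost := by
  refine ⟨Flamecast.Code.main, 1478, ?_⟩
  intro W T hW hmono hone ε hε I hI hn hτ hlam hcap hα
  obtain ⟨s, k, h1, h2, L, h3, h4⟩ := Flamecast.run_main hW hmono hone hε hI hn hτ hlam hα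
  refine ⟨s, k, h1, by rwa [mul_assoc], L, h3, fun u i _ => ?_, fun L' _ => h4 L'⟩
  rw [hcap i]
  exact le_top
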